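/- **Setting.** Rings are unital. Let $S$ be a ring and $R\subseteq S$ a subring with $1_R=1_S$, where $R$ has invariant basis number; for a finitely generated free left $R$-module $M\cong R^d$ write $\dim M=d$. *Rank functions.* A Sylvester matrix rank function for a ring $R$ is an $\mathbb R_{\ge 0}$-valued function $\mathrm{rk}$ on all rectangular matrices over $R$ with $\mathrm{rk}(0)=0$, $\mathrm{rk}(1_R)=1$, $\mathrm{rk}(AB)\le\min(\mathrm{rk}(A),\mathrm{rk}(B))$, $\mathrm{rk}\begin{bmatrix}A&0\\0&B\end{bmatrix}=\mathrm{rk}(A)+\mathrm{rk}(B)$ and $\mathrm{rk}\begin{bmatrix}A&C\\0&B\end{bmatrix}\ge\mathrm{rk}(A)+\mathrm{rk}(B)$. The set $\mathbb P(R)$ of all of them carries pointwise operations and the topology of pointwise convergence. *Amenable normal extensions.* Let $\mathcal F$ be a collection of left $R$-submodules of $S$ and $\hat{\mathcal F}$ the set of its nonzero members. $\mathcal F$ is a finite approximation system if: each $\mathcal W\in\mathcal F$ is finitely generated and free; $\mathcal F$ is closed under $\cap$ and $+$; if $\mathcal V\subseteq\mathcal W$ are in $\mathcal F$ then $\mathcal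 W=\mathcal V\oplus\mathcal V'$ for some $\mathcal V'\in\mathcal F$; every finitely generated left $R$-submodule of $S$ lies in a member of $\mathcal F$. For a finite set $V\subseteq S$ and $\varepsilon>0$, $\mathcal W\in\hat{\mathcal F}$ is $(V,\varepsilon)$-invariant if $\dim\tilde{\mathcal W}\le(1+\varepsilon)\dim\mathcal W$ for some $\tilde{\mathcal W}\in\mathcal F$ containing $\mathcal W+\mathcal WV$. Let $N_S(R)$ be the set of non-zero-divisors $g\ne0$ of $S$ with $gR=Rg$, and for $g\in N_S(R)$ let $\sigma_g$ be the automorphism of $R$ with $ga=\sigma_g(a)g$. $S$ is a right amenable normal extension of $R$ with $(\mathcal F,\mathcal U)$ if $\mathcal F$ is a finite approximation system which for every finite $V\subseteq S$ and $\varepsilon>0$ contains a $(V,\varepsilon)$-invariant member of $\hat{\mathcal F}$, and $\mathcal U\subseteq N_S(R)$ is a multiplicative set (containing $1$) such that each $\mathcal W\in\mathcal F$ has an $R$-basis in $\mathcal U$; $Rg\in\mathcal F$ for $g\in\mathcal U$; and $\{x\in S: xg\in\mathcal W\}\in\mathcal F$ whenever $g\in\mathcal U$, $\mathcal W\in\mathcal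 F$ and $\mathcal W\subseteq Sg$. Let $\mathbb P_{\mathcal U}(R)$ be the set of $\mathrm{rk}\in\mathbb P(R)$ that are $\sigma_g$-invariant for all $g\in\mathcal U$. *Weak quasitiling.* For $\mathcal V\in\mathcal F$ and $\delta>0$, $\mathcal W\in\hat{\mathcal F}$ is $(\mathcal V,\delta)$-invariant if $\dim(\mathcal W+\mathcal W\mathcal V)\le(1+\delta)\dim\mathcal W$. The pair $(\mathcal F,\mathcal U)$ has the weak quasitiling property if for all $0<\varepsilon<1$ and $\mathcal V\in\hat{\mathcal F}$ there are $n\in\mathbb N$ and $(\mathcal V,\varepsilon)$-invariant $\mathcal W_1,\dots,\mathcal W_n\in\hat{\mathcal F}$ such that for all $\delta>0$ and $\mathcal V'\in\hat{\mathcal F}$ there are a $(\mathcal V',\delta)$-invariant $\mathcal W\in\hat{\mathcal F}$, sets $C_1,\dots,C_n\subseteq\mathcal U\cap\mathcal W$ and $\mathcal W_{j,c}\in\mathcal F$ ($1\le j\le n$, $c\in C_j$) with: $\mathcal W_{j,c}\subseteq\mathcal W_j$ and $\dim\mathcal W_{j,c}\ge(1-\varepsilon)\dim\mathcal W_j$;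 the modules $c\mathcal W_{j,c}$ (over all $j$ and $c\in C_j$) are linearly independent; $\sum_{j}\sum_{c\in C_j}c\mathcal W_j$ is contained in $\mathcal W$ and has dimension at least $(1-\varepsilon)\dim\mathcal W$. *The extension $\mathrm{rk}_{\mathcal F}$.* Let $\mathrm{rk}\in\mathbb P(R)$, $A\in M_{n,m}(S)$ and $\mathcal W\in\hat{\mathcal F}$. Choose $\tilde{\mathcal W}\in\hat{\mathcal F}$ with $\mathcal WA_{i,j}\subseteq\tilde{\mathcal W}$ for all $i,j$, and set $\mathrm{rk}_{\mathcal W}(A)=\mathrm{rk}(B)$, where $B$ is the matrix over $R$ of the map $\mathcal W^n\to\tilde{\mathcal W}^m$, $x\mapsto xA$, in some $R$-bases (all choices give the same value). An ultrafilter $\omega$ on $\hat{\mathcal F}$ is non-principal if it contains the set of $(V,\varepsilon)$-invariant $\mathcal W$ for every finite $V\subseteq S$ and $\varepsilon>0$. Put $\mathrm{rk}_{\mathcal F}(A)=\lim_{\mathcal W\to\omega}\mathrm{rk}_{\mathcal W}(A)/\dim\mathcal W$ for a non-principal ultrafilter $\omega$. **Theorem.** Let $S$ be a right amenable normal extension of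 $R$ with $(\mathcal F,\mathcal U)$, and suppose that $(\mathcal F,\mathcal U)$ has the weak quasitiling property. Then $\mathbb P_{\mathcal U}(R)$ is compact and convex, $\mathbb P(S)$ is convex, and for $\mathrm{rk}\in\mathbb P_{\mathcal U}(R)$ the function $\mathrm{rk}_{\mathcal F}$ is well defined: non-principal ultrafilters on $\hat{\mathcal F}$ exist, the limits defining $\mathrm{rk}_{\mathcal F}$ exist, and they do not depend on the non-principal ultrafilter. Moreover $\mathrm{rk}_{\mathcal F}\in\mathbb P(S)$, and the map $\mathbb P_{\mathcal U}(R)\to\mathbb P(S)$, $\mathrm{rk}\mapsto\mathrm{rk}_{\mathcal F}$, is affine, i.e. $(t\,\mathrm{rk}_1+(1-t)\,\mathrm{rk}_2)_{\mathcal F}=t(\mathrm{rk}_1)_{\mathcal F}+(1-t)(\mathrm{rk}_2)_{\mathcal F}$ for $0\le t\le1$, and continuous. -/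

import Mathlib

open Filter Topology

namespace SylvesterRank

noncomputable section

/-! ### Sylvester matrix rank functions -/

section RankFunctions

variable (R : Type*) [Ring R]

/-- Real-valued functions on the set of all rectangular matrices over `R`, with the pointwise real
vector space structure and the topology of pointwise convergence. -/
abbrev MatrixFunction := ∀ n m : ℕ, Matrix (Fin n) (Fin m) R → ℝ

variable {R}

/-- The block matrix `[A C; D B]`. -/
def blockMatrix {n m n' m' : ℕ} (A : Matrix (Fin n) (Fin m) R) (C : Matrix (Fin n) (Fin m') R)
    (D : Matrix (Fin n') (Fin m) R) (B : Matrix (Fin n') (Fin m') R) :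
    Matrix (Fin (n + n')) (Fin (m + m')) R :=
  Matrix.reindex finSumFinEquiv finSumFinEquiv (Matrix.fromBlocks A C D B)

/-- Sylvester matrix rank functions, in the sense of Malcolmson. -/
structure IsSylvester (rk : MatrixFunction R) : Prop where
  nonneg : ∀ (n m : ℕ) (A : Matrix (Fin n) (Fin m) R), 0 ≤ rk n m A
  zero : ∀ n m : ℕ, rk n m 0 = 0
  one : rk 1 1 1 = 1
  mul_le : ∀ (n m l : ℕ) (A : Matrix (Fin n) (Fin m) R) (B : Matrix (Fin m) (Fin l) R),
    rk n l (A * B) ≤ min (rk n m A) (rk m l B)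
  diag : ∀ (n m n' m' : ℕ) (A : Matrix (Fin n) (Fin m) R) (B : Matrix (Fin n') (Fin m') R),
    rk (n + n') (m + m') (blockMatrix A 0 0 B) = rk n m A + rk n' m' B
  upper : ∀ (n m n' m' : ℕ) (A : Matrix (Fin n) (Fin m) R) (C : Matrix (Fin n) (Fin m') R)
    (B : Matrix (Fin n') (Fin m') R),
    rk n m A + rk n' m' B ≤ rk (n + n') (m + m') (blockMatrix A C 0 B)

variable (R) in
/-- The space `ℙ(R)` of all Sylvester matrix rank functions for `R`. -/
def rankSpace : Set (MatrixFunction R) := {rk | IsSylvester rk}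

/-- The rank of a finitely generated free module over a ring with invariant basis number: the
unique `n` with `M ≃ Rⁿ`. (`Module.finrank` is a supremum over linearly independent families, and
differs from this number for some rings with invariant basis number.) -/
def freeDim (R M : Type*) [Ring R] [AddCommGroup M] [Module R M] : ℕ :=
  sInf {n : ℕ | Nonempty (M ≃ₗ[R] (Fin n → R))}

end RankFunctions

/-! ### Amenable extensions -/

variable {S : Type*} [Ring S] {R : Subring S}

/-- Finite approximation systems: `F` is a collection of left `R`-submodules of `S`. -/
structure IsFiniteApproximationSystem (F : Set (Submodule R S)) : Prop where
  free : ∀ W ∈ F, Module.Finite R W ∧ Module.Free R W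
  inf_mem : ∀ W ∈ F, ∀ V ∈ F, W ⊓ V ∈ F
  sup_mem : ∀ W ∈ F, ∀ V ∈ F, W ⊔ V ∈ F
  exists_compl : ∀ W ∈ F, ∀ V ∈ F, V ≤ W → ∃ V' ∈ F, Disjoint V V' ∧ V ⊔ V' = W
  exists_le : ∀ M : Submodule R S, M.FG → ∃ W ∈ F, M ≤ W

/-- The set of nonzero elements of `F`. -/
def nonzeroPart (F : Set (Submodule R S)) : Set (Submodule R S) := {W | W ∈ F ∧ W ≠ ⊥}

/-- `W` is `(V, ε)`-invariant, for a finite set `V` of elements of `S`: some `W'` in `F` contains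
`W + W V` and has `dim W' ≤ (1 + ε) dim W`. -/
def IsInvariant (F : Set (Submodule R S)) (V : Finset S) (ε : ℝ) (W : Submodule R S) : Prop :=
  ∃ W' ∈ F, W ≤ W' ∧ (∀ w ∈ W, ∀ v ∈ V, w * v ∈ W') ∧
    (freeDim R W' : ℝ) ≤ (1 + ε) * freeDim R W

/-- `S` is a right amenable extension of `R` with finite approximation system `F`. -/
structure IsRightAmenable (F : Set (Submodule R S)) : Prop
    extends IsFiniteApproximationSystem F where
  exists_invariant : ∀ (V : Finset S) (ε : ℝ), 0 < ε → ∃ W ∈ nonzeroPart F, IsInvariant F V ε W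

/-! ### Normal extensions -/

variable (R) in
/-- The set `N_S(R)` of non-zero-divisors `g` of `S` with `g R = R g`. -/
def normalizing : Set S :=
  {g | g ∈ nonZeroDivisors S ∧ (fun a : S => g * a) '' (R : Set S) = (fun a : S => a * g) '' R}

theorem exists_conj {g : S} (hg : g ∈ normalizing R) (a : R) : ∃ b : R, g * a = b * g := by
  have h : g * (a : S) ∈ (fun a : S => a * g) '' (R : Set S) := hg.2 ▸ ⟨a, a.2, rfl⟩
  obtain ⟨b, hb, h⟩ := h
  exact ⟨⟨b, hb⟩, h.symm⟩

/-- The automorphism `σ_g` of `R`, determined by `g a = σ_g(a) g`. -/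
def conj {g : S} (hg : g ∈ normalizing R) (a : R) : R := (exists_conj hg a).choose

/-- Right multiplication by `g`, as a map of left `R`-modules. -/
def rightMul (R : Subring S) (g : S) : S →ₗ[R] S where
  toFun x := x * g
  map_add' x y := add_mul x y g
  map_smul' r x := smul_mul_assoc r x g

/-- `F` is normal with respect to the multiplicative set `U`. -/
structure IsNormal (F : Set (Submodule R S)) (U : Submonoid S) : Prop where
  le_normalizing : ∀ g ∈ U, g ∈ normalizing R
  exists_basis : ∀ W ∈ F, ∃ (n : ℕ) (b : Module.Basis (Fin n) R W), ∀ i, (b i : S) ∈ U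
  span_mem : ∀ g ∈ U, Submodule.span R {g} ∈ F
  comap_mem : ∀ g ∈ U, ∀ W ∈ F, W ≤ LinearMap.range (rightMul R g) → W.comap (rightMul R g) ∈ F

/-- `S` is a right amenable normal extension of `R` with `F` and `U`. -/
structure IsRightAmenableNormal (F : Set (Submodule R S)) (U : Submonoid S) : Prop
    extends IsRightAmenable F, IsNormal F U

/-- The set `ℙ_U(R)` of Sylvester matrix rank functions for `R` that are `σ_g`-invariant for every
`g` in `U`. -/
def invariantRankSpace (R : Subring S) (U : Submonoid S) : Set (MatrixFunction R) :=
  {rk | rk ∈ rankSpace R ∧ ∀ g ∈ U, ∀ (hg : g ∈ normalizing R) (n m : ℕ)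
    (A : Matrix (Fin n) (Fin m) R), rk n m (A.map (conj hg)) = rk n m A}

/-! ### The extended rank function -/

/-- `B` is a matrix over `R` of the left `R`-linear map `Wⁿ → W'ᵐ`, `x ↦ x A`, with respect to some
bases of `Wⁿ` and `W'ᵐ` (rows of length `n` and `m`). -/
def Represents (W W' : Submodule R S) {n m l p : ℕ} (A : Matrix (Fin n) (Fin m) S)
    (B : Matrix (Fin l) (Fin p) R) : Prop :=
  ∃ (w : Module.Basis (Fin l) R (Fin n → W)) (w' : Module.Basis (Fin p) R (Fin m → W')),
    ∀ (i : Fin l) (j : Fin m),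
      ∑ a, (w i a : S) * A a j = ∑ k, (B i k : S) * (w' k j : S)

/-- The pairs `(W', B)` that may be used to compute `rk_W(A)`. -/
def IsPresentation (F : Set (Submodule R S)) (W : Submodule R S) {n m : ℕ}
    (A : Matrix (Fin n) (Fin m) S)
    (x : Submodule R S × Σ l p : ℕ, Matrix (Fin l) (Fin p) R) : Prop :=
  x.1 ∈ nonzeroPart F ∧ (∀ i j, ∀ w ∈ W, w * A i j ∈ x.1) ∧ Represents W x.1 A x.2.2.2

open Classical in
/-- `rk_W(A) = rk(B)`, where `B` represents `x ↦ x A` from `Wⁿ` to `W'ᵐ` for some nonzero `W'` in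
`F` with `W A_{ij} ⊆ W'` for all `i, j`. -/
def rankOn (F : Set (Submodule R S)) (rk : MatrixFunction R) (W : Submodule R S) {n m : ℕ}
    (A : Matrix (Fin n) (Fin m) S) : ℝ :=
  if h : ∃ x, IsPresentation F W A x then rk _ _ h.choose.2.2.2 else 0

/-- An ultrafilter on the nonzero elements of `F` is non-principal if it contains the set of all
`(V, ε)`-invariant elements, for every finite `V ⊆ S` and `ε > 0`. -/
def IsNonprincipal (F : Set (Submodule R S)) (ω : Ultrafilter (nonzeroPart F)) : Prop :=
  ∀ (V : Finset S) (ε : ℝ), 0 < ε → {W : nonzeroPart F | IsInvariant F V ε W.1} ∈ ω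

/-- The normalized rank `rk_W(A) / dim W`. -/
def normalizedRank (F : Set (Submodule R S)) (rk : MatrixFunction R) {n m : ℕ}
    (A : Matrix (Fin n) (Fin m) S) (W : nonzeroPart F) : ℝ :=
  rankOn F rk W.1 A / freeDim R W.1

/-- `rk_F(A)`, the limit of `rk_W(A) / dim W` along the ultrafilter `ω`. -/
def extendedRank (F : Set (Submodule R S)) (ω : Ultrafilter (nonzeroPart F))
    (rk : MatrixFunction R) : MatrixFunction S :=
  fun _ _ A => limUnder (ω : Filter (nonzeroPart F)) (normalizedRank F rk A)

/-! ### The weak quasitiling property -/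

/-- `W` is `(V, δ)`-invariant for a left `R`-submodule `V` of `S`:
`dim (W + W V) ≤ (1 + δ) dim W`. -/
def IsSubmoduleInvariant (V : Submodule R S) (δ : ℝ) (W : Submodule R S) : Prop :=
  (freeDim R (W ⊔ W * V : Submodule R S) : ℝ) ≤ (1 + δ) * freeDim R W

/-- The left `R`-module `c W`. When `c R = R c`, the set of all `c w` with `w` in `W` is already
an `R`-submodule. -/
def leftTranslate (c : S) (W : Submodule R S) : Submodule R S :=
  Submodule.span R ((fun w => c * w) '' (W : Set S))

/-- `W` can be `ε`-quasitiled by the `T j`, with centres `C j` and parts `D j c` of `T j`. -/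
def IsQuasitiled (F : Set (Submodule R S)) (U : Submonoid S) (ε : ℝ) {n : ℕ}
    (T : Fin n → Submodule R S) (W : Submodule R S) : Prop :=
  ∃ (C : Fin n → Set S) (D : Fin n → S → Submodule R S),
    (∀ j, C j ⊆ (U : Set S) ∩ W) ∧
    (∀ j, ∀ c ∈ C j, D j c ∈ F) ∧
    (∀ j, ∀ c ∈ C j, D j c ≤ T j ∧ (1 - ε) * freeDim R (T j) ≤ freeDim R (D j c)) ∧
    iSupIndep (fun x : Σ j, C j => leftTranslate (x.2 : S) (D x.1 x.2)) ∧
    (⨆ x : Σ j, C j, leftTranslate (x.2 : S) (T x.1)) ≤ W ∧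
    (1 - ε) * freeDim R W ≤
      freeDim R (⨆ x : Σ j, C j, leftTranslate (x.2 : S) (T x.1) : Submodule R S)

/-- The weak quasitiling property of `(F, U)`. -/
def WeakQuasitiling (F : Set (Submodule R S)) (U : Submonoid S) : Prop :=
  ∀ ε : ℝ, 0 < ε → ε < 1 → ∀ V ∈ nonzeroPart F,
    ∃ (n : ℕ) (T : Fin n → Submodule R S),
      (∀ j, T j ∈ nonzeroPart F ∧ IsSubmoduleInvariant V ε (T j)) ∧
      ∀ δ : ℝ, 0 < δ → ∀ V' ∈ nonzeroPart F,
        ∃ W ∈ nonzeroPart F, IsSubmoduleInvariant V' δ W ∧ IsQuasitiled F U ε T W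

end

end SylvesterRank

/-! Fix a matrix $A$ with $n$ rows and an invariant rk, and put $\varphi(W)=\mathrm{rk}_W(A)$. The
Sylvester axioms make $\varphi$ monotone, submodular and Lipschitz in $\dim W$ with constant $n$
(`rankOn_sup_add_inf_le`, `rankOn_lipschitz`). Invariance gives $\varphi(gW)=\varphi(W)$, because
the matrix for $gW$ is the $\sigma_g$-image of the one for $W$. Well-definedness then follows from
an infimum rule for such functions (`IsLeftSaturated.exists_limit`): $\varphi(W)/\dim W$ is close to
one number $l$ once $W$ is invariant enough. Quasitilings play no role in this; they serve only for
continuity.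

Infimum rule. Let $l$ be the infimum of $\varphi(T)/\dim T$ over a suitable family. Take $T$ nearly
attaining it and, inside a slight enlargement of an invariant $W$, a $Y$ of maximal dimension with
$\varphi(Y)\le(l+\theta)\dim Y$. By submodularity a translate $cT$ that enlarges $Y$ by more than
$\theta\dim T$ could be added to $Y$; so $Y$ almost contains all $cT$ with $c$ in $WC$, for an
auxiliary $C$. It remains to see that $Y$ is almost as large as $WC$. For a group this is a double
count of pairs $(c,t)$ with $ct\in Y$, but here the part of $T$ taken into $Y$ varies with $c$ and
need not be spanned by part of a fixed basis.

The remedy is to treat $F$ as a projective geometry with points $Ru$, $u\in U$. Points are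
perspective if they are equal or their line carries a third point. This is an equivalence relation,
and different classes are independent. For $E$ with pairwise perspective points, a bounded-rank
argument (`IsLeftSaturated.exists_rank_or_mul_le`) shows: if each point of $E$ has rank at most $t$
on $W$ modulo $Y$, then the points $w$ of $W$ with $\dim(Ew\cap Y)\ge\dim E-(\dim W)^2$ span all but
$2t$ dimensions. Now pairs of classes can be counted (`card_mul_le_of_perspective`). The error
$(\dim W)^2$ is negligible if such $E$ have unbounded dimension; otherwise only members of $F$ made
of whole classes are used, and the error disappears. These are the two constructions of an
`IsCoveringFamily`.

The rank argument divides on the left by points, which normality does not allow. Hence $F$ and $U$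
are replaced by `saturation` and `saturatedSubmonoid`; the Ore condition, a consequence of
amenability, carries the axioms over.

Continuity at $\mathrm{rk}_0$. Weak quasitiling fixes finitely many tiles, invariant enough that
their normalized ranks for $\mathrm{rk}_0$ are near the limit. Ranks on the tiles vary continuously.
For nearby rk take $W$, invariant enough for rk, tiled by the same tiles: $\mathrm{rk}_W(A)$ is
nearly the sum over the tiles, from above by subadditivity and from below by independence of the
parts. -/

namespace SylvesterRank

noncomputable section

/-! ### The rank of a linear map between finitely generated free modules -/

section LinRank

variable {R : Type*} [Ring R]
variable {M N P M' N' : Type*} [AddCommGroup M] [Module R M] [AddCommGroup N] [Module R N]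
  [AddCommGroup P] [Module R P] [AddCommGroup M'] [Module R M'] [AddCommGroup N'] [Module R N']

/-- The matrix of a linear map, in the row convention. -/
def coordMatrix {l p : ℕ} (b : Module.Basis (Fin l) R M) (b' : Module.Basis (Fin p) R N)
    (f : M →ₗ[R] N) : Matrix (Fin l) (Fin p) R :=
  fun i k => b'.repr (f (b i)) k

theorem coordMatrix_comp {l p q : ℕ} (b : Module.Basis (Fin l) R M)
    (b' : Module.Basis (Fin p) R N) (b'' : Module.Basis (Fin q) R P) (f : M →ₗ[R] N)
    (g : N →ₗ[R] P) :
    coordMatrix b b'' (g ∘ₗ f) = coordMatrix b b' f * coordMatrix b' b'' g := by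
  ext i k
  have h : f (b i) = ∑ j, b'.repr (f (b i)) j • b' j := (b'.sum_repr _).symm
  simp only [coordMatrix, LinearMap.comp_apply, Matrix.mul_apply]
  conv_lhs => rw [h]
  rw [map_sum, map_sum, Finsupp.finsetSum_apply]
  simp only [map_smul, Finsupp.smul_apply, smul_eq_mul]

theorem coordMatrix_id {l : ℕ} (b : Module.Basis (Fin l) R M) :
    coordMatrix b b LinearMap.id = 1 := by
  ext i k
  simp [coordMatrix, Finsupp.single_apply, Matrix.one_apply]

/-- Through this dictionary both block axioms pass to linear maps; `g = 0` is the diagonal case. -/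
theorem coordMatrix_prod {l p l' p' : ℕ} (b : Module.Basis (Fin l) R M)
    (c : Module.Basis (Fin p) R N) (b' : Module.Basis (Fin l') R M')
    (c' : Module.Basis (Fin p') R N') (f : M →ₗ[R] N) (g : M →ₗ[R] N') (f' : M' →ₗ[R] N') :
    coordMatrix ((b.prod b').reindex finSumFinEquiv) ((c.prod c').reindex finSumFinEquiv)
      ((f ∘ₗ LinearMap.fst R M M').prod (g ∘ₗ LinearMap.fst R M M' + f' ∘ₗ LinearMap.snd R M M'))
      = blockMatrix (coordMatrix b c f) (coordMatrix b c' g) 0 (coordMatrix b' c' f') := by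
  ext i k
  obtain ⟨i, rfl⟩ := finSumFinEquiv.surjective i
  obtain ⟨k, rfl⟩ := finSumFinEquiv.surjective k
  rcases i with i | i <;> rcases k with k | k <;>
    simp [coordMatrix, blockMatrix, Matrix.reindex_apply]

theorem IsSylvester.mul_le_left {rk : MatrixFunction R} (h : IsSylvester rk) {n m l : ℕ}
    (A : Matrix (Fin n) (Fin m) R) (B : Matrix (Fin m) (Fin l) R) :
    rk n l (A * B) ≤ rk n m A := (h.mul_le _ _ _ A B).trans (min_le_left _ _)

theorem IsSylvester.mul_le_right {rk : MatrixFunction R} (h : IsSylvester rk) {n m l : ℕ}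
    (A : Matrix (Fin n) (Fin m) R) (B : Matrix (Fin m) (Fin l) R) :
    rk n l (A * B) ≤ rk m l B := (h.mul_le _ _ _ A B).trans (min_le_right _ _)

theorem IsSylvester.coordMatrix_le {rk : MatrixFunction R} (h : IsSylvester rk) {l p l' p' : ℕ}
    (b : Module.Basis (Fin l) R M) (b' : Module.Basis (Fin p) R N)
    (c : Module.Basis (Fin l') R M) (c' : Module.Basis (Fin p') R N) (f : M →ₗ[R] N) :
    rk _ _ (coordMatrix b b' f) ≤ rk _ _ (coordMatrix c c' f) := by
  have h1 : coordMatrix b b' f =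
      coordMatrix b c LinearMap.id * (coordMatrix c c' f * coordMatrix c' b' LinearMap.id) := by
    rw [← coordMatrix_comp, ← coordMatrix_comp]; rfl
  rw [h1]
  exact (h.mul_le_right _ _).trans (h.mul_le_left _ _)

variable (R M) in
theorem exists_finBasis [Module.Finite R M] [Module.Free R M] :
    ∃ n : ℕ, Nonempty (Module.Basis (Fin n) R M) := by
  classical
  cases subsingleton_or_nontrivial R with
  | inl h =>
    have := Module.subsingleton R M
    exact ⟨0, ⟨Module.Basis.empty M⟩⟩
  | inr h =>
    let b := Module.Free.chooseBasis R M
    exact ⟨_, ⟨b.reindex (Fintype.equivFin _)⟩⟩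

/-- The rank of a linear map between finitely generated free modules. -/
def linRank [Module.Finite R M] [Module.Free R M] [Module.Finite R N] [Module.Free R N]
    (rk : MatrixFunction R) (f : M →ₗ[R] N) : ℝ :=
  rk _ _ (coordMatrix (exists_finBasis R M).choose_spec.some (exists_finBasis R N).choose_spec.some
    f)

variable [Module.Finite R M] [Module.Free R M] [Module.Finite R N] [Module.Free R N]
variable [Module.Finite R P] [Module.Free R P]
variable [Module.Finite R M'] [Module.Free R M'] [Module.Finite R N'] [Module.Free R N']
variable {rk : MatrixFunction R}

theorem IsSylvester.linRank_eq (h : IsSylvester rk) {l p : ℕ} (b : Module.Basis (Fin l) R M)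
    (b' : Module.Basis (Fin p) R N) (f : M →ₗ[R] N) :
    linRank rk f = rk _ _ (coordMatrix b b' f) :=
  le_antisymm (h.coordMatrix_le _ _ _ _ f) (h.coordMatrix_le _ _ _ _ f)

theorem IsSylvester.linRank_zero (h : IsSylvester rk) : linRank rk (0 : M →ₗ[R] N) = 0 := by
  unfold linRank
  convert h.zero _ _
  ext i k
  simp [coordMatrix]

theorem IsSylvester.linRank_comp_le_right (h : IsSylvester rk) (f : M →ₗ[R] N) (g : N →ₗ[R] P) :
    linRank rk (g ∘ₗ f) ≤ linRank rk f := by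
  obtain ⟨m, ⟨b⟩⟩ := exists_finBasis R M
  obtain ⟨n, ⟨b'⟩⟩ := exists_finBasis R N
  obtain ⟨p, ⟨b''⟩⟩ := exists_finBasis R P
  rw [h.linRank_eq b b'', h.linRank_eq b b', coordMatrix_comp b b' b'']
  exact h.mul_le_left _ _

theorem IsSylvester.linRank_comp_le_left (h : IsSylvester rk) (f : M →ₗ[R] N) (g : N →ₗ[R] P) :
    linRank rk (g ∘ₗ f) ≤ linRank rk g := by
  obtain ⟨m, ⟨b⟩⟩ := exists_finBasis R M
  obtain ⟨n, ⟨b'⟩⟩ := exists_finBasis R N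
  obtain ⟨p, ⟨b''⟩⟩ := exists_finBasis R P
  rw [h.linRank_eq b b'', h.linRank_eq b' b'', coordMatrix_comp b b' b'']
  exact h.mul_le_right _ _

/-- The form in which the product axiom is used later: ranks are compared by exhibiting one map as a
factor of another. -/
theorem IsSylvester.linRank_le_of_comp_eq (h : IsSylvester rk) {f : M →ₗ[R] N}
    {f' : M' →ₗ[R] N'} (e : M →ₗ[R] M') (e' : N' →ₗ[R] N) (hf : e' ∘ₗ f' ∘ₗ e = f) :
    linRank rk f ≤ linRank rk f' := by
  rw [← hf]
  exact (h.linRank_comp_le_right _ _).trans (h.linRank_comp_le_left _ _)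

theorem IsSylvester.one_eq (h : IsSylvester rk) : ∀ n : ℕ, rk n n 1 = n
  | 0 => by
    have : (1 : Matrix (Fin 0) (Fin 0) R) = 0 := Subsingleton.elim _ _
    rw [this, h.zero]; simp
  | n + 1 => by
    have h1 : blockMatrix (1 : Matrix (Fin n) (Fin n) R) 0 0 (1 : Matrix (Fin 1) (Fin 1) R) = 1 := by
      rw [blockMatrix, Matrix.fromBlocks_one]
      simp
    have h2 := h.diag _ _ _ _ (1 : Matrix (Fin n) (Fin n) R) (1 : Matrix (Fin 1) (Fin 1) R)
    rw [h1, h.one, IsSylvester.one_eq h n] at h2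
    rw [h2]; push_cast; rfl

theorem IsSylvester.le_rows (h : IsSylvester rk) {n m : ℕ} (A : Matrix (Fin n) (Fin m) R) :
    rk n m A ≤ n := by
  have := h.mul_le_left (1 : Matrix (Fin n) (Fin n) R) A
  rwa [Matrix.one_mul, h.one_eq] at this

theorem IsSylvester.linRank_le_card (h : IsSylvester rk) {l : ℕ} (b : Module.Basis (Fin l) R M)
    (f : M →ₗ[R] N) : linRank rk f ≤ l := by
  obtain ⟨n, ⟨b'⟩⟩ := exists_finBasis R N
  rw [h.linRank_eq b b']
  exact h.le_rows _

theorem IsSylvester.linRank_id (h : IsSylvester rk) {l : ℕ} (b : Module.Basis (Fin l) R M) :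
    linRank rk (LinearMap.id : M →ₗ[R] M) = l := by
  rw [h.linRank_eq b b, coordMatrix_id, h.one_eq]

theorem IsSylvester.linRank_prodMap (h : IsSylvester rk) (f : M →ₗ[R] N) (f' : M' →ₗ[R] N') :
    linRank rk (f.prodMap f') = linRank rk f + linRank rk f' := by
  obtain ⟨m, ⟨b⟩⟩ := exists_finBasis R M
  obtain ⟨n, ⟨c⟩⟩ := exists_finBasis R N
  obtain ⟨m', ⟨b'⟩⟩ := exists_finBasis R M'
  obtain ⟨n', ⟨c'⟩⟩ := exists_finBasis R N'
  have h1 : f.prodMap f' = (f ∘ₗ LinearMap.fst R M M').prod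
      ((0 : M →ₗ[R] N') ∘ₗ LinearMap.fst R M M' + f' ∘ₗ LinearMap.snd R M M') := by
    ext <;> simp
  have h2 : coordMatrix b c' (0 : M →ₗ[R] N') = 0 := by ext i k; simp [coordMatrix]
  rw [h.linRank_eq b c f, h.linRank_eq b' c' f', h1,
    h.linRank_eq ((b.prod b').reindex finSumFinEquiv) ((c.prod c').reindex finSumFinEquiv),
    coordMatrix_prod, h2, h.diag]

theorem IsSylvester.le_linRank_triangular (h : IsSylvester rk) (f : M →ₗ[R] N) (g : M →ₗ[R] N')
    (f' : M' →ₗ[R] N') :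
    linRank rk f + linRank rk f' ≤ linRank rk ((f ∘ₗ LinearMap.fst R M M').prod
      (g ∘ₗ LinearMap.fst R M M' + f' ∘ₗ LinearMap.snd R M M')) := by
  obtain ⟨m, ⟨b⟩⟩ := exists_finBasis R M
  obtain ⟨n, ⟨c⟩⟩ := exists_finBasis R N
  obtain ⟨m', ⟨b'⟩⟩ := exists_finBasis R M'
  obtain ⟨n', ⟨c'⟩⟩ := exists_finBasis R N'
  rw [h.linRank_eq b c f, h.linRank_eq b' c' f',
    h.linRank_eq ((b.prod b').reindex finSumFinEquiv) ((c.prod c').reindex finSumFinEquiv),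
    coordMatrix_prod]
  exact h.upper _ _ _ _ _ _ _

end LinRank

/-! ### Dimensions of free modules -/

section FreeDim

variable {R : Type*} [Ring R] [InvariantBasisNumber R]
variable {M N : Type*} [AddCommGroup M] [Module R M] [AddCommGroup N] [Module R N]

theorem freeDim_eq {n : ℕ} (b : Module.Basis (Fin n) R M) : freeDim R M = n := by
  have h : {k : ℕ | Nonempty (M ≃ₗ[R] (Fin k → R))} = {n} := by
    ext k
    constructor
    · rintro ⟨e⟩
      exact eq_of_fin_equiv R (e.symm.trans b.equivFun)
    · rintro rfl
      exact ⟨b.equivFun⟩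
  rw [freeDim, h, csInf_singleton]

theorem freeDim_eq_card {ι : Type*} [Fintype ι] (b : Module.Basis ι R M) :
    freeDim R M = Fintype.card ι := by
  classical
  exact freeDim_eq (b.reindex (Fintype.equivFin ι))

variable (R M) in
theorem exists_basis_freeDim [Module.Finite R M] [Module.Free R M] :
    Nonempty (Module.Basis (Fin (freeDim R M)) R M) := by
  obtain ⟨n, ⟨b⟩⟩ := exists_finBasis R M
  rw [freeDim_eq b]
  exact ⟨b⟩

theorem freeDim_congr [Module.Finite R M] [Module.Free R M] (e : M ≃ₗ[R] N) :
    freeDim R M = freeDim R N := by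
  obtain ⟨b⟩ := exists_basis_freeDim R M
  exact (freeDim_eq (b.map e)).symm

theorem freeDim_prod [Module.Finite R M] [Module.Free R M] [Module.Finite R N] [Module.Free R N] :
    freeDim R (M × N) = freeDim R M + freeDim R N := by
  obtain ⟨b⟩ := exists_basis_freeDim R M
  obtain ⟨c⟩ := exists_basis_freeDim R N
  rw [freeDim_eq_card (b.prod c)]
  simp

theorem freeDim_pi [Module.Finite R M] [Module.Free R M] (n : ℕ) :
    freeDim R (Fin n → M) = n * freeDim R M := by
  obtain ⟨b⟩ := exists_basis_freeDim R M
  rw [freeDim_eq_card (Pi.basis fun _ : Fin n => b)]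
  simp

theorem freeDim_eq_zero_iff [Module.Finite R M] [Module.Free R M] :
    freeDim R M = 0 ↔ Subsingleton M := by
  obtain ⟨b⟩ := exists_basis_freeDim R M
  constructor
  · intro h
    rw [h] at b
    exact b.repr.toEquiv.subsingleton
  · intro h
    by_contra h0
    have : Nontrivial R := nontrivial_of_invariantBasisNumber R
    exact b.ne_zero ⟨0, Nat.pos_of_ne_zero h0⟩ (Subsingleton.elim _ _)

end FreeDim

/-! ### Dimensions in finite approximation systems -/

section Dimension

variable {S : Type*} [Ring S] {R : Subring S}

theorem IsFiniteApproximationSystem.bot_mem {F : Set (Submodule R S)}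
    (hF : IsFiniteApproximationSystem F) : ⊥ ∈ F := by
  obtain ⟨W, hW, -⟩ := hF.exists_le ⊥ Submodule.fg_bot
  obtain ⟨V, hV, h1, h2⟩ := hF.exists_compl W hW W hW le_rfl
  have : V = ⊥ := by
    rw [← h1.eq_bot]
    exact (inf_eq_right.2 (le_sup_right.trans h2.le)).symm
  rwa [← this]

theorem IsFiniteApproximationSystem.biSup_mem {F : Set (Submodule R S)}
    (hF : IsFiniteApproximationSystem F) {ι : Type*} (s : Finset ι) (f : ι → Submodule R S)
    (hf : ∀ i ∈ s, f i ∈ F) : (⨆ i ∈ s, f i) ∈ F := by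
  classical
  induction s using Finset.induction_on with
  | empty => simpa using hF.bot_mem
  | insert a s ha ih =>
    rw [Finset.iSup_insert]
    exact hF.sup_mem _ (hf a (Finset.mem_insert_self a s)) _
      (ih fun i hi => hf i (Finset.mem_insert_of_mem hi))

theorem IsFiniteApproximationSystem.iSup_mem {F : Set (Submodule R S)}
    (hF : IsFiniteApproximationSystem F) {ι : Type*} [Finite ι] (f : ι → Submodule R S)
    (hf : ∀ i, f i ∈ F) : (⨆ i, f i) ∈ F := by
  classical
  cases nonempty_fintype ι
  have := hF.biSup_mem Finset.univ f fun i _ => hf i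
  simpa using this

variable [InvariantBasisNumber R]

theorem freeDim_bot : freeDim R (⊥ : Submodule R S) = 0 :=
  freeDim_eq (Module.Basis.empty (ι := Fin 0) (⊥ : Submodule R S))

variable {F : Set (Submodule R S)} (hF : IsFiniteApproximationSystem F)
include hF

theorem IsFiniteApproximationSystem.exists_basis_freeDim {W : Submodule R S} (hW : W ∈ F) :
    Nonempty (Module.Basis (Fin (freeDim R W)) R W) := by
  have := (hF.free W hW).1
  have := (hF.free W hW).2
  exact SylvesterRank.exists_basis_freeDim R W

theorem IsFiniteApproximationSystem.eq_bot_of_freeDim {W : Submodule R S} (hW : W ∈ F)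
    (h : freeDim R W = 0) : W = ⊥ := by
  have := (hF.free W hW).1
  have := (hF.free W hW).2
  rw [freeDim_eq_zero_iff] at h
  exact (Submodule.subsingleton_iff_eq_bot).1 h

theorem IsFiniteApproximationSystem.freeDim_pos {W : Submodule R S} (hW : W ∈ F)
    (h : W ≠ ⊥) : 0 < freeDim R W :=
  Nat.pos_of_ne_zero fun h0 => h (hF.eq_bot_of_freeDim hW h0)

theorem IsFiniteApproximationSystem.freeDim_sup_of_disjoint {V W : Submodule R S} (hV : V ∈ F)
    (hW : W ∈ F) (h : Disjoint V W) :
    freeDim R (V ⊔ W : Submodule R S) = freeDim R V + freeDim R W := by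
  have := (hF.free W hW).1
  have := (hF.free W hW).2
  have := (hF.free V hV).1
  have := (hF.free V hV).2
  have hinj : Function.Injective (V.subtype.coprod W.subtype) := by
    rw [← LinearMap.ker_eq_bot, LinearMap.ker_coprod_of_disjoint_range]
    · simp
    · simpa using h
  have e := LinearEquiv.ofInjective _ hinj
  rw [LinearMap.range_coprod, Submodule.range_subtype, Submodule.range_subtype] at e
  rw [← freeDim_prod, freeDim_congr e]

/-- A complement of $V\cap W$ in $V$ is also a complement of $W$ in $V+W$. So `freeDim` is a modular
dimension function on the lattice $F$; nearly all later counting rests on this. -/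
theorem IsFiniteApproximationSystem.freeDim_sup_add_inf {V W : Submodule R S} (hV : V ∈ F)
    (hW : W ∈ F) :
    freeDim R (V ⊔ W : Submodule R S) + freeDim R (V ⊓ W : Submodule R S)
      = freeDim R V + freeDim R W := by
  obtain ⟨V', hV', h1, h2⟩ := hF.exists_compl V hV (V ⊓ W) (hF.inf_mem _ hV _ hW) inf_le_left
  have h3 : V ⊔ W = W ⊔ V' := by
    conv_lhs => rw [← h2]
    rw [sup_comm, ← sup_assoc]
    congr 1
    exact sup_eq_left.2 inf_le_right
  have h4 : Disjoint W V' := by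
    rw [disjoint_iff_inf_le] at h1 ⊢
    refine le_trans (le_inf (le_inf ?_ inf_le_left) inf_le_right) h1
    exact inf_le_right.trans (le_sup_right.trans h2.le)
  have h5 := hF.freeDim_sup_of_disjoint (hF.inf_mem _ hV _ hW) hV' h1
  rw [h2] at h5
  rw [h3, hF.freeDim_sup_of_disjoint hW hV' h4, h5]
  ring

theorem IsFiniteApproximationSystem.freeDim_mono {V W : Submodule R S} (hV : V ∈ F)
    (hW : W ∈ F) (h : V ≤ W) : freeDim R V ≤ freeDim R W := by
  obtain ⟨V', hV', h1, h2⟩ := hF.exists_compl W hW V hV h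
  have := hF.freeDim_sup_of_disjoint hV hV' h1
  rw [h2] at this
  omega

theorem IsFiniteApproximationSystem.eq_of_freeDim_le {V W : Submodule R S} (hV : V ∈ F)
    (hW : W ∈ F) (h : V ≤ W) (h' : freeDim R W ≤ freeDim R V) : V = W := by
  obtain ⟨V', hV', h1, h2⟩ := hF.exists_compl W hW V hV h
  have := hF.freeDim_sup_of_disjoint hV hV' h1
  rw [h2] at this
  have h3 := hF.eq_bot_of_freeDim hV' (by omega)
  rw [h3, sup_bot_eq] at h2
  exact h2

theorem IsFiniteApproximationSystem.freeDim_biSup_le {ι : Type*} (s : Finset ι)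
    (f : ι → Submodule R S) (hf : ∀ i ∈ s, f i ∈ F) :
    freeDim R (⨆ i ∈ s, f i : Submodule R S) ≤ ∑ i ∈ s, freeDim R (f i) := by
  classical
  induction s using Finset.induction_on with
  | empty => rw [show (⨆ i ∈ (∅ : Finset ι), f i) = ⊥ by simp, freeDim_bot, Finset.sum_empty]
  | insert a s ha ih =>
    have h1 := hf a (Finset.mem_insert_self a s)
    have h2 : ∀ i ∈ s, f i ∈ F := fun i hi => hf i (Finset.mem_insert_of_mem hi)
    have := hF.freeDim_sup_add_inf h1 (hF.biSup_mem s f h2)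
    have := ih h2
    rw [Finset.iSup_insert, Finset.sum_insert ha]
    omega

theorem IsFiniteApproximationSystem.freeDim_biSup_eq {ι : Type*} [DecidableEq ι] (s : Finset ι)
    (f : ι → Submodule R S) (hf : ∀ i ∈ s, f i ∈ F)
    (hd : ∀ t : Finset ι, ∀ a ∉ t, insert a t ⊆ s → Disjoint (f a) (⨆ i ∈ t, f i)) :
    freeDim R (⨆ i ∈ s, f i : Submodule R S) = ∑ i ∈ s, freeDim R (f i) := by
  induction s using Finset.induction_on with
  | empty => rw [show (⨆ i ∈ (∅ : Finset ι), f i) = ⊥ by simp, freeDim_bot, Finset.sum_empty]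
  | insert a s ha ih =>
    have h1 := hf a (Finset.mem_insert_self a s)
    have h2 : ∀ i ∈ s, f i ∈ F := fun i hi => hf i (Finset.mem_insert_of_mem hi)
    rw [Finset.iSup_insert, Finset.sum_insert ha,
      hF.freeDim_sup_of_disjoint h1 (hF.biSup_mem s f h2) (hd s a ha subset_rfl), ih h2]
    intro t b hb hts
    exact hd t b hb (hts.trans (Finset.subset_insert a s))

end Dimension

/-! ### Normalizing elements -/

section Normalizing

variable {S : Type*} [Ring S] {R : Subring S} {g : S}

theorem normalizing_mul_left_cancel (hg : g ∈ normalizing R) {x y : S} (h : g * x = g * y) :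
    x = y := by
  have : g * (x - y) = 0 := by rw [mul_sub, h, sub_self]
  exact sub_eq_zero.1 ((mem_nonZeroDivisors_iff.1 hg.1).1 _ this)

theorem normalizing_mul_right_cancel (hg : g ∈ normalizing R) {x y : S} (h : x * g = y * g) :
    x = y := by
  have : (x - y) * g = 0 := by rw [sub_mul, h, sub_self]
  exact sub_eq_zero.1 ((mem_nonZeroDivisors_iff.1 hg.1).2 _ this)

theorem conj_spec (hg : g ∈ normalizing R) (a : R) : g * a = conj hg a * g :=
  (exists_conj hg a).choose_spec

theorem exists_conj_eq (hg : g ∈ normalizing R) (b : R) : ∃ a : R, conj hg a = b := by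
  have h : (b : S) * g ∈ (fun a : S => g * a) '' (R : Set S) := hg.2.symm ▸ ⟨b, b.2, rfl⟩
  obtain ⟨a, ha, h⟩ := h
  refine ⟨⟨a, ha⟩, Subtype.ext (normalizing_mul_right_cancel hg ?_)⟩
  rw [← conj_spec]
  exact h

theorem one_mem_normalizing : (1 : S) ∈ normalizing R :=
  ⟨one_mem _, by simp⟩

theorem mem_normalizing_iff (hg : g ∈ nonZeroDivisors S) :
    g ∈ normalizing R ↔ (∀ a : R, ∃ b : R, g * a = b * g) ∧ ∀ b : R, ∃ a : R, g * a = b * g := by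
  constructor
  · intro h
    refine ⟨exists_conj h, fun b => ?_⟩
    obtain ⟨a, rfl⟩ := exists_conj_eq h b
    exact ⟨a, conj_spec h a⟩
  · rintro ⟨h1, h2⟩
    refine ⟨hg, Set.Subset.antisymm ?_ ?_⟩
    · rintro _ ⟨a, ha, rfl⟩
      obtain ⟨b, hb⟩ := h1 ⟨a, ha⟩
      exact ⟨b, b.2, hb.symm⟩
    · rintro _ ⟨b, hb, rfl⟩
      obtain ⟨a, ha⟩ := h2 ⟨b, hb⟩
      exact ⟨a, a.2, ha⟩

theorem mul_mem_normalizing {h : S} (hg : g ∈ normalizing R) (hh : h ∈ normalizing R) :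
    g * h ∈ normalizing R := by
  rw [mem_normalizing_iff (mul_mem hg.1 hh.1)]
  constructor
  · intro a
    refine ⟨conj hg (conj hh a), ?_⟩
    rw [mul_assoc, conj_spec hh, ← mul_assoc, conj_spec hg, mul_assoc]
  · intro b
    obtain ⟨b, rfl⟩ := exists_conj_eq hg b
    obtain ⟨b, rfl⟩ := exists_conj_eq hh b
    refine ⟨b, ?_⟩
    rw [mul_assoc, conj_spec hh, ← mul_assoc, conj_spec hg, mul_assoc]

theorem mem_leftTranslate (hg : g ∈ normalizing R) {W : Submodule R S} {x : S} :
    x ∈ leftTranslate g W ↔ ∃ w ∈ W, g * w = x := by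
  constructor
  · intro h
    induction h using Submodule.span_induction with
    | mem x h => exact h
    | zero => exact ⟨0, W.zero_mem, mul_zero _⟩
    | add x y _ _ hx hy =>
      obtain ⟨w, hw, rfl⟩ := hx
      obtain ⟨v, hv, rfl⟩ := hy
      exact ⟨w + v, W.add_mem hw hv, mul_add _ _ _⟩
    | smul r x _ hx =>
      obtain ⟨w, hw, rfl⟩ := hx
      obtain ⟨a, rfl⟩ := exists_conj_eq hg r
      refine ⟨a • w, W.smul_mem a hw, ?_⟩
      rw [Subring.smul_def, Subring.smul_def, smul_eq_mul, smul_eq_mul, ← mul_assoc, conj_spec hg,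
        mul_assoc]
  · rintro ⟨w, hw, rfl⟩
    exact Submodule.subset_span ⟨w, hw, rfl⟩

theorem mul_mem_leftTranslate {W : Submodule R S} {w : S} (hw : w ∈ W) :
    g * w ∈ leftTranslate g W := Submodule.subset_span ⟨w, hw, rfl⟩

theorem mul_mem_leftTranslate_iff (hg : g ∈ normalizing R) {W : Submodule R S} {w : S} :
    g * w ∈ leftTranslate g W ↔ w ∈ W := by
  rw [mem_leftTranslate hg]
  constructor
  · rintro ⟨v, hv, h⟩
    rwa [← normalizing_mul_left_cancel hg h]
  · exact fun h => ⟨w, h, rfl⟩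

theorem leftTranslate_mono {V W : Submodule R S} (h : V ≤ W) :
    leftTranslate g V ≤ leftTranslate g W :=
  Submodule.span_mono (Set.image_mono h)

theorem leftTranslate_le_iff (hg : g ∈ normalizing R) {V W : Submodule R S} :
    leftTranslate g V ≤ leftTranslate g W ↔ V ≤ W :=
  ⟨fun h _ hv => (mul_mem_leftTranslate_iff hg).1 (h (mul_mem_leftTranslate hv)),
    leftTranslate_mono⟩

theorem leftTranslate_injective (hg : g ∈ normalizing R) :
    Function.Injective (leftTranslate (R := R) g) := fun _ _ h =>
  le_antisymm ((leftTranslate_le_iff hg).1 h.le) ((leftTranslate_le_iff hg).1 h.ge)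

theorem leftTranslate_bot : leftTranslate g (⊥ : Submodule R S) = ⊥ := by
  simp [leftTranslate]

theorem leftTranslate_one (W : Submodule R S) : leftTranslate 1 W = W := by
  simp [leftTranslate]

theorem leftTranslate_sup (hg : g ∈ normalizing R) (V W : Submodule R S) :
    leftTranslate g (V ⊔ W) = leftTranslate g V ⊔ leftTranslate g W := by
  apply le_antisymm
  · intro x hx
    obtain ⟨y, hy, rfl⟩ := (mem_leftTranslate hg).1 hx
    obtain ⟨v, hv, w, hw, rfl⟩ := Submodule.mem_sup.1 hy
    rw [mul_add]
    exact Submodule.add_mem_sup (mul_mem_leftTranslate hv) (mul_mem_leftTranslate hw)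
  · exact sup_le (leftTranslate_mono le_sup_left) (leftTranslate_mono le_sup_right)

theorem leftTranslate_inf (hg : g ∈ normalizing R) (V W : Submodule R S) :
    leftTranslate g (V ⊓ W) = leftTranslate g V ⊓ leftTranslate g W := by
  apply le_antisymm
  · exact le_inf (leftTranslate_mono inf_le_left) (leftTranslate_mono inf_le_right)
  · rintro x ⟨hx, hx'⟩
    obtain ⟨v, hv, rfl⟩ := (mem_leftTranslate hg).1 hx
    exact mul_mem_leftTranslate ⟨hv, (mul_mem_leftTranslate_iff hg).1 hx'⟩

theorem leftTranslate_mul {h : S} (hg : g ∈ normalizing R) (hh : h ∈ normalizing R)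
    (W : Submodule R S) : leftTranslate (g * h) W = leftTranslate g (leftTranslate h W) := by
  ext x
  rw [mem_leftTranslate (mul_mem_normalizing hg hh), mem_leftTranslate hg]
  constructor
  · rintro ⟨w, hw, rfl⟩
    exact ⟨h * w, mul_mem_leftTranslate hw, (mul_assoc _ _ _).symm⟩
  · rintro ⟨y, hy, rfl⟩
    obtain ⟨w, hw, rfl⟩ := (mem_leftTranslate hh).1 hy
    exact ⟨w, hw, mul_assoc _ _ _⟩

theorem leftTranslate_span_singleton (hg : g ∈ normalizing R) (x : S) :
    leftTranslate g (Submodule.span R {x}) = Submodule.span R {g * x} := by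
  apply le_antisymm
  · intro y hy
    obtain ⟨w, hw, rfl⟩ := (mem_leftTranslate hg).1 hy
    obtain ⟨r, rfl⟩ := Submodule.mem_span_singleton.1 hw
    refine Submodule.mem_span_singleton.2 ⟨conj hg r, ?_⟩
    rw [Subring.smul_def, Subring.smul_def, smul_eq_mul, smul_eq_mul, ← mul_assoc, ← conj_spec hg,
      mul_assoc]
  · rw [Submodule.span_singleton_le_iff_mem]
    exact mul_mem_leftTranslate (Submodule.mem_span_singleton_self x)

/-- Left multiplication by $g$ is only $\sigma_g$-semilinear, so coefficients are carried along by
`conj` instead of transporting the basis by a linear equivalence. -/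
theorem exists_basis_leftTranslate (hg : g ∈ normalizing R) {W : Submodule R S} {n : ℕ}
    (b : Module.Basis (Fin n) R W) :
    ∃ c : Module.Basis (Fin n) R (leftTranslate g W), ∀ i, (c i : S) = g * b i := by
  let v : Fin n → leftTranslate g W := fun i => ⟨g * b i, mul_mem_leftTranslate (b i).2⟩
  have hli : LinearIndependent R v := by
    rw [Fintype.linearIndependent_iff]
    intro r hr i
    choose a ha using fun i => exists_conj_eq hg (r i)
    have h1 : g * ((∑ i, a i • b i : W) : S) = 0 := by
      have h2 := congrArg (Subtype.val) hr
      rw [AddSubmonoidClass.coe_finsetSum] at h2 ⊢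
      rw [Finset.mul_sum, ← ZeroMemClass.coe_zero (leftTranslate g W), ← h2]
      refine Finset.sum_congr rfl fun i _ => ?_
      simp only [v, Submodule.coe_smul, Subring.smul_def, smul_eq_mul, ← ha]
      rw [← mul_assoc, conj_spec hg, mul_assoc]
    have h3 : (∑ i, a i • b i : W) = 0 :=
      Subtype.ext (normalizing_mul_left_cancel hg (h1.trans (mul_zero g).symm))
    have h4 := (Fintype.linearIndependent_iff.1 b.linearIndependent) a h3 i
    rw [← ha, h4]
    apply Subtype.ext
    apply normalizing_mul_right_cancel hg
    rw [← conj_spec hg]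
    simp
  have hsp : ⊤ ≤ Submodule.span R (Set.range v) := by
    rintro ⟨x, hx⟩ -
    obtain ⟨w, hw, rfl⟩ := (mem_leftTranslate hg).1 hx
    have h1 : (⟨g * w, hx⟩ : leftTranslate g W) =
        ∑ i, conj hg (b.repr ⟨w, hw⟩ i) • v i := by
      apply Subtype.ext
      have h2 := congrArg (Subtype.val) (b.sum_repr ⟨w, hw⟩)
      rw [AddSubmonoidClass.coe_finsetSum] at h2 ⊢
      change g * w = _
      conv_lhs => rw [← show _ = w from h2, Finset.mul_sum]
      refine Finset.sum_congr rfl fun i _ => ?_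
      simp only [v, Submodule.coe_smul, Subring.smul_def, smul_eq_mul]
      rw [← mul_assoc, conj_spec hg, mul_assoc]
    rw [h1]
    exact Submodule.sum_mem _ fun i _ => Submodule.smul_mem _ _ (Submodule.subset_span ⟨i, rfl⟩)
  exact ⟨Module.Basis.mk hli hsp, fun i => by simp [v]⟩

theorem rightMul_injective (hg : g ∈ normalizing R) : Function.Injective (rightMul R g) :=
  fun _ _ h => normalizing_mul_right_cancel hg h

theorem rightMul_apply (x : S) : rightMul R g x = x * g := rfl

theorem mem_map_rightMul {W : Submodule R S} {x : S} :
    x ∈ W.map (rightMul R g) ↔ ∃ w ∈ W, w * g = x := Iff.rfl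

theorem mul_mem_map_rightMul_iff (hg : g ∈ normalizing R) {W : Submodule R S} {w : S} :
    w * g ∈ W.map (rightMul R g) ↔ w ∈ W := by
  rw [mem_map_rightMul]
  constructor
  · rintro ⟨v, hv, h⟩
    rwa [← normalizing_mul_right_cancel hg h]
  · exact fun h => ⟨w, h, rfl⟩

end Normalizing

/-! ### Normal extensions -/

section Normal

variable {S : Type*} [Ring S] {R : Subring S}

theorem eq_iSup_span_basis {W : Submodule R S} {ι : Type*} (b : Module.Basis ι R W) :
    W = ⨆ i, Submodule.span R {(b i : S)} := by
  have h := congrArg (Submodule.map W.subtype) b.span_eq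
  rw [Submodule.map_span, Submodule.map_top, Submodule.range_subtype, ← Set.range_comp] at h
  conv_lhs => rw [← h, ← Set.iUnion_singleton_eq_range, Submodule.span_iUnion]
  rfl

theorem leftTranslate_iSup {g : S} (hg : g ∈ normalizing R) {ι : Type*}
    (f : ι → Submodule R S) : leftTranslate g (⨆ i, f i) = ⨆ i, leftTranslate g (f i) := by
  apply le_antisymm
  · intro x hx
    obtain ⟨y, hy, rfl⟩ := (mem_leftTranslate hg).1 hx
    induction hy using Submodule.iSup_induction' with
    | mem i y hy => exact Submodule.mem_iSup_of_mem i (mul_mem_leftTranslate hy)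
    | zero => rw [mul_zero]; exact Submodule.zero_mem _
    | add y z hy hz h1 h2 =>
      rw [mul_add]
      exact Submodule.add_mem _ (h1 (mul_mem_leftTranslate hy)) (h2 (mul_mem_leftTranslate hz))
  · exact iSup_le fun i => leftTranslate_mono (le_iSup f i)

/-- The elements of `W` which are taken into `V` by right multiplication by `g`. -/
def rightDiv (W : Submodule R S) (g : S) (V : Submodule R S) : Submodule R S :=
  (V ⊓ W.map (rightMul R g)).comap (rightMul R g)

theorem mem_rightDiv {g : S} (hg : g ∈ normalizing R) {V W : Submodule R S} {x : S} :
    x ∈ rightDiv W g V ↔ x ∈ W ∧ x * g ∈ V := by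
  rw [rightDiv, Submodule.mem_comap, Submodule.mem_inf, rightMul_apply,
    mul_mem_map_rightMul_iff hg, and_comm]

theorem map_rightDiv {g : S} (V W : Submodule R S) :
    (rightDiv W g V).map (rightMul R g) = V ⊓ W.map (rightMul R g) := by
  rw [rightDiv, Submodule.map_comap_eq]
  exact inf_eq_right.2 (inf_le_right.trans LinearMap.map_le_range)

variable {F : Set (Submodule R S)} {U : Submonoid S}

/-- Members of $F$ have bases in $U$, so they are determined by the elements of $U$ that they
contain. This is what lets $U$ act as the set of points of a geometry. -/
theorem IsNormal.le_of_forall_mem (hU : IsNormal F U) {V W : Submodule R S} (hV : V ∈ F)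
    (h : ∀ u ∈ U, u ∈ V → u ∈ W) : V ≤ W := by
  obtain ⟨n, b, hb⟩ := hU.exists_basis V hV
  rw [eq_iSup_span_basis b]
  refine iSup_le fun i => ?_
  rw [Submodule.span_singleton_le_iff_mem]
  exact h _ (hb i) (b i).2

theorem IsNormal.exists_mem (hU : IsNormal F U) {V : Submodule R S} (hV : V ∈ F)
    (h : V ≠ ⊥) : ∃ u ∈ U, u ∈ V := by
  by_contra! h'
  exact h (le_bot_iff.1 (hU.le_of_forall_mem hV fun u hu huV => (h' u hu huV).elim))

/-- Basis vectors in $U$ move $r$ to the left through $\sigma$; hence members of $F$ are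
$R$-bimodules. -/
theorem IsNormal.mul_right_mem (hU : IsNormal F U) {W : Submodule R S} (hW : W ∈ F) {x : S}
    (hx : x ∈ W) (r : R) : x * r ∈ W := by
  obtain ⟨n, b, hb⟩ := hU.exists_basis W hW
  have h2 := congrArg (Subtype.val) (b.sum_repr ⟨x, hx⟩)
  rw [AddSubmonoidClass.coe_finsetSum] at h2
  rw [← show _ = x from h2, Finset.sum_mul]
  refine Submodule.sum_mem _ fun i _ => ?_
  rw [Submodule.coe_smul, Subring.smul_def, smul_eq_mul, mul_assoc,
    conj_spec (hU.le_normalizing _ (hb i)) r]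
  exact W.smul_mem _ (W.smul_mem (conj _ r) (b i).2)

theorem IsNormal.mul_le_iff (hU : IsNormal F U) {V W X : Submodule R S} (hV : V ∈ F) (hW : W ∈ F) :
    V * W ≤ X ↔ ∀ v ∈ U, v ∈ V → ∀ w ∈ U, w ∈ W → v * w ∈ X := by
  constructor
  · intro h v _ hv w _ hw
    exact h (Submodule.mul_mem_mul hv hw)
  · intro h
    obtain ⟨n, b, hb⟩ := hU.exists_basis V hV
    obtain ⟨m, c, hc⟩ := hU.exists_basis W hW
    rw [Submodule.mul_le]
    intro x hx y hy
    rw [eq_iSup_span_basis b] at hx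
    rw [eq_iSup_span_basis c] at hy
    induction hx using Submodule.iSup_induction' with
    | mem i x hx =>
      obtain ⟨r, rfl⟩ := Submodule.mem_span_singleton.1 hx
      rw [smul_mul_assoc]
      refine X.smul_mem _ ?_
      induction hy using Submodule.iSup_induction' with
      | mem j y hy =>
        obtain ⟨s, rfl⟩ := Submodule.mem_span_singleton.1 hy
        rw [Subring.smul_def, smul_eq_mul, ← mul_assoc, conj_spec (hU.le_normalizing _ (hb i)),
          mul_assoc]
        exact X.smul_mem _ (h _ (hb i) (b i).2 _ (hc j) (c j).2)
      | zero => rw [mul_zero]; exact X.zero_mem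
      | add y z hy hz h1 h2 => rw [mul_add]; exact X.add_mem h1 h2
    | zero => rw [zero_mul]; exact X.zero_mem
    | add y z hy hz h1 h2 => rw [add_mul]; exact X.add_mem h1 h2

theorem IsNormal.le_mul_mem (hF : IsFiniteApproximationSystem F) (hU : IsNormal F U) {g : S}
    (hg : g ∈ U) {W : Submodule R S} (hW : W ∈ F) : leftTranslate g W ∈ F := by
  obtain ⟨n, b, hb⟩ := hU.exists_basis W hW
  rw [eq_iSup_span_basis b, leftTranslate_iSup (hU.le_normalizing g hg)]
  refine hF.iSup_mem _ fun i => ?_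
  rw [leftTranslate_span_singleton (hU.le_normalizing g hg)]
  exact hU.span_mem _ (U.mul_mem hg (hb i))

theorem map_rightMul_span_singleton (g x : S) :
    (Submodule.span R {x}).map (rightMul R g) = Submodule.span R {x * g} := by
  rw [Submodule.map_span, Set.image_singleton, rightMul_apply]

theorem IsNormal.map_rightMul_mem (hF : IsFiniteApproximationSystem F) (hU : IsNormal F U) {g : S}
    (hg : g ∈ U) {W : Submodule R S} (hW : W ∈ F) : W.map (rightMul R g) ∈ F := by
  obtain ⟨n, b, hb⟩ := hU.exists_basis W hW
  rw [eq_iSup_span_basis b, Submodule.map_iSup]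
  refine hF.iSup_mem _ fun i => ?_
  rw [map_rightMul_span_singleton]
  exact hU.span_mem _ (U.mul_mem (hb i) hg)

/-- Intersecting with $Wg$ puts the module inside $Sg$, as the division axiom requires. -/
theorem IsNormal.rightDiv_mem (hF : IsFiniteApproximationSystem F) (hU : IsNormal F U) {g : S}
    (hg : g ∈ U) {V W : Submodule R S} (hV : V ∈ F) (hW : W ∈ F) : rightDiv W g V ∈ F :=
  hU.comap_mem g hg _ (hF.inf_mem _ hV _ (hU.map_rightMul_mem hF hg hW))
    (inf_le_right.trans LinearMap.map_le_range)

theorem IsNormal.exists_mul_eq_iSup (hU : IsNormal F U) {V : Submodule R S} (hV : V ∈ F)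
    (W : Submodule R S) : ∃ (n : ℕ) (x : Fin n → S), (∀ i, x i ∈ U ∧ x i ∈ V) ∧
      V * W = ⨆ i, leftTranslate (x i) W := by
  obtain ⟨n, b, hb⟩ := hU.exists_basis V hV
  refine ⟨n, fun i => b i, fun i => ⟨hb i, (b i).2⟩, ?_⟩
  apply le_antisymm
  · rw [Submodule.mul_le]
    intro x hx y hy
    rw [eq_iSup_span_basis b] at hx
    induction hx using Submodule.iSup_induction' with
    | mem i x hx =>
      obtain ⟨r, rfl⟩ := Submodule.mem_span_singleton.1 hx
      rw [smul_mul_assoc]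
      exact Submodule.smul_mem _ _ (Submodule.mem_iSup_of_mem i (mul_mem_leftTranslate hy))
    | zero => rw [zero_mul]; exact Submodule.zero_mem _
    | add y z hy hz h1 h2 => rw [add_mul]; exact Submodule.add_mem _ h1 h2
  · refine iSup_le fun i => ?_
    rw [leftTranslate, Submodule.span_le]
    rintro _ ⟨w, hw, rfl⟩
    exact Submodule.mul_mem_mul (b i).2 hw

theorem IsNormal.mul_mem (hF : IsFiniteApproximationSystem F) (hU : IsNormal F U)
    {V W : Submodule R S} (hV : V ∈ F) (hW : W ∈ F) : V * W ∈ F := by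
  obtain ⟨n, x, hx, h⟩ := hU.exists_mul_eq_iSup hV W
  rw [h]
  exact hF.iSup_mem _ fun i => hU.le_mul_mem hF (hx i).1 hW

theorem leftTranslate_le_mul {g : S} {V W : Submodule R S} (hg : g ∈ V) :
    leftTranslate g W ≤ V * W := by
  rw [leftTranslate, Submodule.span_le]
  rintro _ ⟨w, hw, rfl⟩
  exact Submodule.mul_mem_mul hg hw

theorem map_rightMul_le_mul {g : S} {V W : Submodule R S} (hg : g ∈ W) :
    V.map (rightMul R g) ≤ V * W := by
  rintro _ ⟨w, hw, rfl⟩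
  exact Submodule.mul_mem_mul hw hg

/-- Invariance under a finite set becomes invariance under the module $C$: a basis of $C$ suffices
because $WR\subseteq W$. -/
theorem IsNormal.exists_mul_le (hU : IsNormal F U) {C : Submodule R S} (hC : C ∈ F) :
    ∃ V : Finset S, ∀ ε : ℝ, ∀ W ∈ F, IsInvariant F V ε W → ∃ W' ∈ F, W ≤ W' ∧ W * C ≤ W' ∧
      (freeDim R W' : ℝ) ≤ (1 + ε) * freeDim R W := by
  classical
  obtain ⟨n, b, hb⟩ := hU.exists_basis C hC
  refine ⟨Finset.univ.image fun i => (b i : S), fun ε W hW hinv => ?_⟩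
  obtain ⟨W', hW', h1, h2, h3⟩ := hinv
  refine ⟨W', hW', h1, ?_, h3⟩
  rw [Submodule.mul_le]
  intro x hx y hy
  rw [eq_iSup_span_basis b] at hy
  induction hy using Submodule.iSup_induction' with
  | mem j y hy =>
    obtain ⟨s, rfl⟩ := Submodule.mem_span_singleton.1 hy
    rw [Subring.smul_def, smul_eq_mul, ← mul_assoc]
    exact h2 _ (hU.mul_right_mem hW hx s) _ (Finset.mem_image_of_mem _ (Finset.mem_univ j))
  | zero => rw [mul_zero]; exact W'.zero_mem
  | add y z hy hz h1 h2 => rw [mul_add]; exact W'.add_mem h1 h2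

theorem IsInvariant.mono {V V' : Finset S} {ε ε' : ℝ} (hV : V ⊆ V') (hε : ε' ≤ ε)
    {W : Submodule R S} (h : IsInvariant F V' ε' W) : IsInvariant F V ε W := by
  obtain ⟨W', hW', h1, h2, h3⟩ := h
  refine ⟨W', hW', h1, fun w hw v hv => h2 w hw v (hV hv), h3.trans ?_⟩
  gcongr

variable [InvariantBasisNumber R]

theorem freeDim_leftTranslate (hF : IsFiniteApproximationSystem F) {g : S}
    (hg : g ∈ normalizing R) {W : Submodule R S} (hW : W ∈ F) :
    freeDim R (leftTranslate g W) = freeDim R W := by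
  obtain ⟨b⟩ := hF.exists_basis_freeDim hW
  obtain ⟨c, -⟩ := exists_basis_leftTranslate hg b
  exact freeDim_eq c

theorem freeDim_map_rightMul (hF : IsFiniteApproximationSystem F) {g : S}
    (hg : g ∈ normalizing R) {W : Submodule R S} (hW : W ∈ F) :
    freeDim R (W.map (rightMul R g)) = freeDim R W := by
  have := (hF.free W hW).1
  have := (hF.free W hW).2
  exact (freeDim_congr (Submodule.equivMapOfInjective _ (rightMul_injective hg) W)).symm

theorem IsNormal.freeDim_rightDiv (hF : IsFiniteApproximationSystem F) (hU : IsNormal F U) {g : S}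
    (hg : g ∈ U) {V W : Submodule R S} (hV : V ∈ F) (hW : W ∈ F) :
    freeDim R (rightDiv W g V) = freeDim R (V ⊓ W.map (rightMul R g) : Submodule R S) := by
  rw [← map_rightDiv, freeDim_map_rightMul hF (hU.le_normalizing g hg)
    (hU.rightDiv_mem hF hg hV hW)]

theorem ne_zero_of_mem_normalizing {g : S} (hg : g ∈ normalizing R) : g ≠ 0 := by
  have : Nontrivial R := nontrivial_of_invariantBasisNumber R
  have : Nontrivial S := R.subtype_injective.nontrivial
  exact nonZeroDivisors.ne_zero hg.1

theorem freeDim_span_singleton {g : S} (hg : g ∈ normalizing R) :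
    freeDim R (Submodule.span R {g}) = 1 := by
  have h1 : LinearIndependent R ![g] := by
    rw [Fintype.linearIndependent_iff]
    intro r hr i
    rw [Subsingleton.elim i 0]
    apply Subtype.ext
    apply normalizing_mul_right_cancel hg
    simpa [Subring.smul_def] using hr
  have h2 := Module.Basis.span h1
  have h3 : Submodule.span R (Set.range ![g]) = Submodule.span R {g} := by simp
  rw [h3] at h2
  exact freeDim_eq h2

end Normal

/-! ### Perspectivity of points -/

section Perspectivity

variable {S : Type*} [Ring S]

/-- The free module of rank one spanned by `u`. -/
abbrev point (R : Subring S) (u : S) : Submodule R S := Submodule.span R {u}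

/-- Two elements of `U` are perspective if they span the same point, or if there is a third point
on the line through their points. -/
def Perspective (R : Subring S) (U : Submonoid S) (u v : S) : Prop :=
  point R u = point R v ∨
    ∃ w ∈ U, w ∈ point R u ⊔ point R v ∧ point R w ≠ point R u ∧ point R w ≠ point R v

variable {R : Subring S} {F : Set (Submodule R S)} {U : Submonoid S}

theorem Perspective.refl (u : S) : Perspective R U u u := Or.inl rfl

theorem Perspective.symm {u v : S} (h : Perspective R U u v) : Perspective R U v u := by
  rcases h with h | ⟨w, hw, h1, h2, h3⟩
  · exact Or.inl h.symm
  · exact Or.inr ⟨w, hw, by rwa [sup_comm], h3, h2⟩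

theorem mem_point (u : S) : u ∈ point R u := Submodule.mem_span_singleton_self u

theorem point_le_iff {u : S} {W : Submodule R S} : point R u ≤ W ↔ u ∈ W :=
  Submodule.span_singleton_le_iff_mem u W

theorem disjoint_of_not_perspective (hF : IsFiniteApproximationSystem F)
    (hU : IsNormal F U) {X Y : Submodule R S} (hX : X ∈ F) (hY : Y ∈ F)
    (h : ∀ p ∈ U, p ∈ X → ∀ q ∈ U, q ∈ Y → ¬ Perspective R U p q) : Disjoint X Y := by
  rw [disjoint_iff]
  by_contra h0
  obtain ⟨u, hu, h1, h2⟩ := hU.exists_mem (hF.inf_mem _ hX _ hY) h0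
  exact h u hu h1 u hu h2 (.refl u)

variable [InvariantBasisNumber R] (hF : IsFiniteApproximationSystem F) (hU : IsNormal F U)
include hF hU

theorem point_eq_of_mem {u v : S} (hu : u ∈ U) (hv : v ∈ U) (h : u ∈ point R v) :
    point R u = point R v := by
  refine hF.eq_of_freeDim_le (hU.span_mem u hu) (hU.span_mem v hv) (point_le_iff.2 h) ?_
  rw [freeDim_span_singleton (hU.le_normalizing u hu), freeDim_span_singleton
    (hU.le_normalizing v hv)]

theorem disjoint_point {u : S} (hu : u ∈ U) {W : Submodule R S} (hW : W ∈ F) (h : u ∉ W) :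
    Disjoint W (point R u) := by
  rw [disjoint_iff]
  by_contra h0
  obtain ⟨w, hw, hw1, hw2⟩ := hU.exists_mem (hF.inf_mem _ hW _ (hU.span_mem u hu)) h0
  have := point_eq_of_mem hF hU hw hu hw2
  exact h (point_le_iff.1 (this ▸ point_le_iff.2 hw1))

theorem freeDim_sup_point {u : S} (hu : u ∈ U) {W : Submodule R S} (hW : W ∈ F) (h : u ∉ W) :
    freeDim R (W ⊔ point R u : Submodule R S) = freeDim R W + 1 := by
  rw [hF.freeDim_sup_of_disjoint hW (hU.span_mem u hu) (disjoint_point hF hU hu hW h),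
    freeDim_span_singleton (hU.le_normalizing u hu)]

theorem point_exchange {u v : S} (hu : u ∈ U) (hv : v ∈ U) {W : Submodule R S} (hW : W ∈ F)
    (h : u ∈ W ⊔ point R v) (h' : u ∉ W) : v ∈ W ⊔ point R u := by
  have hv' : v ∉ W := fun hv' => h' (by rwa [sup_eq_left.2 (point_le_iff.2 hv')] at h)
  have h1 : W ⊔ point R u = W ⊔ point R v := by
    refine hF.eq_of_freeDim_le (hF.sup_mem _ hW _ (hU.span_mem u hu))
      (hF.sup_mem _ hW _ (hU.span_mem v hv)) (sup_le le_sup_left (point_le_iff.2 h)) ?_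
    rw [freeDim_sup_point hF hU hu hW h', freeDim_sup_point hF hU hv hW hv']
  rw [h1]
  exact point_le_iff.1 le_sup_right

theorem point_exchange' {u v w : S} (hu : u ∈ U) (hv : v ∈ U) (hw : w ∈ U)
    (h : w ∈ point R u ⊔ point R v) (h' : point R w ≠ point R u) :
    v ∈ point R u ⊔ point R w :=
  point_exchange hF hU hw hv (hU.span_mem u hu) h fun hm => h' (point_eq_of_mem hF hU hw hu hm)

theorem exists_mem_inf {V W X : Submodule R S} (hV : V ∈ F) (hW : W ∈ F) (hX : X ∈ F)
    (h1 : V ≤ X) (h2 : W ≤ X) (h : freeDim R X < freeDim R V + freeDim R W) :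
    ∃ u ∈ U, u ∈ V ∧ u ∈ W := by
  refine hU.exists_mem (hF.inf_mem _ hV _ hW) fun h0 => ?_
  have h3 := hF.freeDim_sup_add_inf hV hW
  have h4 := hF.freeDim_mono (hF.sup_mem _ hV _ hW) hX (sup_le h1 h2)
  rw [h0, freeDim_bot] at h3
  omega

theorem freeDim_line {u v : S} (hu : u ∈ U) (hv : v ∈ U) (h : point R u ≠ point R v) :
    freeDim R (point R u ⊔ point R v : Submodule R S) = 2 := by
  rw [freeDim_sup_point hF hU hv (hU.span_mem u hu)
    fun hm => h (point_eq_of_mem hF hU hv hu hm).symm,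
    freeDim_span_singleton (hU.le_normalizing u hu)]

/-- In the non-collinear case $u,v,w$ span a plane, and with $a$ on the line $uv$ and $b$ on the
line $vw$ the lines $ab$ and $uw$ must meet by dimension. The common point is the third point on
$uw$. -/
theorem Perspective.trans {u v w : S} (hu : u ∈ U) (hv : v ∈ U) (hw : w ∈ U)
    (h1 : Perspective R U u v) (h2 : Perspective R U v w) : Perspective R U u w := by
  by_cases huv : point R u = point R v
  · unfold Perspective at h2 ⊢
    rwa [huv]
  by_cases hvw : point R v = point R w
  · unfold Perspective at h1 ⊢
    rwa [← hvw]
  by_cases huw : point R u = point R w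
  · exact Or.inl huw
  obtain ⟨a, ha, ha1, ha2, ha3⟩ := h1.resolve_left huv
  obtain ⟨b, hb, hb1, hb2, hb3⟩ := h2.resolve_left hvw
  right
  by_cases hcol : w ∈ point R u ⊔ point R v
  -- For collinear points the middle point $v$ itself is the third point.
  · exact ⟨v, hv, point_exchange' hF hU hu hv hw hcol (Ne.symm huw), Ne.symm huv, hvw⟩
  have le_of {x y z : S} (hx : x ∈ point R y ⊔ point R z) {X : Submodule R S} (hy : y ∈ X)
      (hz : z ∈ X) : x ∈ X := (sup_le (point_le_iff.2 hy) (point_le_iff.2 hz)) hx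
  have memL (x y : S) : x ∈ point R x ⊔ point R y := point_le_iff.1 le_sup_left
  have memR (x y : S) : y ∈ point R x ⊔ point R y := point_le_iff.1 le_sup_right
  have hbn : b ∉ point R u ⊔ point R v := by
    intro hb'
    exact hcol (le_of (point_exchange' hF hU hv hw hb hb1 hb2) (memR _ _) hb')
  have hab : point R a ≠ point R b := fun h => hbn (point_le_iff.1 (h ▸ point_le_iff.2 ha1))
  have hX := hF.sup_mem _ (hF.sup_mem _ (hU.span_mem u hu) _ (hU.span_mem v hv)) _
    (hU.span_mem w hw)
  have hdim := freeDim_sup_point hF hU hw (hF.sup_mem _ (hU.span_mem u hu) _ (hU.span_mem v hv))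
    hcol
  rw [freeDim_line hF hU hu hv huv] at hdim
  have memu : u ∈ point R u ⊔ point R v ⊔ point R w :=
    point_le_iff.1 (le_sup_left.trans le_sup_left)
  have memv : v ∈ point R u ⊔ point R v ⊔ point R w :=
    point_le_iff.1 (le_sup_right.trans le_sup_left)
  have memw : w ∈ point R u ⊔ point R v ⊔ point R w := point_le_iff.1 le_sup_right
  obtain ⟨s, hs, hs1, hs2⟩ := exists_mem_inf hF hU
    (hF.sup_mem _ (hU.span_mem a ha) _ (hU.span_mem b hb))
    (hF.sup_mem _ (hU.span_mem u hu) _ (hU.span_mem w hw)) hX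
    (sup_le (point_le_iff.2 (le_of ha1 memu memv)) (point_le_iff.2 (le_of hb1 memv memw)))
    (sup_le (point_le_iff.2 memu) (point_le_iff.2 memw))
    (by rw [hdim, freeDim_line hF hU ha hb hab, freeDim_line hF hU hu hw huw]; norm_num)
  -- If $s$ were $u$ or $w$, exchange along the lines would put $b$, respectively $w$, on the line
  -- $uv$.
  refine ⟨s, hs, hs2, fun hsu => ?_, fun hsw => ?_⟩
  · have hu' : u ∈ point R a ⊔ point R b := point_le_iff.1 (hsu ▸ point_le_iff.2 hs1)
    exact hbn (le_of (point_exchange' hF hU ha hb hu hu' (Ne.symm ha2)) ha1 (memL _ _))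
  · have hw' : w ∈ point R b ⊔ point R a :=
      point_le_iff.1 (sup_comm (point R a) (point R b) ▸ hsw ▸ point_le_iff.2 hs1)
    have ha' : a ∈ point R v ⊔ point R w :=
      le_of (point_exchange' hF hU hb ha hw hw' (Ne.symm hb3)) hb1 (memR _ _)
    rw [sup_comm] at ha1
    have hu' : u ∈ point R v ⊔ point R w :=
      le_of (point_exchange' hF hU hv hu ha ha1 ha3) (memL _ _) ha'
    have := point_exchange' hF hU hv hw hu hu' huv
    rw [sup_comm] at this
    exact hcol this

/-- If $p\notin X$, modularity gives a point $q$ of $X'$ in $X+Rp$ outside $X$. Since $X$ has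
codimension one in $X+Rp$, it meets the line $pq$, and the common point is neither $p$ nor $q$. -/
theorem mem_or_perspective_of_mem_sup {X X' : Submodule R S} (hX : X ∈ F) (hX' : X' ∈ F) {p : S}
    (hp : p ∈ U) (h : p ∈ X ⊔ X') : p ∈ X ∨ ∃ q ∈ U, q ∈ X' ∧ Perspective R U p q := by
  by_cases hpX : p ∈ X
  · exact Or.inl hpX
  right
  have hXp := hF.sup_mem _ hX _ (hU.span_mem p hp)
  have hd := freeDim_sup_point hF hU hp hX hpX
  have h1 : ∃ q ∈ U, q ∈ X' ∧ q ∈ X ⊔ point R p ∧ q ∉ X := by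
    -- Otherwise $X'$ meets $X+Rp$ only inside $X$. As $p\in X+X'$, the dimension formula would then
    -- give $X+Rp$ and $X$ the same dimension.
    by_contra! hcon
    have h2 : X' ⊓ (X ⊔ point R p) ≤ X' ⊓ X :=
      hU.le_of_forall_mem (hF.inf_mem _ hX' _ hXp) fun u hu huq => ⟨huq.1, hcon u hu huq.1 huq.2⟩
    have h3 := hF.freeDim_mono (hF.inf_mem _ hX' _ hXp) (hF.inf_mem _ hX' _ hX) h2
    have h4 := hF.freeDim_sup_add_inf hX' hXp
    have h5 := hF.freeDim_sup_add_inf hX' hX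
    have h6 : X' ⊔ (X ⊔ point R p) = X' ⊔ X := by
      rw [← sup_assoc, sup_eq_left, point_le_iff, sup_comm]
      exact h
    rw [h6, hd] at h4
    omega
  obtain ⟨q, hq, hqX', hqXp, hqX⟩ := h1
  refine ⟨q, hq, hqX', ?_⟩
  by_cases hpq : point R p = point R q
  · exact Or.inl hpq
  right
  obtain ⟨s, hs, hs1, hs2⟩ := exists_mem_inf hF hU
    (hF.sup_mem _ (hU.span_mem p hp) _ (hU.span_mem q hq)) hX hXp
    (sup_le le_sup_right (point_le_iff.2 hqXp)) le_sup_left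
    (by rw [hd, freeDim_line hF hU hp hq hpq]; omega)
  refine ⟨s, hs, hs1, fun h => hpX ?_, fun h => hqX ?_⟩
  · exact point_le_iff.1 (h ▸ point_le_iff.2 hs2)
  · exact point_le_iff.1 (h ▸ point_le_iff.2 hs2)

theorem exists_perspective_of_mem_sup {X X' : Submodule R S} (hX : X ∈ F) (hX' : X' ∈ F) {p : S}
    (hp : p ∈ U) (h : p ∈ X ⊔ X') : ∃ q ∈ U, (q ∈ X ∨ q ∈ X') ∧ Perspective R U p q := by
  rcases mem_or_perspective_of_mem_sup hF hU hX hX' hp h with h | ⟨q, hq, h1, h2⟩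
  · exact ⟨p, hp, Or.inl h, .refl p⟩
  · exact ⟨q, hq, Or.inr h1, h2⟩

theorem exists_perspective_of_mem_biSup {ι : Type*} (s : Finset ι) (f : ι → Submodule R S)
    (hf : ∀ i ∈ s, f i ∈ F) {p : S} (hp : p ∈ U) (h : p ∈ ⨆ i ∈ s, f i) :
    ∃ i ∈ s, ∃ q ∈ U, q ∈ f i ∧ Perspective R U p q := by
  classical
  induction s using Finset.induction_on generalizing p with
  | empty =>
    simp only [Finset.notMem_empty, iSup_false, iSup_bot, Submodule.mem_bot] at h
    exact absurd h (ne_zero_of_mem_normalizing (hU.le_normalizing p hp))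
  | insert a s ha ih =>
    rw [Finset.iSup_insert] at h
    have h1 := hf a (Finset.mem_insert_self a s)
    have h2 : ∀ i ∈ s, f i ∈ F := fun i hi => hf i (Finset.mem_insert_of_mem hi)
    rcases exists_perspective_of_mem_sup hF hU h1 (hF.biSup_mem s f h2) hp h with
      ⟨q, hq, hqa | hqs, hpq⟩
    · exact ⟨a, Finset.mem_insert_self a s, q, hq, hqa, hpq⟩
    · obtain ⟨i, hi, r, hr, hri, hqr⟩ := ih h2 hq hqs
      exact ⟨i, Finset.mem_insert_of_mem hi, r, hr, hri, hpq.trans hF hU hp hq hr hqr⟩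

/-- A point of a sum of points lies in the sum of the points perspective to it. -/
theorem mem_biSup_perspective {ι : Type*} (s : Finset ι) (b : ι → S) (hb : ∀ i ∈ s, b i ∈ U)
    (c : S) {p : S} (hp : p ∈ U) (hc : c ∈ U) (hpc : Perspective R U p c)
    (h : p ∈ ⨆ i ∈ s, point R (b i)) (t : Finset ι) (ht : t ⊆ s)
    (hts : ∀ i ∈ s, Perspective R U (b i) c → i ∈ t) : p ∈ ⨆ i ∈ t, point R (b i) := by
  classical
  have h1 : (⨆ i ∈ s, point R (b i)) =
      (⨆ i ∈ t, point R (b i)) ⊔ ⨆ i ∈ s \ t, point R (b i) := by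
    rw [← Finset.iSup_union, Finset.union_sdiff_of_subset ht]
  rw [h1] at h
  have hm : ∀ r ⊆ s, (⨆ i ∈ r, point R (b i)) ∈ F := fun r hr =>
    hF.biSup_mem _ _ fun i hi => hU.span_mem _ (hb i (hr hi))
  rcases mem_or_perspective_of_mem_sup hF hU (hm t ht) (hm _ Finset.sdiff_subset) hp h with
    h | ⟨q, hq, h2, h3⟩
  · exact h
  · obtain ⟨i, hi, r, hr, hri, hqr⟩ := exists_perspective_of_mem_biSup hF hU _ _
      (fun i hi => hU.span_mem _ (hb i (Finset.sdiff_subset hi))) hq h2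
    rw [Finset.mem_sdiff] at hi
    have hri' : Perspective R U r (b i) := Or.inl (point_eq_of_mem hF hU hr (hb i hi.1) hri)
    have h4 : Perspective R U p (b i) :=
      (h3.trans hF hU hp hq hr hqr).trans hF hU hp hr (hb i hi.1) hri'
    exact (hi.2 (hts i hi.1 (h4.symm.trans hF hU (hb i hi.1) hp hc hpc))).elim

/-- A common point of one module and the sum of the others would be perspective to a point of one of
these; so modules without perspective points are independent. -/
theorem sum_freeDim_le_of_not_perspective {ι : Type*} (s : Finset ι) (f : ι → Submodule R S)
    (hf : ∀ i ∈ s, f i ∈ F) {Y : Submodule R S} (hY : Y ∈ F) (hfY : ∀ i ∈ s, f i ≤ Y)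
    (h : ∀ i ∈ s, ∀ j ∈ s, i ≠ j → ∀ p ∈ U, p ∈ f i → ∀ q ∈ U, q ∈ f j →
      ¬ Perspective R U p q) :
    ∑ i ∈ s, freeDim R (f i) ≤ freeDim R Y := by
  classical
  rw [← hF.freeDim_biSup_eq s f hf]
  · exact hF.freeDim_mono (hF.biSup_mem s f hf) hY (iSup₂_le hfY)
  · intro t a ha hts
    have hats := hts (Finset.mem_insert_self a t)
    have htF : ∀ i ∈ t, f i ∈ F := fun i hi => hf i (hts (Finset.mem_insert_of_mem hi))
    refine disjoint_of_not_perspective hF hU (hf a hats) (hF.biSup_mem t f htF) ?_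
    intro p hp hpa q hq hqt hpq
    obtain ⟨i, hi, r, hr, hri, hqr⟩ := exists_perspective_of_mem_biSup hF hU t f htF hq hqt
    exact h a hats i (hts (Finset.mem_insert_of_mem hi)) (fun hai => ha (hai ▸ hi)) p hp hpa r hr
      hri (hpq.trans hF hU hp hq hr hqr)

end Perspectivity

/-! ### Left saturated systems -/

section Saturated

variable {S : Type*} [Ring S] {R : Subring S}

/-- `F` and `U` are closed under left division by elements of `U`. -/
structure IsLeftSaturated (F : Set (Submodule R S)) (U : Submonoid S) : Prop where
  mem_of_mul_mem : ∀ a ∈ U, ∀ w, a * w ∈ U → w ∈ U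
  mem_of_leftTranslate_mem : ∀ a ∈ U, ∀ Z, leftTranslate a Z ∈ F → Z ∈ F

/-- The elements of `W` which are taken into `Y` by left multiplication by `u`. -/
def leftDiv {u : S} (hu : u ∈ normalizing R) (W Y : Submodule R S) : Submodule R S where
  carrier := {w | w ∈ W ∧ u * w ∈ Y}
  zero_mem' := ⟨W.zero_mem, by rw [mul_zero]; exact Y.zero_mem⟩
  add_mem' h h' := ⟨W.add_mem h.1 h'.1, by rw [mul_add]; exact Y.add_mem h.2 h'.2⟩
  smul_mem' r w h := ⟨W.smul_mem r h.1, by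
    rw [Subring.smul_def, smul_eq_mul, ← mul_assoc, conj_spec hu, mul_assoc]
    exact Y.smul_mem (conj hu r) h.2⟩

theorem leftTranslate_leftDiv {u : S} (hu : u ∈ normalizing R) (W Y : Submodule R S) :
    leftTranslate u (leftDiv hu W Y) = leftTranslate u W ⊓ Y := by
  ext x
  rw [mem_leftTranslate hu, Submodule.mem_inf, mem_leftTranslate hu]
  constructor
  · rintro ⟨w, ⟨h1, h2⟩, rfl⟩
    exact ⟨⟨w, h1, rfl⟩, h2⟩
  · rintro ⟨⟨w, h1, rfl⟩, h2⟩
    exact ⟨w, ⟨h1, h2⟩, rfl⟩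

/-- Relates the translates by collinear points; this is how the third point of a line enters the
rank argument. -/
theorem leftTranslate_le_sup {u v x : S} (hv : v ∈ point R u ⊔ point R x) (Z : Submodule R S) :
    leftTranslate v Z ≤ leftTranslate u Z ⊔ leftTranslate x Z := by
  obtain ⟨y, hy, z, hz, rfl⟩ := Submodule.mem_sup.1 hv
  obtain ⟨r, rfl⟩ := Submodule.mem_span_singleton.1 hy
  obtain ⟨s, rfl⟩ := Submodule.mem_span_singleton.1 hz
  rw [leftTranslate, Submodule.span_le]
  rintro _ ⟨w, hw, rfl⟩
  simp only [add_mul, smul_mul_assoc]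
  exact Submodule.add_mem_sup (Submodule.smul_mem _ _ (mul_mem_leftTranslate hw))
    (Submodule.smul_mem _ _ (mul_mem_leftTranslate hw))

theorem exists_max_of_bounded {α : Type*} (P : α → Prop) (f : α → ℕ) (B : ℕ)
    (hB : ∀ a, P a → f a ≤ B) (h : ∃ a, P a) : ∃ a, P a ∧ ∀ b, P b → f b ≤ f a := by
  obtain ⟨a, ha, hmin⟩ := (measure fun a => B - f a).wf.has_min {a | P a} h
  refine ⟨a, ha, fun b hb => ?_⟩
  have h1 := hmin b hb
  have h2 : ¬ (B - f b < B - f a) := h1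
  have := hB a ha
  have := hB b hb
  omega

variable {F : Set (Submodule R S)} {U : Submonoid S}

theorem IsLeftSaturated.leftDiv_mem (hF : IsFiniteApproximationSystem F) (hU : IsNormal F U)
    (hs : IsLeftSaturated F U) {u : S} (hu : u ∈ U) {W Y : Submodule R S} (hW : W ∈ F)
    (hY : Y ∈ F) : leftDiv (hU.le_normalizing u hu) W Y ∈ F := by
  refine hs.mem_of_leftTranslate_mem u hu _ ?_
  rw [leftTranslate_leftDiv]
  exact hF.inf_mem _ (hU.le_mul_mem hF hu hW) _ hY

variable [InvariantBasisNumber R] (hF : IsFiniteApproximationSystem F) (hU : IsNormal F U)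
include hF hU

/-- If any two points of `E` are perspective, then some left multiplication by a point of `E`
has relative rank at least half of the dimension of `W` modulo `Y`, unless `E` takes a nonzero part
of `W` into a module which is only slightly larger than `Y`. -/
theorem IsLeftSaturated.exists_rank_or_mul_le (hs : IsLeftSaturated F U) {E : Submodule R S}
    (hE : E ∈ F) (hE0 : E ≠ ⊥)
    (hEp : ∀ u ∈ U, u ∈ E → ∀ v ∈ U, v ∈ E → Perspective R U u v) (d : ℕ) :
    ∀ W ∈ F, freeDim R W = d → ∀ Y ∈ F,
      (∃ u ∈ U, u ∈ E ∧
        d + 2 * freeDim R Y ≤ 2 * freeDim R (leftTranslate u W ⊔ Y : Submodule R S)) ∨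
      ∃ Z ∈ F, Z ≤ W ∧ Z ≠ ⊥ ∧ ∃ Y' ∈ F, Y ≤ Y' ∧ E * Z ≤ Y' ∧
        freeDim R Y' ≤ freeDim R Y + d ^ 2 := by
  induction d using Nat.strong_induction_on with
  | _ d ih =>
  intro W hW hd Y hY
  have hT : ∀ u ∈ U, ∀ Z ∈ F, leftTranslate u Z ∈ F := fun u hu Z hZ => hU.le_mul_mem hF hu hZ
  have hdT : ∀ u ∈ U, ∀ Z ∈ F, freeDim R (leftTranslate u Z) = freeDim R Z :=
    fun u hu Z hZ => freeDim_leftTranslate hF (hU.le_normalizing u hu) hZ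
  have hbound : ∀ u ∈ U, freeDim R (leftTranslate u W ⊔ Y : Submodule R S) ≤ d + freeDim R Y := by
    intro u hu
    have := hF.freeDim_sup_add_inf (hT u hu W hW) hY
    rw [hdT u hu W hW] at this
    omega
  have hbound' : ∀ u ∈ U, freeDim R Y ≤ freeDim R (leftTranslate u W ⊔ Y : Submodule R S) :=
    fun u hu => hF.freeDim_mono hY (hF.sup_mem _ (hT u hu W hW) _ hY) le_sup_right
  -- Call $\dim(uW+Y)-\dim Y$ the rank of $u$. Choose $u$ of maximal rank $r$; from `hfull` on,
  -- $2r<d$ is assumed.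
  obtain ⟨u, ⟨hu, huE⟩, hmax⟩ := exists_max_of_bounded (fun u => u ∈ U ∧ u ∈ E)
    (fun u => freeDim R (leftTranslate u W ⊔ Y : Submodule R S)) (d + freeDim R Y)
    (fun u hu => hbound u hu.1) (by
      obtain ⟨u, hu, huE⟩ := hU.exists_mem hE hE0
      exact ⟨u, hu, huE⟩)
  have hY1 : leftTranslate u W ⊔ Y ∈ F := hF.sup_mem _ (hT u hu W hW) _ hY
  by_cases hfull : d + 2 * freeDim R Y ≤ 2 * freeDim R (leftTranslate u W ⊔ Y : Submodule R S)
  · exact Or.inl ⟨u, hu, huE, hfull⟩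
  have hd0 : 0 < d := by
    have := hbound' u hu
    omega
  by_cases hr0 : freeDim R (leftTranslate u W ⊔ Y : Submodule R S) ≤ freeDim R Y
  · right
    refine ⟨W, hW, le_rfl, ?_, Y, hY, le_rfl, ?_, Nat.le_add_right _ _⟩
    · rintro rfl
      rw [freeDim_bot] at hd
      omega
    · rw [hU.mul_le_iff hE hW]
      intro v hv hvE w hw hwW
      have h1 : Y = leftTranslate v W ⊔ Y := by
        refine hF.eq_of_freeDim_le hY (hF.sup_mem _ (hT v hv W hW) _ hY) le_sup_right ?_
        exact (hmax v ⟨hv, hvE⟩).trans hr0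
      rw [h1]
      exact (le_sup_left : leftTranslate v W ≤ _) (mul_mem_leftTranslate hwW)
  set Y1 := leftTranslate u W ⊔ Y with hY1def
  set Z1 := leftDiv (hU.le_normalizing u hu) W Y with hZ1def
  have hZ1 : Z1 ∈ F := hs.leftDiv_mem hF hU hu hW hY
  have hZ1W : Z1 ≤ W := fun z hz => hz.1
  have huZ1 : leftTranslate u Z1 ≤ Y := by
    rw [leftTranslate_leftDiv]
    exact inf_le_right
  have hdZ1 : freeDim R Y1 + freeDim R Z1 = d + freeDim R Y := by
    have h1 := hF.freeDim_sup_add_inf (hT u hu W hW) hY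
    rw [← leftTranslate_leftDiv (hU.le_normalizing u hu), hdT u hu _ hZ1, hdT u hu W hW, hd] at h1
    exact h1
  -- Induction on the kernel `Z1` of $u$ on $W$ modulo $Y$, of dimension $d-r$, with $Y$ enlarged to
  -- `Y1`, that is $uW+Y$.
  rcases ih (freeDim R Z1) (by omega) Z1 hZ1 rfl Y1 hY1 with
    ⟨x, hx, hxE, hrank⟩ | ⟨Z, hZ, hZZ1, hZ0, Y', hY', h1, h2, h3⟩
  swap
  · right
    refine ⟨Z, hZ, hZZ1.trans hZ1W, hZ0, Y', hY', le_sup_right.trans h1, h2, h3.trans ?_⟩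
    -- The rank is written as `r + 1`; with rank $r\ge1$ the loss from $Y$ to `Y1` is absorbed by
    -- $r+(d-r)^2\le d^2$.
    obtain ⟨r, hr⟩ : ∃ r, freeDim R Y1 = freeDim R Y + (r + 1) :=
      ⟨freeDim R Y1 - freeDim R Y - 1, by omega⟩
    have hd' : d = freeDim R Z1 + (r + 1) := by omega
    rw [hr, hd']
    nlinarith
  left
  have hx1 : leftTranslate x Z1 ∈ F := hT x hx _ hZ1
  by_cases hxu : point R u = point R x
  · exfalso
    have h1 : leftTranslate x Z1 ≤ Y1 := by
      have h2 : x ∈ point R u ⊔ point R u := by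
        rw [sup_idem, hxu]; exact mem_point x
      refine (leftTranslate_le_sup h2 Z1).trans ?_
      rw [sup_idem]
      exact huZ1.trans le_sup_right
    rw [sup_eq_right.2 h1] at hrank
    omega
  -- The aim is to show that $x$ and the third point $v$ have ranks of sum at least $d$, which
  -- contradicts $2r<d$ by maximality of $r$.
  obtain ⟨v, hv, hv1, hv2, hv3⟩ := (hEp u hu huE x hx hxE).resolve_left hxu
  have hvE : v ∈ E := (sup_le (point_le_iff.2 huE) (point_le_iff.2 hxE)) hv1
  have hxv : x ∈ point R u ⊔ point R v := point_exchange' hF hU hu hx hv hv1 hv2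
  have huv : u ∈ point R x ⊔ point R v := by
    rw [sup_comm] at hv1
    exact point_exchange' hF hU hx hu hv hv1 hv3
  set Y2 := Y ⊔ leftTranslate x Z1 with hY2def
  have hY2 : Y2 ∈ F := hF.sup_mem _ hY _ hx1
  have hY2x : Y2 ≤ leftTranslate x W ⊔ Y :=
    sup_le le_sup_right ((leftTranslate_mono hZ1W).trans le_sup_left)
  -- As $x$ lies on the line $uv$ and $u$ takes `Z1` into $Y$, the module $xZ_1$ lies in $vW+Y$ as
  -- well as in $xW$.
  have hY2v : Y2 ≤ leftTranslate v W ⊔ Y := by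
    refine sup_le le_sup_right ((leftTranslate_le_sup hxv Z1).trans (sup_le ?_ ?_))
    · exact huZ1.trans le_sup_right
    · exact (leftTranslate_mono hZ1W).trans le_sup_left
  have hxW := hF.sup_mem _ (hT x hx W hW) _ hY
  have hvW := hF.sup_mem _ (hT v hv W hW) _ hY
  have hupper := hF.freeDim_sup_add_inf hxW hvW
  have hle1 := hF.freeDim_mono hY2 (hF.inf_mem _ hxW _ hvW) (le_inf hY2x hY2v)
  have hle2 : freeDim R (leftTranslate x Z1 ⊔ Y1 : Submodule R S) ≤
      freeDim R (leftTranslate x W ⊔ Y ⊔ (leftTranslate v W ⊔ Y) : Submodule R S) := by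
    refine hF.freeDim_mono (hF.sup_mem _ hx1 _ hY1) (hF.sup_mem _ hxW _ hvW)
      (sup_le ?_ (sup_le ?_ ?_))
    · exact (leftTranslate_mono hZ1W).trans (le_sup_left.trans le_sup_left)
    · exact (leftTranslate_le_sup huv W).trans (sup_le (le_sup_left.trans le_sup_left)
        (le_sup_left.trans le_sup_right))
    · exact le_sup_right.trans le_sup_left
  have hle3 : freeDim R (leftTranslate x Z1 ⊔ Y1 : Submodule R S) + freeDim R Y ≤
      freeDim R Y1 + freeDim R Y2 := by
    have h1 := hF.freeDim_sup_add_inf hY1 hY2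
    have h2 := hF.freeDim_mono hY (hF.inf_mem _ hY1 _ hY2) (le_inf le_sup_right le_sup_left)
    have h3 : Y1 ⊔ Y2 = leftTranslate x Z1 ⊔ Y1 := by
      rw [hY2def, ← sup_assoc, sup_eq_left.2 (le_sup_right : Y ≤ Y1), sup_comm]
    rw [h3] at h1
    omega
  -- Put $k=\dim(xZ_1+Y_1)-\dim Y_1$, so $2k\ge d-r$. Modulo $Y$, the intersection of $xW+Y$ and
  -- $vW+Y$ has dimension at least $k$ and their sum at least $r+k$. The ranks of $x$ and $v$ thus
  -- add up to at least $r+2k\ge d$.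
  have hmx := hmax x ⟨hx, hxE⟩
  have hmv := hmax v ⟨hv, hvE⟩
  refine ⟨u, hu, huE, ?_⟩
  omega

/-- A complement $V$ of $G$ contains no good point, which excludes the second alternative of
`exists_rank_or_mul_le` on $V$; the first one is excluded by the rank bound $t$ if $\dim V>2t$. -/
theorem IsLeftSaturated.freeDim_le_of_perspective (hs : IsLeftSaturated F U) {E : Submodule R S}
    (hE : E ∈ F) (hE0 : E ≠ ⊥)
    (hEp : ∀ u ∈ U, u ∈ E → ∀ v ∈ U, v ∈ E → Perspective R U u v) {W Y G : Submodule R S}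
    (hW : W ∈ F) (hY : Y ∈ F) (hG : G ∈ F) (hGW : G ≤ W) {t : ℕ}
    (ht : ∀ u ∈ U, u ∈ E →
      freeDim R (leftTranslate u W ⊔ Y : Submodule R S) ≤ freeDim R Y + t)
    (hgood : ∀ w ∈ U, w ∈ W → freeDim R E ≤
      freeDim R (E.map (rightMul R w) ⊓ Y : Submodule R S) + freeDim R W ^ 2 → w ∈ G) :
    freeDim R W ≤ freeDim R G + 2 * t := by
  obtain ⟨V, hV, h1, h2⟩ := hF.exists_compl W hW G hG hGW
  have hVW : V ≤ W := le_sup_right.trans h2.le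
  have hdim := hF.freeDim_sup_of_disjoint hG hV h1
  rw [h2] at hdim
  have hdVW := hF.freeDim_mono hV hW hVW
  by_contra! hcon
  rcases hs.exists_rank_or_mul_le hF hU hE hE0 hEp _ V hV rfl Y hY with
    ⟨u, hu, huE, hrank⟩ | ⟨Z, hZ, hZV, hZ0, Y', hY', h3, h4, h5⟩
  · have h6 := ht u hu huE
    have h7 := hF.freeDim_mono (hF.sup_mem _ (hU.le_mul_mem hF hu hV) _ hY)
      (hF.sup_mem _ (hU.le_mul_mem hF hu hW) _ hY) (sup_le_sup_right (leftTranslate_mono hVW) Y)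
    omega
  · obtain ⟨z, hz, hzZ⟩ := hU.exists_mem hZ hZ0
    have hzV := hZV hzZ
    have hzG : z ∈ G := by
      refine hgood z hz (hVW hzV) ?_
      have hEz := hU.map_rightMul_mem hF hz hE
      have h6 := hF.freeDim_sup_add_inf hEz hY
      have h7 := hF.freeDim_mono (hF.sup_mem _ hEz _ hY) hY'
        (sup_le ((map_rightMul_le_mul hzZ).trans h4) h3)
      rw [freeDim_map_rightMul hF (hU.le_normalizing z hz) hE] at h6
      have h8 := Nat.pow_le_pow_left hdVW 2
      omega
    exact ne_zero_of_mem_normalizing (hU.le_normalizing z hz)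
      ((Submodule.disjoint_def.1 h1) z hzG hzV)

end Saturated

/-! ### Counting perspectivity classes -/

section Counting

variable {S : Type*} [Ring S] {R : Subring S} {F : Set (Submodule R S)} {U : Submonoid S}
  [InvariantBasisNumber R]

omit [InvariantBasisNumber R] in
theorem Perspective.mul_left (hU : IsNormal F U) {a u v : S} (ha : a ∈ U)
    (h : Perspective R U u v) : Perspective R U (a * u) (a * v) := by
  have ha' := hU.le_normalizing a ha
  rcases h with h | ⟨w, hw, h1, h2, h3⟩
  · left
    rw [point, point, ← leftTranslate_span_singleton ha', ← point, h, leftTranslate_span_singleton ha']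
  · right
    refine ⟨a * w, U.mul_mem ha hw, ?_, ?_, ?_⟩
    · rw [point, point, ← leftTranslate_span_singleton ha', ← leftTranslate_span_singleton ha',
        ← leftTranslate_sup ha']
      exact mul_mem_leftTranslate h1
    · rw [point, point, ← leftTranslate_span_singleton ha', ← leftTranslate_span_singleton ha']
      exact fun h => h2 (leftTranslate_injective ha' h)
    · rw [point, point, ← leftTranslate_span_singleton ha', ← leftTranslate_span_singleton ha']
      exact fun h => h3 (leftTranslate_injective ha' h)

omit [InvariantBasisNumber R] in
theorem map_rightMul_injective {g : S} (hg : g ∈ normalizing R) :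
    Function.Injective (Submodule.map (rightMul R g) : Submodule R S → Submodule R S) :=
  Submodule.map_injective_of_injective (rightMul_injective hg)

omit [InvariantBasisNumber R] in
theorem Perspective.mul_right (hU : IsNormal F U) {a u v : S} (ha : a ∈ U)
    (h : Perspective R U u v) : Perspective R U (u * a) (v * a) := by
  have ha' := hU.le_normalizing a ha
  rcases h with h | ⟨w, hw, h1, h2, h3⟩
  · left
    rw [point, point, ← map_rightMul_span_singleton, ← point, h, map_rightMul_span_singleton]
  · right
    refine ⟨w * a, U.mul_mem hw ha, ?_, ?_, ?_⟩
    · rw [point, point, ← map_rightMul_span_singleton, ← map_rightMul_span_singleton,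
        ← Submodule.map_sup]
      exact ⟨w, h1, rfl⟩
    · rw [point, point, ← map_rightMul_span_singleton, ← map_rightMul_span_singleton]
      exact fun h => h2 (map_rightMul_injective ha' h)
    · rw [point, point, ← map_rightMul_span_singleton, ← map_rightMul_span_singleton]
      exact fun h => h3 (map_rightMul_injective ha' h)

variable (hF : IsFiniteApproximationSystem F) (hU : IsNormal F U)
include hF hU

/-- The third point on the line through $ua$ and $va$ can be divided by $a$ on the right within $F$.
This cancellation separates the classes in the counting argument. -/
theorem Perspective.of_mul_right {a u v : S} (ha : a ∈ U) (hu : u ∈ U) (hv : v ∈ U)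
    (h : Perspective R U (u * a) (v * a)) : Perspective R U u v := by
  have ha' := hU.le_normalizing a ha
  rcases h with h | ⟨w, hw, h1, h2, h3⟩
  · left
    rw [point, point, ← map_rightMul_span_singleton, ← map_rightMul_span_singleton] at h
    exact map_rightMul_injective ha' h
  · rw [point, point, ← map_rightMul_span_singleton, ← map_rightMul_span_singleton,
      ← Submodule.map_sup] at h1
    obtain ⟨x, hx, hxw⟩ := h1
    rw [rightMul_apply] at hxw
    have hZ : rightDiv (point R u ⊔ point R v) a (point R w) ∈ F :=
      hU.rightDiv_mem hF ha (hU.span_mem w hw)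
        (hF.sup_mem _ (hU.span_mem u hu) _ (hU.span_mem v hv))
    obtain ⟨y, hy, hyZ⟩ := hU.exists_mem hZ (by
      intro h0
      have hxm : x ∈ rightDiv (point R u ⊔ point R v) a (point R w) :=
        (mem_rightDiv ha').2 ⟨hx, by rw [hxw]; exact mem_point w⟩
      rw [h0, Submodule.mem_bot] at hxm
      rw [hxm, zero_mul] at hxw
      exact ne_zero_of_mem_normalizing (hU.le_normalizing w hw) hxw.symm)
    rw [mem_rightDiv ha'] at hyZ
    have hyw := point_eq_of_mem hF hU (U.mul_mem hy ha) hw hyZ.2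
    right
    refine ⟨y, hy, hyZ.1, fun h => h2 ?_, fun h => h3 ?_⟩
    · rw [← hyw, point, point, ← map_rightMul_span_singleton, ← map_rightMul_span_singleton]
      exact congrArg _ h
    · rw [← hyw, point, point, ← map_rightMul_span_singleton, ← map_rightMul_span_singleton]
      exact congrArg _ h

/-- The spans of `s` and of its complement have dimension at most their cardinalities and together
span $X$, so both bounds are equalities. -/
theorem freeDim_biSup_basis {X : Submodule R S} {N : ℕ}
    (c : Module.Basis (Fin N) R X) (hc : ∀ i, (c i : S) ∈ U) (s : Finset (Fin N)) :
    freeDim R (⨆ i ∈ s, point R (c i : S) : Submodule R S) = s.card := by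
  have h1 : ∀ s : Finset (Fin N), freeDim R (⨆ i ∈ s, point R (c i : S) : Submodule R S) ≤
      s.card := by
    intro s
    refine (hF.freeDim_biSup_le s _ fun i _ => hU.span_mem _ (hc i)).trans ?_
    rw [Finset.sum_congr rfl fun i _ => freeDim_span_singleton (hU.le_normalizing _ (hc i))]
    simp
  have h2 := hF.freeDim_sup_add_inf (hF.biSup_mem s _ fun i _ => hU.span_mem _ (hc i))
    (hF.biSup_mem sᶜ _ fun i _ => hU.span_mem _ (hc i))
  have h3 : (⨆ i ∈ s, point R (c i : S)) ⊔ (⨆ i ∈ sᶜ, point R (c i : S)) = X := by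
    rw [← Finset.iSup_union, Finset.union_compl]
    conv_rhs => rw [eq_iSup_span_basis c]
    simp
  rw [h3, freeDim_eq c] at h2
  have h4 := h1 s
  have h5 := h1 sᶜ
  simp only [point] at h4 h5 ⊢
  rw [Finset.card_compl, Fintype.card_fin] at h5
  have h6 : s.card ≤ N := by simpa using Finset.card_le_univ s
  omega

/-- If all perspectivity classes of `X` have dimension at least `M`, and left multiplication by
the points of a class takes most of `W` almost entirely into `Y`, then `Y` is large. -/
theorem card_mul_le_of_perspective {X W Y : Submodule R S} (hX : X ∈ F) (hW : W ∈ F) (hY : Y ∈ F)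
    (M e t : ℕ)
    (hM : ∀ p ∈ U, p ∈ X → ∃ C ∈ F, C ≤ X ∧ M ≤ freeDim R C ∧
      ∀ q ∈ U, q ∈ C → Perspective R U q p)
    (hgood : ∀ E ∈ F, E ≠ ⊥ → E ≤ X →
      (∀ u ∈ U, u ∈ E → ∀ v ∈ U, v ∈ E → Perspective R U u v) → ∀ G ∈ F, G ≤ W →
      (∀ w ∈ U, w ∈ W → freeDim R E ≤
        freeDim R (E.map (rightMul R w) ⊓ Y : Submodule R S) + e → w ∈ G) →
      freeDim R W ≤ freeDim R G + 2 * t) :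
    M * (freeDim R X * freeDim R W) ≤ M * (freeDim R X * (2 * t)) +
      freeDim R W * (M * freeDim R Y + e * freeDim R X) := by
  classical
  obtain ⟨N, c, hc⟩ := hU.exists_basis X hX
  obtain ⟨d, g, hg⟩ := hU.exists_basis W hW
  rw [freeDim_eq c, freeDim_eq g]
  rw [freeDim_eq g] at hgood
  have hXc : X = ⨆ i ∈ (Finset.univ : Finset (Fin N)), point R (c i : S) := by
    conv_lhs => rw [eq_iSup_span_basis c]
    simp
  have hWg : W = ⨆ i ∈ (Finset.univ : Finset (Fin d)), point R (g i : S) := by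
    conv_lhs => rw [eq_iSup_span_basis g]
    simp
  -- `s i` is the set of basis indices in the class of `c i`, and `E (s i)` contains exactly the
  -- points of $X$ in that class.
  let s : Fin N → Finset (Fin N) := fun i => Finset.univ.filter fun k => Perspective R U (c k) (c i)
  let E : Finset (Fin N) → Submodule R S := fun σ => ⨆ i ∈ σ, point R (c i : S)
  have hEF : ∀ σ, E σ ∈ F := fun σ => hF.biSup_mem σ _ fun i _ => hU.span_mem _ (hc i)
  have hEd : ∀ σ, freeDim R (E σ) = σ.card := freeDim_biSup_basis hF hU c hc
  have his : ∀ i, i ∈ s i := fun i => Finset.mem_filter.2 ⟨Finset.mem_univ i, .refl _⟩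
  have hEs : ∀ i, ∀ p ∈ U, p ∈ E (s i) → Perspective R U p (c i) := by
    intro i p hp hpE
    obtain ⟨k, hk, q, hq, hqk, hpq⟩ := exists_perspective_of_mem_biSup hF hU _ _
      (fun k _ => hU.span_mem _ (hc k)) hp hpE
    have h1 : Perspective R U q (c k) := Or.inl (point_eq_of_mem hF hU hq (hc k) hqk)
    exact (hpq.trans hF hU hp hq (hc k) h1).trans hF hU hp (hc k) (hc i)
      (Finset.mem_filter.1 hk).2
  have hmemE : ∀ i, ∀ p ∈ U, p ∈ X → Perspective R U p (c i) → p ∈ E (s i) := by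
    intro i p hp hpX hpi
    rw [hXc] at hpX
    exact mem_biSup_perspective hF hU _ _ (fun k _ => hc k) (c i) hp (hc i) hpi hpX (s i)
      (Finset.filter_subset _ _) fun k hk hki => Finset.mem_filter.2 ⟨hk, hki⟩
  have hMs : ∀ i, M ≤ (s i).card := by
    intro i
    obtain ⟨C, hC, hCX, hMC, hCp⟩ := hM _ (hc i) (c i).2
    rw [← hEd]
    exact hMC.trans (hF.freeDim_mono hC (hEF _) (hU.le_of_forall_mem hC fun q hq hqC =>
      hmemE i q hq (hCX hqC) (hCp q hq hqC)))
  have hss : ∀ i k, Perspective R U (c i) (c k) → s i = s k := by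
    intro i k hik
    ext l
    simp only [s, Finset.mem_filter, Finset.mem_univ, true_and]
    exact ⟨fun h => h.trans hF hU (hc l) (hc i) (hc k) hik,
      fun h => h.trans hF hU (hc l) (hc k) (hc i) hik.symm⟩
  -- The good $w$ need not be a basis vector of $W$; only its class is recorded, by the index `j` of
  -- a basis vector perspective to it.
  let P : Fin N → Fin d → Prop := fun i j => ∃ w ∈ U, w ∈ W ∧ Perspective R U w (g j) ∧
    (s i).card ≤ freeDim R ((E (s i)).map (rightMul R w) ⊓ Y : Submodule R S) + e
  have hrow : ∀ i, d ≤ (Finset.univ.filter fun j => P i j).card + 2 * t := by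
    intro i
    rw [← freeDim_biSup_basis hF hU g hg]
    refine hgood (E (s i)) (hEF _) ?_ ?_ ?_ _ (hF.biSup_mem _ _ fun i _ => hU.span_mem _ (hg i))
      ?_ ?_
    · intro h0
      have h1 := hEd (s i)
      rw [h0, freeDim_bot] at h1
      exact Finset.card_ne_zero_of_mem (his i) h1.symm
    · exact iSup₂_le fun k _ => point_le_iff.2 (c k).2
    · intro u hu huE v hv hvE
      exact (hEs i u hu huE).trans hF hU hu (hc i) hv (hEs i v hv hvE).symm
    · exact iSup₂_le fun k _ => point_le_iff.2 (g k).2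
    · intro w hw hwW hgw
      rw [hEd] at hgw
      have hwW' := hwW
      rw [hWg] at hwW'
      exact mem_biSup_perspective hF hU _ _ (fun k _ => hg k) w hw hw (.refl w) hwW' _
        (Finset.filter_subset _ _) fun k hk hkw =>
          Finset.mem_filter.2 ⟨hk, w, hw, hwW, hkw.symm, hgw⟩
  -- The classes partition the basis of $X$ into sets of size at least $M$, so there are at most
  -- $N/M$ of them.
  have hclass : (Finset.univ.image s).card * M ≤ N := by
    have h1 : ((Finset.univ.image s).biUnion id).card = ∑ σ ∈ Finset.univ.image s, σ.card := by
      refine Finset.card_biUnion ?_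
      intro σ hσ τ hτ hστ
      obtain ⟨i, -, rfl⟩ := Finset.mem_image.1 hσ
      obtain ⟨k, -, rfl⟩ := Finset.mem_image.1 hτ
      change Disjoint (s i) (s k)
      rw [Finset.disjoint_left]
      intro l hl hl'
      refine hστ (hss i k ?_)
      exact ((Finset.mem_filter.1 hl).2.symm).trans hF hU (hc i) (hc l) (hc k)
        (Finset.mem_filter.1 hl').2
    have h2 : ((Finset.univ.image s).biUnion id).card ≤ N := by
      simpa using Finset.card_le_univ ((Finset.univ.image s).biUnion id)
    rw [h1] at h2
    refine le_trans ?_ h2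
    rw [← smul_eq_mul]
    refine Finset.card_nsmul_le_sum _ _ _ ?_
    intro σ hσ
    obtain ⟨i, -, rfl⟩ := Finset.mem_image.1 hσ
    exact hMs i
  have hcol : ∀ j, (Finset.univ.filter fun i => P i j).card ≤
      freeDim R Y + e * (Finset.univ.image s).card := by
    intro j
    rcases isEmpty_or_nonempty (Fin N) with hN | hN
    · rw [Finset.univ_eq_empty, Finset.filter_empty, Finset.card_empty]
      exact Nat.zero_le _
    let T := (Finset.univ.filter fun i => P i j).image s
    have hT : T ⊆ Finset.univ.image s := Finset.image_subset_image (Finset.filter_subset _ _)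
    have hTi : ∀ σ ∈ T, ∃ i, s i = σ ∧ P i j := by
      intro σ hσ
      obtain ⟨i, hi, rfl⟩ := Finset.mem_image.1 hσ
      exact ⟨i, rfl, (Finset.mem_filter.1 hi).2⟩
    choose! i hi hPi using hTi
    choose! w hw hwW hwg hwd using hPi
    have h1 : (Finset.univ.filter fun i => P i j).card ≤ ∑ σ ∈ T, σ.card := by
      refine le_trans (Finset.card_le_card ?_) (Finset.card_biUnion_le (s := T) (t := id))
      intro k hk
      exact Finset.mem_biUnion.2 ⟨s k, Finset.mem_image_of_mem s hk, his k⟩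
    have h2 : ∑ σ ∈ T, σ.card ≤
        ∑ σ ∈ T, (freeDim R ((E σ).map (rightMul R (w σ)) ⊓ Y : Submodule R S) + e) := by
      refine Finset.sum_le_sum fun σ hσ => ?_
      have := hwd σ hσ
      rwa [hi σ hσ] at this
    rw [Finset.sum_add_distrib, Finset.sum_const, smul_eq_mul] at h2
    have h3 : ∑ σ ∈ T, freeDim R ((E σ).map (rightMul R (w σ)) ⊓ Y : Submodule R S) ≤
        freeDim R Y := by
      refine sum_freeDim_le_of_not_perspective hF hU T _
        (fun σ hσ => hF.inf_mem _ (hU.map_rightMul_mem hF (hw σ hσ) (hEF σ)) _ hY) hY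
        (fun σ hσ => inf_le_right) ?_
      -- All points of $E_\sigma w$ lie in the class of $c_{i(\sigma)}g_j$. Cancelling $g_j$ on the
      -- right, different $\sigma$ give non-perspective points, so the modules $E_\sigma w\cap Y$
      -- are independent in $Y$.
      have key : ∀ σ ∈ T, ∀ p ∈ U, p ∈ (E σ).map (rightMul R (w σ)) ⊓ Y →
          Perspective R U p (c (i σ) * g j) := by
        intro σ hσ p hp hpE
        have h4 : p ∈ ⨆ k ∈ σ, point R ((c k : S) * w σ) := by
          have h5 := hpE.1
          simp only [E, Submodule.map_iSup, point, map_rightMul_span_singleton] at h5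
          exact h5
        obtain ⟨k, hk, q, hq, hqk, hpq⟩ := exists_perspective_of_mem_biSup hF hU _ _
          (fun k _ => hU.span_mem _ (U.mul_mem (hc k) (hw σ hσ))) hp h4
        have h5 := U.mul_mem (hc k) (hw σ hσ)
        have h6 := U.mul_mem (hc (i σ)) (hw σ hσ)
        have h7 : Perspective R U q (c k * w σ) := Or.inl (point_eq_of_mem hF hU hq h5 hqk)
        have h8 : Perspective R U (c k) (c (i σ)) := by
          rw [← hi σ hσ] at hk
          exact (Finset.mem_filter.1 hk).2
        exact ((hpq.trans hF hU hp hq h5 h7).trans hF hU hp h5 h6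
          (h8.mul_right hU (hw σ hσ))).trans hF hU hp h6 (U.mul_mem (hc _) (hg j))
          ((hwg σ hσ).mul_left hU (hc _))
      intro σ hσ τ hτ hστ p hp hpσ q hq hqτ hpq
      have h4 := key σ hσ p hp hpσ
      have h5 := key τ hτ q hq hqτ
      have h6 := U.mul_mem (hc (i σ)) (hg j)
      have h7 := U.mul_mem (hc (i τ)) (hg j)
      have h8 : Perspective R U (c (i σ) * g j) (c (i τ) * g j) :=
        (h4.symm.trans hF hU h6 hp hq hpq).trans hF hU h6 hq h7 h5
      have h9 := hss _ _ (h8.of_mul_right hF hU (hg j) (hc _) (hc _))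
      rw [hi σ hσ, hi τ hτ] at h9
      exact hστ h9
    have h4 : T.card * e ≤ e * (Finset.univ.image s).card := by
      rw [mul_comm]
      exact Nat.mul_le_mul_left e (Finset.card_le_card hT)
    omega
  -- Double count of `P`: rows have at least $d-2t$ entries, columns at most $\dim
  -- Y+e\cdot\#\text{classes}$. Multiplying by $M$ turns the number of classes into $N$.
  have hdouble := Finset.sum_card_bipartiteAbove_eq_sum_card_bipartiteBelow
    (s := (Finset.univ : Finset (Fin N))) (t := (Finset.univ : Finset (Fin d))) P
  simp only [Finset.bipartiteAbove, Finset.bipartiteBelow] at hdouble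
  have h1 : N * d ≤ ∑ i : Fin N, (Finset.univ.filter fun j => P i j).card + N * (2 * t) := by
    have := Finset.sum_le_sum fun i (_ : i ∈ (Finset.univ : Finset (Fin N))) => hrow i
    rw [Finset.sum_add_distrib] at this
    simpa using this
  have h2 : ∑ j : Fin d, (Finset.univ.filter fun i => P i j).card ≤
      d * (freeDim R Y + e * (Finset.univ.image s).card) := by
    have := Finset.sum_le_sum fun j (_ : j ∈ (Finset.univ : Finset (Fin d))) => hcol j
    simpa using this
  rw [hdouble] at h1
  calc M * (N * d) ≤ M * (d * (freeDim R Y + e * (Finset.univ.image s).card) + N * (2 * t)) :=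
        Nat.mul_le_mul_left M (by omega)
    _ = M * (N * (2 * t)) + d * (M * freeDim R Y + e * ((Finset.univ.image s).card * M)) := by ring
    _ ≤ _ := by gcongr

end Counting

/-! ### The infimum rule -/

section Infimum

variable {S : Type*} [Ring S] {R : Subring S}

/-- All points of `E` are perspective to each other. -/
def IsHomogeneous (U : Submonoid S) (E : Submodule R S) : Prop :=
  ∀ u ∈ U, u ∈ E → ∀ v ∈ U, v ∈ E → Perspective R U u v

theorem IsLeftSaturated.exists_eq_mul {F : Set (Submodule R S)} {U : Submonoid S}
    (hU : IsNormal F U) (hs : IsLeftSaturated F U) {x u : S} (hx : x ∈ U) (hu : u ∈ U)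
    {W : Submodule R S} (h : u ∈ leftTranslate x W) : ∃ w ∈ U, w ∈ W ∧ x * w = u := by
  obtain ⟨w, hw, rfl⟩ := (mem_leftTranslate (hU.le_normalizing x hx)).1 h
  exact ⟨w, hs.mem_of_mul_mem x hx w hu, hw, rfl⟩

theorem IsLeftSaturated.isHomogeneous_leftTranslate {F : Set (Submodule R S)} {U : Submonoid S}
    (hU : IsNormal F U) (hs : IsLeftSaturated F U) {x : S} (hx : x ∈ U) {E : Submodule R S}
    (hE : IsHomogeneous U E) : IsHomogeneous U (leftTranslate x E) := by
  intro u hu huE v hv hvE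
  obtain ⟨a, ha, haE, rfl⟩ := hs.exists_eq_mul hU hx hu huE
  obtain ⟨b, hb, hbE, rfl⟩ := hs.exists_eq_mul hU hx hv hvE
  exact (hE a ha haE b hb hbE).mul_left hU hx

/-- Division by $Md$: the exceptional part of $W$ costs $2\theta$, the error $e$ one more $\theta$.
-/
theorem le_of_card_mul_le {N d y M e t : ℕ} {θ : ℝ} (hd : 0 < d) (hM : 0 < M)
    (ht : (t : ℝ) ≤ θ * d) (he : (e : ℝ) ≤ θ * M)
    (h : M * (N * d) ≤ M * (N * (2 * t)) + d * (M * y + e * N)) : (1 - 3 * θ) * N ≤ y := by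
  have h1 : (M : ℝ) * (N * d) ≤ M * (N * (2 * t)) + d * (M * y + e * N) := by exact_mod_cast h
  have hd' : (0 : ℝ) < d := by exact_mod_cast hd
  have hM' : (0 : ℝ) < M := by exact_mod_cast hM
  have h2 : (M : ℝ) * (N * (2 * t)) ≤ M * (N * (2 * (θ * d))) := by gcongr
  have h3 : (d : ℝ) * (M * y + e * N) ≤ d * (M * y + θ * M * N) := by gcongr
  have h4 : (M * d : ℝ) * ((1 - 3 * θ) * N) ≤ (M * d) * y := by nlinarith
  exact le_of_mul_le_mul_left h4 (by positivity)

theorem mul_submodule_mono_right {V W W' : Submodule R S} (h : W ≤ W') : V * W ≤ V * W' :=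
  Submodule.mul_le.2 fun _ hm _ hn => Submodule.mul_mem_mul hm (h hn)

variable [InvariantBasisNumber R]

/-- A family of members of `F` which is rich enough for the infimum rule: members of the family
which almost contain all left translates of a fixed member by points of `X * C` have
almost full dimension. -/
structure IsCoveringFamily (F : Set (Submodule R S)) (U : Submonoid S)
    (G : Set (Submodule R S)) : Prop where
  subset : G ⊆ F
  bot_mem : ⊥ ∈ G
  exists_ne_bot : ∃ W ∈ G, W ≠ ⊥
  sup_mem : ∀ V ∈ G, ∀ W ∈ G, V ⊔ W ∈ G
  inf_mem : ∀ V ∈ G, ∀ W ∈ G, V ⊓ W ∈ G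
  leftTranslate_mem : ∀ g ∈ U, ∀ W ∈ G, leftTranslate g W ∈ G
  cover : ∀ θ : ℝ, 0 < θ → ∀ W ∈ G, W ≠ ⊥ → ∃ C ∈ F, C ≠ ⊥ ∧ ∀ X ∈ F, X * C ∈ G ∧
    ∀ Y ∈ G, (∀ c ∈ U, c ∈ X * C →
      (freeDim R (leftTranslate c W ⊔ Y : Submodule R S) : ℝ) ≤
        freeDim R Y + θ * freeDim R W) →
      (1 - 3 * θ) * freeDim R (X * C : Submodule R S) ≤ freeDim R Y

variable {F : Set (Submodule R S)} {U : Submonoid S}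
  (hF : IsFiniteApproximationSystem F) (hU : IsNormal F U)
include hF hU

/-- Choose $C$ homogeneous with $\theta\dim C\ge(\dim W)^2$. Since $XC$ is a sum of translates $xC$,
each of its classes has dimension at least $\dim C$, which makes the error of the rank argument
negligible. -/
theorem IsLeftSaturated.isCoveringFamily_of_unbounded (hs : IsLeftSaturated F U)
    (h : ∀ m : ℕ, ∃ C ∈ F, IsHomogeneous U C ∧ m ≤ freeDim R C) : IsCoveringFamily F U F where
  subset := subset_rfl
  bot_mem := hF.bot_mem
  exists_ne_bot := by
    obtain ⟨C, hC, -, h1⟩ := h 1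
    refine ⟨C, hC, ?_⟩
    rintro rfl
    rw [freeDim_bot] at h1
    omega
  sup_mem := fun V hV W hW => hF.sup_mem V hV W hW
  inf_mem := fun V hV W hW => hF.inf_mem V hV W hW
  leftTranslate_mem := fun g hg W hW => hU.le_mul_mem hF hg hW
  cover := by
    intro θ hθ W hW hW0
    have hd := hF.freeDim_pos hW hW0
    obtain ⟨m, hm⟩ := exists_nat_ge ((freeDim R W : ℝ) ^ 2 / θ)
    obtain ⟨C, hC, hCh, hCm⟩ := h (m + 1)
    have hC0 : C ≠ ⊥ := by
      rintro rfl
      rw [freeDim_bot] at hCm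
      omega
    refine ⟨C, hC, hC0, fun X hX => ⟨hU.mul_mem hF hX hC, fun Y hY hcov => ?_⟩⟩
    refine le_of_card_mul_le hd (hF.freeDim_pos hC hC0)
      (Nat.floor_le (by positivity) : (⌊θ * freeDim R W⌋₊ : ℝ) ≤ _)
      (e := freeDim R W ^ 2) ?_ ?_
    · rw [div_le_iff₀ hθ] at hm
      have : (m : ℝ) ≤ freeDim R C := by exact_mod_cast (Nat.le_succ m).trans hCm
      push_cast
      nlinarith
    · refine card_mul_le_of_perspective hF hU (hU.mul_mem hF hX hC) hW hY _ _ _ ?_ ?_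
      · intro p hp hpX
        obtain ⟨n, x, hx, heq⟩ := hU.exists_mul_eq_iSup hX C
        have hpX' : p ∈ ⨆ i ∈ (Finset.univ : Finset (Fin n)), leftTranslate (x i) C := by
          rw [heq] at hpX
          simpa using hpX
        obtain ⟨i, -, q, hq, hqi, hpq⟩ := exists_perspective_of_mem_biSup hF hU _ _
          (fun i _ => hU.le_mul_mem hF (hx i).1 hC) hp hpX'
        refine ⟨leftTranslate (x i) C, hU.le_mul_mem hF (hx i).1 hC,
          leftTranslate_le_mul (hx i).2,
          (freeDim_leftTranslate hF (hU.le_normalizing _ (hx i).1) hC).ge, fun r hr hrC => ?_⟩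
        exact (hs.isHomogeneous_leftTranslate hU (hx i).1 hCh r hr hrC q hq hqi).trans hF hU hr hq
          hp hpq.symm
      · intro E hE hE0 hEX hEp G hG hGW hgood
        refine hs.freeDim_le_of_perspective hF hU hE hE0 hEp hW hY hG hGW ?_ hgood
        intro u hu huE
        have h1 := hcov u hu (hEX huE)
        have h2 := hF.freeDim_mono hY (hF.sup_mem _ (hU.le_mul_mem hF hu hW) _ hY)
          (le_sup_right : Y ≤ leftTranslate u W ⊔ Y)
        have h3 : freeDim R (leftTranslate u W ⊔ Y : Submodule R S) - freeDim R Y ≤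
            ⌊θ * freeDim R W⌋₊ := by
          apply Nat.le_floor
          rw [Nat.cast_sub h2]
          linarith
        omega

/-- When `C` is a homogeneous module of maximal dimension, its left translates are
complete perspectivity classes. -/
theorem IsLeftSaturated.mem_leftTranslate_of_perspective (hs : IsLeftSaturated F U)
    {C : Submodule R S} (hC : C ∈ F) (hCh : IsHomogeneous U C)
    (hmax : ∀ C' ∈ F, IsHomogeneous U C' → freeDim R C' ≤ freeDim R C) {x p q : S} (hx : x ∈ U)
    (hp : p ∈ U) (hq : q ∈ U) (hqC : q ∈ leftTranslate x C) (hpq : Perspective R U p q) :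
    p ∈ leftTranslate x C := by
  by_contra hpC
  have hxC := hU.le_mul_mem hF hx hC
  have h1 : ∀ r ∈ U, r ∈ leftTranslate x C ⊔ point R p → Perspective R U r q := by
    intro r hr hrC
    obtain ⟨s, hs', hsC | hsp, hrs⟩ :=
      exists_perspective_of_mem_sup hF hU hxC (hU.span_mem p hp) hr hrC
    · exact hrs.trans hF hU hr hs' hq
        (hs.isHomogeneous_leftTranslate hU hx hCh s hs' hsC q hq hqC)
    · have h2 : Perspective R U s p := Or.inl (point_eq_of_mem hF hU hs' hp hsp)
      exact (hrs.trans hF hU hr hs' hp h2).trans hF hU hr hp hq hpq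
  have h2 := hmax _ (hF.sup_mem _ hxC _ (hU.span_mem p hp)) fun u hu huC v hv hvC =>
    (h1 u hu huC).trans hF hU hu hq hv (h1 v hv hvC).symm
  have h3 := freeDim_sup_point hF hU hp hxC hpC
  rw [freeDim_leftTranslate hF (hU.le_normalizing x hx) hC] at h3
  simp only [point] at h2 h3
  omega

/-- The family consists of the modules that contain, with each point, its whole class, a translate
of $C$. If $uw\in Y$ then all of $Ew$ lies in $Y$, being in the class of $uw$; so the count applies
with error $e=0$, and $M=1$ is enough. -/
theorem IsLeftSaturated.isCoveringFamily_of_maximal (hs : IsLeftSaturated F U)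
    {C : Submodule R S} (hC : C ∈ F) (hC0 : C ≠ ⊥) (hCh : IsHomogeneous U C)
    (hmax : ∀ C' ∈ F, IsHomogeneous U C' → freeDim R C' ≤ freeDim R C) :
    IsCoveringFamily F U {X | X ∈ F ∧ ∀ p ∈ U, p ∈ X →
      ∃ x ∈ U, p ∈ leftTranslate x C ∧ leftTranslate x C ≤ X} where
  subset := fun X hX => hX.1
  bot_mem := ⟨hF.bot_mem, fun p hp hp0 =>
    absurd ((Submodule.mem_bot _).1 hp0) (ne_zero_of_mem_normalizing (hU.le_normalizing p hp))⟩
  exists_ne_bot := ⟨C, ⟨hC, fun p hp hpC => ⟨1, U.one_mem, by rwa [leftTranslate_one], by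
    rw [leftTranslate_one]⟩⟩, hC0⟩
  sup_mem := by
    rintro V ⟨hV, hV'⟩ W ⟨hW, hW'⟩
    refine ⟨hF.sup_mem _ hV _ hW, fun p hp hpX => ?_⟩
    obtain ⟨q, hq, hqV | hqW, hpq⟩ := exists_perspective_of_mem_sup hF hU hV hW hp hpX
    · obtain ⟨x, hx, h1, h2⟩ := hV' q hq hqV
      exact ⟨x, hx, hs.mem_leftTranslate_of_perspective hF hU hC hCh hmax hx hp hq h1 hpq,
        h2.trans le_sup_left⟩
    · obtain ⟨x, hx, h1, h2⟩ := hW' q hq hqW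
      exact ⟨x, hx, hs.mem_leftTranslate_of_perspective hF hU hC hCh hmax hx hp hq h1 hpq,
        h2.trans le_sup_right⟩
  inf_mem := by
    rintro V ⟨hV, hV'⟩ W ⟨hW, hW'⟩
    refine ⟨hF.inf_mem _ hV _ hW, fun p hp hpX => ?_⟩
    obtain ⟨x, hx, h1, h2⟩ := hV' p hp hpX.1
    obtain ⟨y, hy, h3, h4⟩ := hW' p hp hpX.2
    refine ⟨x, hx, h1, le_inf h2 (le_trans ?_ h4)⟩
    refine hU.le_of_forall_mem (hU.le_mul_mem hF hx hC) fun u hu huC => ?_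
    exact hs.mem_leftTranslate_of_perspective hF hU hC hCh hmax hy hu hp h3
      (hs.isHomogeneous_leftTranslate hU hx hCh u hu huC p hp h1)
  leftTranslate_mem := by
    rintro g hg W ⟨hW, hW'⟩
    refine ⟨hU.le_mul_mem hF hg hW, fun p hp hpX => ?_⟩
    obtain ⟨y, hy, hyW, rfl⟩ := hs.exists_eq_mul hU hg hp hpX
    obtain ⟨x, hx, h1, h2⟩ := hW' y hy hyW
    refine ⟨g * x, U.mul_mem hg hx, ?_⟩
    rw [leftTranslate_mul (hU.le_normalizing g hg) (hU.le_normalizing x hx)]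
    exact ⟨mul_mem_leftTranslate h1, leftTranslate_mono h2⟩
  cover := by
    intro θ hθ W hW hW0
    have hd := hF.freeDim_pos hW.1 hW0
    refine ⟨C, hC, hC0, fun X hX => ⟨⟨hU.mul_mem hF hX hC, fun p hp hpX => ?_⟩,
      fun Y hY hcov => ?_⟩⟩
    · obtain ⟨n, x, hx, heq⟩ := hU.exists_mul_eq_iSup hX C
      have hpX' : p ∈ ⨆ i ∈ (Finset.univ : Finset (Fin n)), leftTranslate (x i) C := by
        rw [heq] at hpX
        simpa using hpX
      obtain ⟨i, -, q, hq, hqi, hpq⟩ := exists_perspective_of_mem_biSup hF hU _ _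
        (fun i _ => hU.le_mul_mem hF (hx i).1 hC) hp hpX'
      exact ⟨x i, (hx i).1, hs.mem_leftTranslate_of_perspective hF hU hC hCh hmax (hx i).1 hp hq
        hqi hpq, leftTranslate_le_mul (hx i).2⟩
    · refine le_of_card_mul_le hd one_pos
        (Nat.floor_le (by positivity) : (⌊θ * freeDim R W⌋₊ : ℝ) ≤ _)
        (e := 0) (by simpa using hθ.le) ?_
      refine card_mul_le_of_perspective hF hU (hU.mul_mem hF hX hC) hW.1 hY.1 _ _ _ ?_ ?_
      · intro p hp hpX
        exact ⟨point R p, hU.span_mem p hp, point_le_iff.2 hpX,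
          (freeDim_span_singleton (hU.le_normalizing p hp)).ge,
          fun q hq hqp => Or.inl (point_eq_of_mem hF hU hq hp hqp)⟩
      · intro E hE hE0 hEX hEp G hG hGW hgood
        obtain ⟨u, hu, huE⟩ := hU.exists_mem hE hE0
        have hun := hU.le_normalizing u hu
        have huW := hU.le_mul_mem hF hu hW.1
        have h1 := hcov u hu (hEX huE)
        have h2 := hF.freeDim_mono hY.1 (hF.sup_mem _ huW _ hY.1)
          (le_sup_right : Y ≤ leftTranslate u W ⊔ Y)
        have h3 : freeDim R (leftTranslate u W ⊔ Y : Submodule R S) - freeDim R Y ≤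
            ⌊θ * freeDim R W⌋₊ := by
          apply Nat.le_floor
          rw [Nat.cast_sub h2]
          linarith
        have h4 := hF.freeDim_sup_add_inf huW hY.1
        have h5 : leftDiv hun W Y ∈ F := hs.leftDiv_mem hF hU hu hW.1 hY.1
        rw [freeDim_leftTranslate hF hun hW.1, ← leftTranslate_leftDiv hun,
          freeDim_leftTranslate hF hun h5] at h4
        -- One point $u$ of $E$ decides for all of $E$: everything that $u$ takes into $Y$ is good.
        -- So the rank bound for this single $u$ bounds the exceptional part.
        have h6 : leftDiv hun W Y ≤ G := by
          refine hU.le_of_forall_mem h5 fun w hw hwY => hgood w hw hwY.1 ?_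
          have h7 : E.map (rightMul R w) ≤ Y := by
            obtain ⟨n, b, hb⟩ := hU.exists_basis E hE
            rw [eq_iSup_span_basis b, Submodule.map_iSup]
            refine iSup_le fun i => ?_
            rw [map_rightMul_span_singleton, Submodule.span_singleton_le_iff_mem]
            obtain ⟨x, hx, h8, h9⟩ := hY.2 _ (U.mul_mem hu hw) hwY.2
            exact h9 (hs.mem_leftTranslate_of_perspective hF hU hC hCh hmax hx
              (U.mul_mem (hb i) hw) (U.mul_mem hu hw) h8
              ((hEp _ (hb i) (b i).2 u hu huE).mul_right hU hw))
          rw [inf_eq_left.2 h7, freeDim_map_rightMul hF (hU.le_normalizing w hw) hE]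
          exact Nat.le_add_right _ _
        have h7 := hF.freeDim_mono h5 hG h6
        omega

theorem IsLeftSaturated.exists_isCoveringFamily (hs : IsLeftSaturated F U) :
    ∃ G, IsCoveringFamily F U G := by
  by_cases h : ∀ m : ℕ, ∃ C ∈ F, IsHomogeneous U C ∧ m ≤ freeDim R C
  · exact ⟨F, hs.isCoveringFamily_of_unbounded hF hU h⟩
  · push Not at h
    obtain ⟨m, hm⟩ := h
    obtain ⟨C, ⟨hC, hCh⟩, hmax⟩ := exists_max_of_bounded
      (fun C : Submodule R S => C ∈ F ∧ IsHomogeneous U C) (fun C => freeDim R C) m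
      (fun C hC => (hm C hC.1 hC.2).le)
      ⟨⊥, hF.bot_mem, fun u hu hu0 => absurd ((Submodule.mem_bot _).1 hu0)
        (ne_zero_of_mem_normalizing (hU.le_normalizing u hu))⟩
    have h1 : 1 ≤ freeDim R C := by
      have h2 := hmax (point R 1) ⟨hU.span_mem 1 U.one_mem, fun u hu hu1 v hv hv1 => Or.inl
        ((point_eq_of_mem hF hU hu U.one_mem hu1).trans
          (point_eq_of_mem hF hU hv U.one_mem hv1).symm)⟩
      rwa [freeDim_span_singleton (hU.le_normalizing 1 U.one_mem)] at h2
    have hC0 : C ≠ ⊥ := by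
      rintro rfl
      rw [freeDim_bot] at h1
      omega
    exact ⟨_, hs.isCoveringFamily_of_maximal hF hU hC hC0 hCh fun C' hC' h' => hmax C' ⟨hC', h'⟩⟩

omit hF hU in
/-- A monotone, submodular and left invariant function on `F` which is Lipschitz
for the dimension. -/
structure IsSubmodularRank (F : Set (Submodule R S)) (U : Submonoid S) (B : ℝ)
    (φ : Submodule R S → ℝ) : Prop where
  bot : φ ⊥ = 0
  mono : ∀ V ∈ F, ∀ W ∈ F, V ≤ W → φ V ≤ φ W
  lipschitz : ∀ V ∈ F, ∀ W ∈ F, V ≤ W → φ W ≤ φ V + B * (freeDim R W - freeDim R V)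
  submodular : ∀ V ∈ F, ∀ W ∈ F, φ (V ⊔ W) + φ (V ⊓ W) ≤ φ V + φ W
  leftTranslate : ∀ g ∈ U, ∀ W ∈ F, φ (leftTranslate g W) = φ W

/-- The limit is the infimum of $\varphi(W)/\dim W$ over a covering family $G$. The argument needs
sums and intersections of translates to stay in $G$, while the invariant $W$ itself need not be in
$G$. -/
theorem IsLeftSaturated.exists_limit (hs : IsLeftSaturated F U) {φ : Submodule R S → ℝ} {B : ℝ}
    (hB : 0 ≤ B) (hφ : IsSubmodularRank F U B φ) :
    ∃ l : ℝ, ∀ η : ℝ, 0 < η → ∃ V : Finset S, ∃ ε : ℝ, 0 < ε ∧ ∀ W ∈ nonzeroPart F,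
      IsInvariant F V ε W → |φ W / freeDim R W - l| ≤ η := by
  obtain ⟨G, hG⟩ := hs.exists_isCoveringFamily hF hU
  have hnonneg : ∀ W ∈ F, 0 ≤ φ W := fun W hW => by
    rw [← hφ.bot]
    exact hφ.mono _ hF.bot_mem _ hW bot_le
  let I : Set ℝ := (fun W : Submodule R S => φ W / freeDim R W) '' {W | W ∈ G ∧ W ≠ ⊥}
  have hIne : I.Nonempty := by
    obtain ⟨W, hW, hW0⟩ := hG.exists_ne_bot
    exact ⟨_, W, ⟨hW, hW0⟩, rfl⟩
  have hIb : BddBelow I := by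
    refine ⟨0, ?_⟩
    rintro _ ⟨W, ⟨hW, -⟩, rfl⟩
    exact div_nonneg (hnonneg W (hG.subset hW)) (Nat.cast_nonneg _)
  have hdpos : ∀ W ∈ F, W ≠ ⊥ → (0 : ℝ) < freeDim R W := fun W hW h0 => by
    exact_mod_cast hF.freeDim_pos hW h0
  set l := sInf I with hl
  have hl0 : 0 ≤ l := by
    apply Real.sInf_nonneg
    rintro _ ⟨W, ⟨hW, -⟩, rfl⟩
    exact div_nonneg (hnonneg W (hG.subset hW)) (Nat.cast_nonneg _)
  have hlle : ∀ W ∈ G, l * freeDim R W ≤ φ W := by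
    intro W hW
    by_cases h0 : W = ⊥
    · rw [h0, hφ.bot, freeDim_bot]; simp
    · rw [← le_div_iff₀ (hdpos W (hG.subset hW) h0)]
      exact csInf_le hIb ⟨W, ⟨hW, h0⟩, rfl⟩
  refine ⟨l, fun η hη => ?_⟩
  have hden : 0 < l + 2 + 7 * B := by positivity
  -- The sum $l+2+7B$ collects the losses of the upper estimate: $(l+\theta)(1+\theta)\le
  -- l+(l+2)\theta$ and a Lipschitz term $7B\theta$.
  let θ : ℝ := min 1 (η / (l + 2 + 7 * B))
  have hθ : 0 < θ := lt_min one_pos (by positivity)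
  have hθ1 : θ ≤ 1 := min_le_left _ _
  have hθη : θ * (l + 2 + 7 * B) ≤ η := by
    rw [← le_div_iff₀ hden]
    exact min_le_right _ _
  -- The precision $\theta^2$ is needed because a translate of $T$ may add only $\theta\dim T$
  -- dimensions to $Y$, while its whole excess $\theta^2\dim T$ must be paid from the gain $\theta$
  -- per new dimension.
  obtain ⟨_, ⟨T, ⟨hT, hT0⟩, rfl⟩, hTl⟩ := exists_lt_of_csInf_lt hIne
    (show sInf I < l + θ ^ 2 by rw [← hl]; linarith [pow_pos hθ 2])
  have hTF := hG.subset hT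
  have hTd := hdpos T hTF hT0
  have hTφ : φ T ≤ (l + θ ^ 2) * freeDim R T := by
    rw [← div_le_iff₀ hTd]
    exact hTl.le
  obtain ⟨C, hC, hC0, hcover⟩ := hG.cover θ hθ T hT hT0
  have hCT := hU.mul_mem hF hC hTF
  -- Invariance under $C+CT$ keeps both $WC$ and all translates $cT$, $c\in WC$, inside the
  -- enlargement of $W$.
  obtain ⟨V, hV⟩ := hU.exists_mul_le (hF.sup_mem _ hC _ hCT)
  refine ⟨V, θ, hθ, ?_⟩
  rintro W ⟨hW, hW0⟩ hinv
  obtain ⟨W', hW', hWW', hWC', hdim⟩ := hV θ W hW hinv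
  have hNpos := hdpos W hW hW0
  have hWCmem := hU.mul_mem hF hW hC
  have hWC : W * C ≤ W' := (mul_submodule_mono_right le_sup_left).trans hWC'
  have hWCT : W * C * T ≤ W' := by
    rw [mul_assoc]
    exact (mul_submodule_mono_right le_sup_right).trans hWC'
  obtain ⟨hWCG, hcoverW⟩ := hcover W hW
  have hWCd : (freeDim R W : ℝ) ≤ freeDim R (W * C : Submodule R S) := by
    obtain ⟨c, hc, hcC⟩ := hU.exists_mem hC hC0
    rw [← freeDim_map_rightMul hF (hU.le_normalizing c hc) hW]
    exact_mod_cast hF.freeDim_mono (hU.map_rightMul_mem hF hc hW) hWCmem (map_rightMul_le_mul hcC)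
  have hWCW' : (freeDim R (W * C : Submodule R S) : ℝ) ≤ freeDim R W' := by
    exact_mod_cast hF.freeDim_mono hWCmem hW' hWC
  obtain ⟨Y, ⟨hY, hYW', hYφ⟩, hYmax⟩ := exists_max_of_bounded
    (fun Y : Submodule R S => Y ∈ G ∧ Y ≤ W' ∧ φ Y ≤ (l + θ) * freeDim R Y)
    (fun Y => freeDim R Y) (freeDim R W')
    (fun Y hY => hF.freeDim_mono (hG.subset hY.1) hW' hY.2.1)
    ⟨⊥, hG.bot_mem, bot_le, by rw [hφ.bot, freeDim_bot]; simp⟩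
  have hYF := hG.subset hY
  have hYd : (1 - 3 * θ) * freeDim R (W * C : Submodule R S) ≤ freeDim R Y := by
    refine hcoverW Y hY fun c hc hcW => ?_
    by_contra! hcon
    have hcT := hG.leftTranslate_mem c hc T hT
    have hcTF := hG.subset hcT
    have h1 : (freeDim R (leftTranslate c T ⊔ Y : Submodule R S) : ℝ) +
        freeDim R (leftTranslate c T ⊓ Y : Submodule R S) = freeDim R T + freeDim R Y := by
      rw [← freeDim_leftTranslate hF (hU.le_normalizing c hc) hTF]
      exact_mod_cast hF.freeDim_sup_add_inf hcTF hYF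
    have h2 := hφ.submodular _ hcTF _ hYF
    rw [hφ.leftTranslate c hc T hTF] at h2
    have h3 := hlle _ (hG.inf_mem _ hcT _ hY)
    -- Submodularity, with $\varphi(cT\cap Y)\ge l\dim(cT\cap Y)$, shows that $cT+Y$ satisfies the
    -- same bound as $Y$, contradicting maximality.
    have h4 := hYmax (leftTranslate c T ⊔ Y) ⟨hG.sup_mem _ hcT _ hY,
      sup_le ((leftTranslate_le_mul hcW).trans hWCT) hYW', by
        have h5 : freeDim R (leftTranslate c T ⊓ Y : Submodule R S) = freeDim R T + freeDim R Y -
          (freeDim R (leftTranslate c T ⊔ Y : Submodule R S) : ℝ) := by linarith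
        rw [h5] at h3
        nlinarith⟩
    have h5 : (freeDim R (leftTranslate c T ⊔ Y : Submodule R S) : ℝ) ≤ freeDim R Y := by
      exact_mod_cast h4
    have h6 : 0 < θ * freeDim R T := mul_pos hθ hTd
    linarith
  have hYW'd : (freeDim R Y : ℝ) ≤ freeDim R W' := by
    exact_mod_cast hF.freeDim_mono hYF hW' hYW'
  have hupper : φ W ≤ (l + η) * freeDim R W := by
    have h1 := hφ.mono _ hW _ hW' hWW'
    have h2 := hφ.lipschitz _ hYF _ hW' hYW'
    -- The constant 7 leaves room for both signs of $1-3\theta$; $\theta\le1$ and $\dim W\le\dim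
    -- WC\le\dim W'$ are used.
    have h3 : (freeDim R W' : ℝ) - freeDim R Y ≤ 7 * θ * freeDim R W := by nlinarith
    have h4 : B * ((freeDim R W' : ℝ) - freeDim R Y) ≤ B * (7 * θ * freeDim R W) :=
      mul_le_mul_of_nonneg_left h3 hB
    have h5 : (l + θ) * freeDim R Y ≤ (l + θ) * ((1 + θ) * freeDim R W) :=
      mul_le_mul_of_nonneg_left (hYW'd.trans hdim) (by positivity)
    have h6 : (l + θ) * (1 + θ) + 7 * B * θ ≤ l + η := by nlinarith
    nlinarith
  -- The infimum bounds $\varphi(WC)$ from below, and $W$ and $WC$ are compared through $W'$.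
  have hlower : (l - η) * freeDim R W ≤ φ W := by
    have h1 := hφ.lipschitz _ hW _ hW' hWW'
    have h2 := hφ.mono _ hWCmem _ hW' hWC
    have h3 := hlle _ hWCG
    have h4 : B * ((freeDim R W' : ℝ) - freeDim R W) ≤ B * (θ * freeDim R W) :=
      mul_le_mul_of_nonneg_left (by linarith) hB
    have h5 := mul_le_mul_of_nonneg_left hWCd hl0
    have h6 : B * θ ≤ η := by nlinarith
    nlinarith
  rw [abs_sub_le_iff]
  constructor
  · rw [sub_le_iff_le_add, div_le_iff₀ hNpos]
    linarith
  · rw [sub_le_comm, le_div_iff₀ hNpos]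
    exact hlower

end Infimum

/-! ### Left saturation of an amenable normal extension -/

section Saturation

variable {S : Type*} [Ring S] {R : Subring S}

theorem leftTranslate_le_of_mem_point {u v : S} (h : v ∈ point R u) (Z : Submodule R S) :
    leftTranslate v Z ≤ leftTranslate u Z := by
  have h1 : v ∈ point R u ⊔ point R u := by rwa [sup_idem]
  simpa using leftTranslate_le_sup h1 Z

theorem leftTranslate_congr_point {u v : S} (h : point R u = point R v) (Z : Submodule R S) :
    leftTranslate u Z = leftTranslate v Z :=
  le_antisymm (leftTranslate_le_of_mem_point (h ▸ mem_point u) Z)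
    (leftTranslate_le_of_mem_point (h ▸ mem_point v) Z)

theorem point_mul_congr {u v : S} (h : point R u = point R v) (w : S) :
    point R (u * w) = point R (v * w) := by
  rw [point, point, ← map_rightMul_span_singleton, ← map_rightMul_span_singleton]
  exact congrArg _ h

theorem exists_unit_of_point_eq {g h : S} (hg : g ∈ normalizing R) (hh : h ∈ normalizing R)
    (heq : point R g = point R h) : ∃ r s : R, r * s = 1 ∧ s * r = 1 ∧ h = r * g := by
  obtain ⟨r, hr⟩ := Submodule.mem_span_singleton.1 (heq ▸ mem_point h)
  obtain ⟨s, hs⟩ := Submodule.mem_span_singleton.1 (heq.symm ▸ mem_point g)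
  rw [Subring.smul_def, smul_eq_mul] at hr hs
  refine ⟨r, s, Subtype.ext (normalizing_mul_right_cancel hh ?_),
    Subtype.ext (normalizing_mul_right_cancel hg ?_), hr.symm⟩
  · rw [Subring.coe_mul, mul_assoc, hs, hr, Subring.coe_one, one_mul]
  · rw [Subring.coe_mul, mul_assoc, hr, hs, Subring.coe_one, one_mul]

theorem unit_mem_normalizing {r s : R} (h1 : r * s = 1) (h2 : s * r = 1) :
    (r : S) ∈ normalizing R := by
  have h1' : (r : S) * s = 1 := by exact_mod_cast congrArg Subtype.val h1
  have h2' : (s : S) * r = 1 := by exact_mod_cast congrArg Subtype.val h2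
  have hu : IsUnit (r : S) := ⟨⟨r, s, h1', h2'⟩, rfl⟩
  rw [mem_normalizing_iff hu.mem_nonZeroDivisors]
  constructor
  · intro a
    refine ⟨r * a * s, ?_⟩
    push_cast
    rw [mul_assoc _ (s : S), h2', mul_one]
  · intro b
    refine ⟨s * (b * r), ?_⟩
    push_cast
    rw [← mul_assoc, h1', one_mul]

theorem exists_basis_of_leftTranslate {g : S} (hg : g ∈ normalizing R) {W : Submodule R S} {n : ℕ}
    (c : Module.Basis (Fin n) R (leftTranslate g W)) :
    ∃ b : Module.Basis (Fin n) R W, ∀ i, (c i : S) = g * b i := by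
  have hz : ∀ i, ∃ w ∈ W, g * w = c i := fun i => (mem_leftTranslate hg).1 (c i).2
  choose z hzW hzc using hz
  let v : Fin n → W := fun i => ⟨z i, hzW i⟩
  have hv : ∀ r : Fin n → R, g * ((∑ i, r i • v i : W) : S) =
      ((∑ i, conj hg (r i) • c i : leftTranslate g W) : S) := by
    intro r
    rw [AddSubmonoidClass.coe_finsetSum, AddSubmonoidClass.coe_finsetSum, Finset.mul_sum]
    refine Finset.sum_congr rfl fun i _ => ?_
    simp only [v, Submodule.coe_smul, Subring.smul_def, smul_eq_mul]
    rw [← mul_assoc, conj_spec hg, mul_assoc, hzc]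
  have hli : LinearIndependent R v := by
    rw [Fintype.linearIndependent_iff]
    intro r hr i
    have h1 := hv r
    rw [hr, ZeroMemClass.coe_zero, mul_zero, eq_comm, ZeroMemClass.coe_eq_zero] at h1
    have h2 := Fintype.linearIndependent_iff.1 c.linearIndependent _ h1 i
    apply Subtype.ext
    apply normalizing_mul_left_cancel hg
    rw [conj_spec hg, h2]
    simp
  have hsp : ⊤ ≤ Submodule.span R (Set.range v) := by
    rintro ⟨x, hx⟩ -
    choose r hr using fun i => exists_conj_eq hg
      (c.repr ⟨g * x, mul_mem_leftTranslate hx⟩ i)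
    have h1 : (⟨x, hx⟩ : W) = ∑ i, r i • v i := by
      apply Subtype.ext
      apply normalizing_mul_left_cancel hg
      rw [hv]
      simp only [hr, c.sum_repr]
    rw [h1]
    exact Submodule.sum_mem _ fun i _ => Submodule.smul_mem _ _ (Submodule.subset_span ⟨i, rfl⟩)
  exact ⟨Module.Basis.mk hli hsp, fun i => by simp [v, hzc]⟩

variable [InvariantBasisNumber R] {F : Set (Submodule R S)} {U : Submonoid S}

theorem IsFiniteApproximationSystem.exists_le_forall (hF : IsFiniteApproximationSystem F)
    {W : Submodule R S} (hW : W ∈ F) {ι : Type*} (s : Finset ι) (f : ι → Submodule R S)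
    (hf : ∀ i ∈ s, f i ∈ F) (hfW : ∀ i ∈ s, f i ≤ W) (δ : ℝ)
    (hδ : ∀ i ∈ s, (freeDim R W : ℝ) - δ ≤ freeDim R (f i)) :
    ∃ X ∈ F, X ≤ W ∧ (∀ i ∈ s, X ≤ f i) ∧ (freeDim R W : ℝ) - s.card * δ ≤ freeDim R X := by
  classical
  induction s using Finset.induction_on with
  | empty => exact ⟨W, hW, le_rfl, by simp, by simp⟩
  | insert a s ha ih =>
    obtain ⟨X, hX, hXW, hXf, hXd⟩ := ih (fun i hi => hf i (Finset.mem_insert_of_mem hi))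
      (fun i hi => hfW i (Finset.mem_insert_of_mem hi))
      (fun i hi => hδ i (Finset.mem_insert_of_mem hi))
    have h1 := hf a (Finset.mem_insert_self a s)
    have h2 := hfW a (Finset.mem_insert_self a s)
    have h3 := hδ a (Finset.mem_insert_self a s)
    refine ⟨X ⊓ f a, hF.inf_mem _ hX _ h1, inf_le_left.trans hXW, ?_, ?_⟩
    · intro i hi
      rcases Finset.mem_insert.1 hi with rfl | hi
      · exact inf_le_right
      · exact inf_le_left.trans (hXf i hi)
    · have h4 : (freeDim R (X ⊔ f a : Submodule R S) : ℝ) + freeDim R (X ⊓ f a : Submodule R S) =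
          freeDim R X + freeDim R (f a) := by exact_mod_cast hF.freeDim_sup_add_inf hX h1
      have h5 : (freeDim R (X ⊔ f a : Submodule R S) : ℝ) ≤ freeDim R W := by
        exact_mod_cast hF.freeDim_mono (hF.sup_mem _ hX _ h1) hW (sup_le hXW h2)
      rw [Finset.card_insert_of_notMem ha]
      push_cast
      linarith

variable (hA : IsRightAmenableNormal F U)
include hA

/-- The Ore condition. -/
theorem IsRightAmenableNormal.exists_mul_mem_range {a : S} (ha : a ∈ U) {X : Submodule R S}
    (hX : X ∈ F) : ∃ b ∈ U, ∀ x ∈ X, b * x ∈ LinearMap.range (rightMul R a) := by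
  have hF := hA.toIsFiniteApproximationSystem
  have hU := hA.toIsNormal
  obtain ⟨n, g, hg⟩ := hU.exists_basis X hX
  obtain ⟨V, hV⟩ := hU.exists_mul_le (hF.sup_mem _ hX _ (hU.span_mem a ha))
  have hn : (0 : ℝ) < n + 1 := by positivity
  -- In $W'$ each $Wg_i$ meets $Wa$ in all but $\dim W/(n+1)$ dimensions. The $n$ conditions
  -- together leave at least $\dim W/(n+1)>0$ dimensions, and any point $b$ there has $bg_i\in Wa$
  -- for all $i$.
  obtain ⟨W, ⟨hW, hW0⟩, hinv⟩ := hA.exists_invariant V (1 / (n + 1)) (by positivity)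
  obtain ⟨W', hW', hWW', hWX, hd⟩ := hV _ W hW hinv
  have hNpos : (0 : ℝ) < freeDim R W := by exact_mod_cast hF.freeDim_pos hW hW0
  have hmul : ∀ x ∈ X ⊔ point R a, W.map (rightMul R x) ≤ W' := fun x hx =>
    (map_rightMul_le_mul hx).trans hWX
  have hWa := hU.map_rightMul_mem hF ha hW
  obtain ⟨Y, hY, hYW, hYf, hYd⟩ := hF.exists_le_forall hW Finset.univ
    (fun i : Fin n => rightDiv W (g i : S) (W.map (rightMul R a)))
    (fun i _ => hU.rightDiv_mem hF (hg i) hWa hW)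
    (fun i _ x hx => ((mem_rightDiv (hU.le_normalizing _ (hg i))).1 hx).1)
    (1 / (n + 1) * freeDim R W) (by
      intro i _
      have hWg := hU.map_rightMul_mem hF (hg i) hW
      rw [hU.freeDim_rightDiv hF (hg i) hWa hW]
      have h1 : (freeDim R (W.map (rightMul R a) ⊔ W.map (rightMul R (g i : S)) :
          Submodule R S) : ℝ) + freeDim R (W.map (rightMul R a) ⊓ W.map (rightMul R (g i : S)) :
          Submodule R S) = freeDim R W + freeDim R W := by
        have h2 := hF.freeDim_sup_add_inf hWa hWg
        rw [freeDim_map_rightMul hF (hU.le_normalizing _ ha) hW,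
          freeDim_map_rightMul hF (hU.le_normalizing _ (hg i)) hW] at h2
        exact_mod_cast h2
      have h3 : (freeDim R (W.map (rightMul R a) ⊔ W.map (rightMul R (g i : S)) :
          Submodule R S) : ℝ) ≤ freeDim R W' := by
        exact_mod_cast hF.freeDim_mono (hF.sup_mem _ hWa _ hWg) hW'
          (sup_le (hmul a (point_le_iff.1 le_sup_right))
            (hmul _ ((le_sup_left : X ≤ _) (g i).2)))
      linarith)
  have hY0 : Y ≠ ⊥ := by
    rintro rfl
    rw [freeDim_bot, Finset.card_univ, Fintype.card_fin] at hYd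
    have h1 : (freeDim R W : ℝ) - n * (1 / (n + 1) * freeDim R W) =
        freeDim R W / (n + 1) := by field_simp; ring
    rw [h1] at hYd
    have : 0 < (freeDim R W : ℝ) / (n + 1) := by positivity
    simp only [Nat.cast_zero] at hYd
    linarith
  obtain ⟨b, hb, hbY⟩ := hU.exists_mem hY hY0
  refine ⟨b, hb, fun x hx => ?_⟩
  have hXle : X ≤ leftDiv (hU.le_normalizing b hb) ⊤ (LinearMap.range (rightMul R a)) := by
    rw [eq_iSup_span_basis g]
    refine iSup_le fun i => ?_
    rw [Submodule.span_singleton_le_iff_mem]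
    refine ⟨trivial, ?_⟩
    obtain ⟨y, -, hy⟩ := ((mem_rightDiv (hU.le_normalizing _ (hg i))).1
      (hYf i (Finset.mem_univ i) hbY)).2
    exact ⟨y, hy⟩
  exact (hXle hx).2

/-- The Ore condition gives $ba=sc$ with $s$ only in $S$. Replacing $s$ by a point of the right
quotient of $Rba$ by $c$ turns the equality of elements into one of spans, which suffices for
translating modules. -/
theorem IsRightAmenableNormal.exists_point_eq {a c : S} (ha : a ∈ U) (hc : c ∈ U) :
    ∃ b ∈ U, ∃ t ∈ U, point R (b * a) = point R (t * c) := by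
  have hF := hA.toIsFiniteApproximationSystem
  have hU := hA.toIsNormal
  obtain ⟨b, hb, hba⟩ := hA.exists_mul_mem_range hc (hU.span_mem a ha)
  have hbaU := U.mul_mem hb ha
  have hle : point R (b * a) ≤ LinearMap.range (rightMul R c) :=
    point_le_iff.2 (hba a (mem_point a))
  have hT := hU.comap_mem c hc _ (hU.span_mem _ hbaU) hle
  obtain ⟨s, hs⟩ := hba a (mem_point a)
  obtain ⟨t, ht, htT⟩ := hU.exists_mem hT (by
    intro h0
    have hsT : s ∈ (point R (b * a)).comap (rightMul R c) := by
      rw [Submodule.mem_comap, hs]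
      exact mem_point _
    rw [h0, Submodule.mem_bot] at hsT
    rw [hsT, map_zero] at hs
    exact ne_zero_of_mem_normalizing (hU.le_normalizing _ hbaU) hs.symm)
  exact ⟨b, hb, t, ht, (point_eq_of_mem hF hU (U.mul_mem ht hc) hbaU htT).symm⟩

/-- Only $xw=0\Rightarrow x=0$ needs more than left cancellation: writing $bx=ya$ by the Ore
condition gives $y(aw)=0$, so $y=0$ and $bx=0$. -/
theorem IsRightAmenableNormal.mem_normalizing_of_mul_mem {a w : S} (ha : a ∈ U)
    (h : a * w ∈ normalizing R) : w ∈ normalizing R := by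
  have hF := hA.toIsFiniteApproximationSystem
  have hU := hA.toIsNormal
  have ha' := hU.le_normalizing a ha
  have hreg : w ∈ nonZeroDivisors S := by
    rw [mem_nonZeroDivisors_iff]
    constructor
    · intro x hx
      apply normalizing_mul_left_cancel h
      rw [mul_assoc, hx, mul_zero, mul_zero]
    · intro x hx
      obtain ⟨X, hX, hxX⟩ := hF.exists_le (point R x) (Submodule.fg_span_singleton x)
      obtain ⟨b, hb, hbx⟩ := hA.exists_mul_mem_range ha hX
      obtain ⟨y, hy⟩ := hbx x (point_le_iff.1 hxX)
      rw [rightMul_apply] at hy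
      have h1 : y * (a * w) = 0 * (a * w) := by
        rw [← mul_assoc, hy, mul_assoc, hx, mul_zero, zero_mul]
      rw [normalizing_mul_right_cancel h h1, zero_mul] at hy
      apply normalizing_mul_left_cancel (hU.le_normalizing b hb)
      rw [← hy, mul_zero]
  rw [mem_normalizing_iff hreg]
  constructor
  · intro r
    obtain ⟨s, hs⟩ := exists_conj_eq ha' (conj h r)
    refine ⟨s, normalizing_mul_left_cancel ha' ?_⟩
    rw [← mul_assoc, conj_spec h, ← hs, ← mul_assoc, ← mul_assoc, ← conj_spec ha']
  · intro s
    obtain ⟨r, hr⟩ := exists_conj_eq h (conj ha' s)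
    refine ⟨r, normalizing_mul_left_cancel ha' ?_⟩
    rw [← mul_assoc, conj_spec h, hr, ← mul_assoc, ← mul_assoc, ← conj_spec ha']

omit hA [InvariantBasisNumber R] in
/-- The modules with a left translate in `F`. -/
def saturation (F : Set (Submodule R S)) (U : Submonoid S) : Set (Submodule R S) :=
  {Z | ∃ a ∈ U, leftTranslate a Z ∈ F}

omit hA [InvariantBasisNumber R] in
theorem subset_saturation : F ⊆ saturation F U := fun Z hZ =>
  ⟨1, U.one_mem, by rwa [leftTranslate_one]⟩

theorem IsRightAmenableNormal.exists_common {Z Z' : Submodule R S} (hZ : Z ∈ saturation F U)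
    (hZ' : Z' ∈ saturation F U) : ∃ a ∈ U, leftTranslate a Z ∈ F ∧ leftTranslate a Z' ∈ F := by
  have hF := hA.toIsFiniteApproximationSystem
  have hU := hA.toIsNormal
  obtain ⟨a, ha, haZ⟩ := hZ
  obtain ⟨c, hc, hcZ⟩ := hZ'
  obtain ⟨b, hb, t, ht, hbt⟩ := hA.exists_point_eq ha hc
  refine ⟨b * a, U.mul_mem hb ha, ?_, ?_⟩
  · rw [leftTranslate_mul (hU.le_normalizing b hb) (hU.le_normalizing a ha)]
    exact hU.le_mul_mem hF hb haZ
  · rw [leftTranslate_congr_point hbt,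
      leftTranslate_mul (hU.le_normalizing t ht) (hU.le_normalizing c hc)]
    exact hU.le_mul_mem hF ht hcZ

theorem IsRightAmenableNormal.leftTranslate_mem_saturation {x : S} (hx : x ∈ U)
    {Z : Submodule R S} (hZ : Z ∈ saturation F U) : leftTranslate x Z ∈ saturation F U := by
  have hF := hA.toIsFiniteApproximationSystem
  have hU := hA.toIsNormal
  obtain ⟨a, ha, haZ⟩ := hZ
  obtain ⟨b, hb, t, ht, hbt⟩ := hA.exists_point_eq hx ha
  refine ⟨b, hb, ?_⟩
  rw [← leftTranslate_mul (hU.le_normalizing b hb) (hU.le_normalizing x hx),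
    leftTranslate_congr_point hbt,
    leftTranslate_mul (hU.le_normalizing t ht) (hU.le_normalizing a ha)]
  exact hU.le_mul_mem hF ht haZ

theorem IsRightAmenableNormal.exists_mem_point_eq {g : S} (hg : g ∈ normalizing R)
    (hgF : point R g ∈ F) : ∃ u ∈ U, point R u = point R g := by
  have hF := hA.toIsFiniteApproximationSystem
  have hU := hA.toIsNormal
  obtain ⟨u, hu, hug⟩ := hU.exists_mem hgF (by
    intro h0
    have := mem_point (R := R) g
    rw [h0, Submodule.mem_bot] at this
    exact ne_zero_of_mem_normalizing hg this)
  refine ⟨u, hu, hF.eq_of_freeDim_le (hU.span_mem u hu) hgF (point_le_iff.2 hug) ?_⟩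
  rw [freeDim_span_singleton hg, freeDim_span_singleton (hU.le_normalizing u hu)]

/-- The normalizing elements which span a module with a left translate in `F`. -/
def IsRightAmenableNormal.saturatedSubmonoid : Submonoid S where
  carrier := {w | w ∈ normalizing R ∧ point R w ∈ saturation F U}
  one_mem' := ⟨one_mem_normalizing, subset_saturation (hA.span_mem 1 U.one_mem)⟩
  mul_mem' := by
    rintro w w' ⟨hw, a, ha, haw⟩ ⟨hw', a', ha', haw'⟩
    have hF := hA.toIsFiniteApproximationSystem
    have hU := hA.toIsNormal
    have han := hU.le_normalizing a ha
    have han' := hU.le_normalizing a' ha'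
    rw [leftTranslate_span_singleton han] at haw
    rw [leftTranslate_span_singleton han'] at haw'
    obtain ⟨u, hu, huw⟩ := hA.exists_mem_point_eq (mul_mem_normalizing han hw) haw
    -- As $aw$ spans the same module as $u\in U$, a common multiple with $a'$ gives $R\,baw=R\,ta'$,
    -- hence $R\,ba\,ww'=t\cdot R\,a'w'$, which lies in $F$.
    obtain ⟨b, hb, t, ht, hbt⟩ := hA.exists_point_eq hu ha'
    have hbn := hU.le_normalizing b hb
    have htn := hU.le_normalizing t ht
    refine ⟨mul_mem_normalizing hw hw', b * a, U.mul_mem hb ha, ?_⟩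
    have h1 : point R (b * (a * w)) = point R (t * a') := by
      rw [← hbt, point, point, ← leftTranslate_span_singleton hbn,
        ← leftTranslate_span_singleton hbn]
      exact congrArg _ huw.symm
    have h2 := point_mul_congr h1 w'
    rw [leftTranslate_span_singleton (mul_mem_normalizing hbn han)]
    have h3 : b * a * (w * w') = b * (a * w) * w' := by simp only [mul_assoc]
    rw [h3]
    rw [point, point] at h2
    rw [h2, mul_assoc, ← leftTranslate_span_singleton htn]
    exact hU.le_mul_mem hF ht haw'

theorem IsRightAmenableNormal.le_saturatedSubmonoid : U ≤ hA.saturatedSubmonoid := fun u hu =>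
  ⟨hA.le_normalizing u hu, subset_saturation (hA.span_mem u hu)⟩

theorem IsRightAmenableNormal.exists_basis_saturation {Z : Submodule R S}
    (hZ : Z ∈ saturation F U) :
    ∃ (n : ℕ) (b : Module.Basis (Fin n) R Z), ∀ i, (b i : S) ∈ hA.saturatedSubmonoid := by
  have hU := hA.toIsNormal
  obtain ⟨a, ha, haZ⟩ := hZ
  obtain ⟨n, c, hc⟩ := hU.exists_basis _ haZ
  have ha' := hU.le_normalizing a ha
  obtain ⟨b, hb⟩ := exists_basis_of_leftTranslate ha' c
  refine ⟨n, b, fun i => ?_⟩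
  have h1 := hc i
  rw [hb i] at h1
  refine ⟨hA.mem_normalizing_of_mul_mem ha (hU.le_normalizing _ h1), a, ha, ?_⟩
  rw [leftTranslate_span_singleton ha']
  exact hU.span_mem _ h1

theorem IsRightAmenableNormal.isFiniteApproximationSystem_saturation :
    IsFiniteApproximationSystem (saturation F U) where
  free := fun Z hZ => by
    obtain ⟨n, b, -⟩ := hA.exists_basis_saturation hZ
    exact ⟨Module.Finite.of_basis b, Module.Free.of_basis b⟩
  inf_mem := fun Z hZ Z' hZ' => by
    obtain ⟨a, ha, h1, h2⟩ := hA.exists_common hZ hZ'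
    refine ⟨a, ha, ?_⟩
    rw [leftTranslate_inf (hA.le_normalizing a ha)]
    exact hA.inf_mem _ h1 _ h2
  sup_mem := fun Z hZ Z' hZ' => by
    obtain ⟨a, ha, h1, h2⟩ := hA.exists_common hZ hZ'
    refine ⟨a, ha, ?_⟩
    rw [leftTranslate_sup (hA.le_normalizing a ha)]
    exact hA.sup_mem _ h1 _ h2
  exists_compl := fun W hW V hV hVW => by
    obtain ⟨a, ha, h1, h2⟩ := hA.exists_common hW hV
    have ha' := hA.le_normalizing a ha
    obtain ⟨V', hV', h3, h4⟩ := hA.exists_compl _ h1 _ h2 (leftTranslate_mono hVW)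
    have h5 : leftTranslate a (leftDiv ha' W V') = V' := by
      rw [leftTranslate_leftDiv]
      exact inf_eq_right.2 (le_sup_right.trans h4.le)
    refine ⟨leftDiv ha' W V', ⟨a, ha, by rwa [h5]⟩, ?_, ?_⟩
    · rw [disjoint_iff]
      apply leftTranslate_injective ha'
      rw [leftTranslate_inf ha', h5, leftTranslate_bot, h3.eq_bot]
    · apply leftTranslate_injective ha'
      rw [leftTranslate_sup ha', h5, h4]
  exists_le := fun M hM => by
    obtain ⟨W, hW, h⟩ := hA.exists_le M hM
    exact ⟨W, subset_saturation hW, h⟩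

/-- Let $u\in U$ span $Raw$. By the Ore condition $bcx=ta$ for every $x$ with $xw\in Z$, and then
$taw=(bc)xw$. So the translate by $bc$ of the quotient is $\{t: tu\in bcZ\}\,a$, where division is
by $u\in U$ and happens in $F$. -/
theorem IsRightAmenableNormal.comap_mem_saturation {w : S} (hw : w ∈ hA.saturatedSubmonoid)
    {Z : Submodule R S} (hZ : Z ∈ saturation F U) (hZw : Z ≤ LinearMap.range (rightMul R w)) :
    Z.comap (rightMul R w) ∈ saturation F U := by
  have hF := hA.toIsFiniteApproximationSystem
  have hU := hA.toIsNormal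
  obtain ⟨hwn, a, ha, haw⟩ := hw
  have hZfree := hA.isFiniteApproximationSystem_saturation.free Z hZ
  obtain ⟨c, hc, hcZ⟩ := hZ
  have han := hU.le_normalizing a ha
  have hcn := hU.le_normalizing c hc
  rw [leftTranslate_span_singleton han] at haw
  have hawn := mul_mem_normalizing han hwn
  obtain ⟨u, hu, huw⟩ := hA.exists_mem_point_eq hawn haw
  have hun := hU.le_normalizing u hu
  have hfg : (Z.comap (rightMul R w)).FG := by
    have h1 : (Z.comap (rightMul R w)).map (rightMul R w) = Z := by
      rw [Submodule.map_comap_eq]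
      exact inf_eq_right.2 hZw
    refine Submodule.fg_of_fg_map_injective (rightMul R w) (rightMul_injective hwn) ?_
    rw [h1]
    exact Module.Finite.iff_fg.1 hZfree.1
  obtain ⟨X, hX, hTX⟩ := hF.exists_le _ hfg
  obtain ⟨b, hb, hbX⟩ := hA.exists_mul_mem_range ha (hU.le_mul_mem hF hc hX)
  have hbn := hU.le_normalizing b hb
  have hbcn := mul_mem_normalizing hbn hcn
  have hbcZ : leftTranslate (b * c) Z ∈ F := by
    rw [leftTranslate_mul hbn hcn]
    exact hU.le_mul_mem hF hb hcZ
  have hbcT : ∀ x, x * w ∈ Z → ∃ t, t * a = b * c * x := by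
    intro x hx
    obtain ⟨t, ht⟩ := hbX (c * x) (mul_mem_leftTranslate (hTX hx))
    exact ⟨t, by rw [mul_assoc]; exact ht⟩
  have hright : ∀ x ∈ leftTranslate (b * c) Z, ∀ r : R, x * r ∈ leftTranslate (b * c) Z :=
    fun x hx r => hU.mul_right_mem hbcZ hx r
  have hiff : ∀ t : S, t * u ∈ leftTranslate (b * c) Z ↔
      t * (a * w) ∈ leftTranslate (b * c) Z := by
    intro t
    obtain ⟨r, s, -, -, h1⟩ := exists_unit_of_point_eq hawn hun huw.symm
    obtain ⟨r', s', -, -, h2⟩ := exists_unit_of_point_eq hun hawn huw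
    constructor
    · intro h
      obtain ⟨q, rfl⟩ := exists_conj_eq hun r'
      rw [← conj_spec hun] at h2
      rw [h2, ← mul_assoc]
      exact hright _ h q
    · intro h
      obtain ⟨q, rfl⟩ := exists_conj_eq hawn r
      rw [← conj_spec hawn] at h1
      rw [h1, ← mul_assoc]
      exact hright _ h q
  have hle : leftTranslate (b * c) Z ≤ LinearMap.range (rightMul R u) := by
    intro y hy
    obtain ⟨z, hz, rfl⟩ := (mem_leftTranslate hbcn).1 hy
    obtain ⟨x, rfl⟩ := hZw hz
    rw [rightMul_apply] at hz
    obtain ⟨t, ht⟩ := hbcT x hz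
    obtain ⟨r, s, -, -, h1⟩ := exists_unit_of_point_eq hun hawn huw
    refine ⟨t * r, ?_⟩
    rw [rightMul_apply, rightMul_apply, ← mul_assoc, ← ht, mul_assoc, ← h1, mul_assoc]
  have hT' := hU.comap_mem u hu _ hbcZ hle
  have hTeq : leftTranslate (b * c) (Z.comap (rightMul R w)) =
      ((leftTranslate (b * c) Z).comap (rightMul R u)).map (rightMul R a) := by
    ext y
    rw [mem_leftTranslate hbcn, mem_map_rightMul]
    constructor
    · rintro ⟨x, hx, rfl⟩
      rw [Submodule.mem_comap, rightMul_apply] at hx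
      obtain ⟨t, ht⟩ := hbcT x hx
      refine ⟨t, ?_, ht⟩
      rw [Submodule.mem_comap, rightMul_apply, hiff, ← mul_assoc, ht, mul_assoc]
      exact mul_mem_leftTranslate hx
    · rintro ⟨t, ht, rfl⟩
      rw [Submodule.mem_comap, rightMul_apply, hiff] at ht
      obtain ⟨z, hz, hzt⟩ := (mem_leftTranslate hbcn).1 ht
      obtain ⟨x, rfl⟩ := hZw hz
      refine ⟨x, hz, normalizing_mul_right_cancel hwn ?_⟩
      rw [mul_assoc t, ← hzt, rightMul_apply]
      simp only [mul_assoc]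
  refine ⟨b * c, U.mul_mem hb hc, ?_⟩
  rw [hTeq]
  exact hU.map_rightMul_mem hF ha hT'

theorem IsRightAmenableNormal.isNormal_saturation :
    IsNormal (saturation F U) hA.saturatedSubmonoid where
  le_normalizing := fun _ hg => hg.1
  exists_basis := fun _ hW => hA.exists_basis_saturation hW
  span_mem := fun _ hg => hg.2
  comap_mem := fun _ hg _ hW h => hA.comap_mem_saturation hg hW h

/-- Translates depend only on the point, so after one further translation by $c\in U$ an element of
the saturated monoid acts on modules like an element of $U$. -/
theorem IsRightAmenableNormal.exists_leftTranslate_eq {g : S} (hg : g ∈ hA.saturatedSubmonoid) :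
    ∃ c ∈ U, ∃ u ∈ U, point R u = point R (c * g) ∧
      ∀ Z : Submodule R S, leftTranslate c (leftTranslate g Z) = leftTranslate u Z := by
  obtain ⟨hgn, c, hc, hcg⟩ := hg
  have hcn := hA.le_normalizing c hc
  rw [leftTranslate_span_singleton hcn] at hcg
  obtain ⟨u, hu, hug⟩ := hA.exists_mem_point_eq (mul_mem_normalizing hcn hgn) hcg
  refine ⟨c, hc, u, hu, hug, fun Z => ?_⟩
  rw [← leftTranslate_mul hcn hgn, leftTranslate_congr_point hug]

theorem IsRightAmenableNormal.isLeftSaturated_saturation :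
    IsLeftSaturated (saturation F U) hA.saturatedSubmonoid where
  mem_of_mul_mem := fun a ha w haw => by
    obtain ⟨c, hc, u, hu, hua, -⟩ := hA.exists_leftTranslate_eq ha
    obtain ⟨hn, d, hd, hdF⟩ := hA.saturatedSubmonoid.mul_mem (hA.le_saturatedSubmonoid hc) haw
    have hcn := hA.le_normalizing c hc
    have hdn := hA.le_normalizing d hd
    have hun := hA.le_normalizing u hu
    rw [leftTranslate_span_singleton hdn] at hdF
    have h1 : point R (u * w) = point R (c * (a * w)) := by
      rw [point_mul_congr hua, mul_assoc]
    obtain ⟨r, s, hrs, hsr, hu'⟩ := exists_unit_of_point_eq (mul_mem_normalizing hcn ha.1) hun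
      hua.symm
    have h2 : u * w ∈ normalizing R := by
      rw [hu', mul_assoc, mul_assoc]
      exact mul_mem_normalizing (unit_mem_normalizing hrs hsr) hn
    refine ⟨hA.mem_normalizing_of_mul_mem hu h2, d * u, U.mul_mem hd hu, ?_⟩
    rw [leftTranslate_span_singleton (mul_mem_normalizing hdn hun), mul_assoc,
      ← leftTranslate_span_singleton hdn]
    rw [point, point] at h1
    rw [h1, leftTranslate_span_singleton hdn]
    exact hdF
  mem_of_leftTranslate_mem := fun a ha Z hZ => by
    obtain ⟨c, hc, u, hu, -, h1⟩ := hA.exists_leftTranslate_eq ha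
    obtain ⟨d, hd, hdF⟩ := hA.leftTranslate_mem_saturation hc hZ
    rw [h1, ← leftTranslate_mul (hA.le_normalizing d hd) (hA.le_normalizing u hu)] at hdF
    exact ⟨d * u, U.mul_mem hd hu, hdF⟩

end Saturation

/-! ### The rank of a matrix on a submodule -/

section Splitting

variable {R M : Type*} [Ring R] [AddCommGroup M] [Module R M]

theorem exists_projections {V V' : Submodule R M} (hd : Disjoint V V') :
    ∃ (p : (V ⊔ V' : Submodule R M) →ₗ[R] V) (p' : (V ⊔ V' : Submodule R M) →ₗ[R] V'),
      (∀ x, (p x : M) + p' x = x) ∧ ∀ (v : V) (v' : V') (h : (v : M) + v' ∈ V ⊔ V'),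
        p ⟨v + v', h⟩ = v ∧ p' ⟨v + v', h⟩ = v' := by
  let f : (V × V') →ₗ[R] (V ⊔ V' : Submodule R M) :=
    (Submodule.inclusion le_sup_left).coprod (Submodule.inclusion le_sup_right)
  have hf : ∀ x : V × V', (f x : M) = x.1 + x.2 := fun x => by simp [f]
  have hinj : Function.Injective f := by
    rw [← LinearMap.ker_eq_bot, LinearMap.ker_eq_bot']
    rintro ⟨v, v'⟩ h
    have h1 : (v : M) + v' = 0 := by rw [← hf (v, v'), h]; rfl
    have h2 : (v : M) ∈ V' := by
      rw [eq_neg_of_add_eq_zero_left h1]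
      exact V'.neg_mem v'.2
    have h3 : (v : M) = 0 := Submodule.disjoint_def.1 hd _ v.2 h2
    rw [h3, zero_add] at h1
    exact Prod.ext (Subtype.ext h3) (Subtype.ext h1)
  have hsurj : Function.Surjective f := by
    rintro ⟨x, hx⟩
    obtain ⟨v, hv, v', hv', rfl⟩ := Submodule.mem_sup.1 hx
    exact ⟨(⟨v, hv⟩, ⟨v', hv'⟩), Subtype.ext (hf _)⟩
  let e := LinearEquiv.ofBijective f ⟨hinj, hsurj⟩
  refine ⟨LinearMap.fst R V V' ∘ₗ e.symm.toLinearMap, LinearMap.snd R V V' ∘ₗ e.symm.toLinearMap,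
    fun x => ?_, fun v v' h => ?_⟩
  · have := hf (e.symm x)
    rw [show f (e.symm x) = x from e.apply_symm_apply x] at this
    exact this.symm
  · have h1 : e.symm ⟨v + v', h⟩ = (v, v') := by
      rw [LinearEquiv.symm_apply_eq]
      exact Subtype.ext (hf (v, v')).symm
    simp [h1]

end Splitting

/-! ### Row maps and the rank of a matrix on a member of $F$ -/

section RowMap

variable {S : Type*} [Ring S] {R : Subring S} {n m : ℕ}

/-- The map `Wⁿ → W'ᵐ`, `x ↦ x A`. -/
def rowMap (A : Matrix (Fin n) (Fin m) S) {W W' : Submodule R S}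
    (H : ∀ i j, ∀ w ∈ W, w * A i j ∈ W') : (Fin n → W) →ₗ[R] (Fin m → W') where
  toFun x j := ⟨∑ i, (x i : S) * A i j, Submodule.sum_mem _ fun i _ => H i j _ (x i).2⟩
  map_add' x y := by
    ext j
    simp [add_mul, Finset.sum_add_distrib]
  map_smul' r x := by
    ext j
    simp [Subring.smul_def, mul_assoc, Finset.mul_sum]

@[simp]
theorem coe_rowMap (A : Matrix (Fin n) (Fin m) S) {W W' : Submodule R S}
    (H : ∀ i j, ∀ w ∈ W, w * A i j ∈ W') (x : Fin n → W) (j : Fin m) :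
    (rowMap A H x j : S) = ∑ i, (x i : S) * A i j := rfl

variable {A : Matrix (Fin n) (Fin m) S}

theorem represents_iff {W W' : Submodule R S} (H : ∀ i j, ∀ w ∈ W, w * A i j ∈ W')
    {l p : ℕ} (B : Matrix (Fin l) (Fin p) R) :
    Represents W W' A B ↔ ∃ (w : Module.Basis (Fin l) R (Fin n → W))
      (w' : Module.Basis (Fin p) R (Fin m → W')), coordMatrix w w' (rowMap A H) = B := by
  refine exists_congr fun w => exists_congr fun w' => ?_
  have h1 : (∀ (i : Fin l) (j : Fin m),
      ∑ a, (w i a : S) * A a j = ∑ k, (B i k : S) * (w' k j : S)) ↔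
      ∀ i, rowMap A H (w i) = ∑ k, B i k • w' k := by
    refine forall_congr' fun i => ?_
    rw [funext_iff]
    refine forall_congr' fun j => ?_
    rw [Subtype.ext_iff, coe_rowMap]
    simp [Finset.sum_apply, Subring.smul_def]
  rw [h1]
  constructor
  · intro h
    ext i k
    simp [coordMatrix, h, Finsupp.single_apply]
  · rintro rfl i
    exact (w'.sum_repr _).symm

theorem IsFiniteApproximationSystem.exists_receiving [InvariantBasisNumber R]
    {F : Set (Submodule R S)} (hF : IsFiniteApproximationSystem F) {W : Submodule R S}
    (hW : W ∈ F) (A : Matrix (Fin n) (Fin m) S) :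
    ∃ W' ∈ nonzeroPart F, ∀ i j, ∀ w ∈ W, w * A i j ∈ W' := by
  have := (hF.free W hW).1
  have hW1 : W.FG := Module.Finite.iff_fg.1 this
  obtain ⟨W', hW', hle⟩ := hF.exists_le
    (Submodule.span R {1} ⊔ ⨆ i, ⨆ j, W.map (rightMul R (A i j)))
    ((Submodule.fg_span_singleton 1).sup
      (Submodule.fg_iSup _ fun i => Submodule.fg_iSup _ fun j => hW1.map _))
  have : Nontrivial R := nontrivial_of_invariantBasisNumber R
  have : Nontrivial S := Subtype.val_injective.nontrivial (α := R)
  refine ⟨W', ⟨hW', ?_⟩, fun i j w hw => hle (Submodule.mem_sup_right ?_)⟩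
  · rintro rfl
    have h1 := hle (Submodule.mem_sup_left (Submodule.mem_span_singleton_self (1 : S)))
    exact one_ne_zero ((Submodule.mem_bot R).1 h1)
  · exact Submodule.mem_iSup_of_mem i (Submodule.mem_iSup_of_mem j ⟨w, hw, rfl⟩)

variable {rk : MatrixFunction R} {F : Set (Submodule R S)}

/-- $V$ is a direct summand of $V'$, so inclusion and projection give factorizations in both
directions. -/
theorem linRank_rowMap_eq_of_le (hF : IsFiniteApproximationSystem F) (h : IsSylvester rk)
    {W V V' : Submodule R S} (hV : V ∈ F) (hV' : V' ∈ F) (hle : V ≤ V')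
    (H : ∀ i j, ∀ w ∈ W, w * A i j ∈ V) (H' : ∀ i j, ∀ w ∈ W, w * A i j ∈ V')
    [Module.Finite R W] [Module.Free R W] [Module.Finite R V] [Module.Free R V]
    [Module.Finite R V'] [Module.Free R V'] :
    linRank rk (rowMap A H) = linRank rk (rowMap A H') := by
  have h1 : (Submodule.inclusion hle).compLeft (Fin m) ∘ₗ rowMap A H = rowMap A H' := by
    ext; rfl
  refine le_antisymm ?_ ?_
  · obtain ⟨V'', -, hd, rfl⟩ := hF.exists_compl _ hV' V hV hle
    obtain ⟨p, p', -, hp⟩ := exists_projections hd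
    have h2 : p.compLeft (Fin m) ∘ₗ rowMap A H' ∘ₗ LinearMap.id = rowMap A H := by
      refine LinearMap.ext fun x => funext fun j => ?_
      have := (hp (rowMap A H x j) 0 (by simpa using hle (rowMap A H x j).2)).1
      rw [← this]
      simp only [LinearMap.comp_apply, LinearMap.compLeft_apply, LinearMap.id_apply,
        Function.comp_apply]
      congr 1
      ext
      simp
    exact h.linRank_le_of_comp_eq _ _ h2
  · rw [← h1]
    exact h.linRank_comp_le_right _ _

theorem linRank_rowMap_congr (hF : IsFiniteApproximationSystem F) (h : IsSylvester rk)
    {W V V' : Submodule R S} (hV : V ∈ F) (hV' : V' ∈ F)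
    (H : ∀ i j, ∀ w ∈ W, w * A i j ∈ V) (H' : ∀ i j, ∀ w ∈ W, w * A i j ∈ V')
    [Module.Finite R W] [Module.Free R W] [Module.Finite R V] [Module.Free R V]
    [Module.Finite R V'] [Module.Free R V'] :
    linRank rk (rowMap A H) = linRank rk (rowMap A H') := by
  have h1 := hF.sup_mem _ hV _ hV'
  obtain ⟨_, _⟩ := hF.free _ h1
  rw [linRank_rowMap_eq_of_le hF h hV h1 le_sup_left H
      (fun i j w hw => (le_sup_left : V ≤ V ⊔ V') (H i j w hw)),
    linRank_rowMap_eq_of_le hF h hV' h1 le_sup_right H'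
      (fun i j w hw => (le_sup_left : V ≤ V ⊔ V') (H i j w hw))]

/-- A matrix over `R` which computes `rk_W(A)` for all `rk`. -/
theorem IsFiniteApproximationSystem.exists_rankOn_eq [InvariantBasisNumber R]
    (hF : IsFiniteApproximationSystem F) {W : Submodule R S} (hW : W ∈ F)
    (A : Matrix (Fin n) (Fin m) S) : ∃ (l p : ℕ) (B : Matrix (Fin l) (Fin p) R),
      ∀ rk : MatrixFunction R, rankOn F rk W A = rk l p B := by
  have hex : ∃ x, IsPresentation F W A x := by
    obtain ⟨W', hW', H⟩ := hF.exists_receiving hW A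
    obtain ⟨_, _⟩ := hF.free _ hW
    obtain ⟨_, _⟩ := hF.free _ hW'.1
    obtain ⟨l, ⟨w⟩⟩ := exists_finBasis R (Fin n → W)
    obtain ⟨p, ⟨w'⟩⟩ := exists_finBasis R (Fin m → W')
    exact ⟨⟨W', l, p, coordMatrix w w' (rowMap A H)⟩, hW', H,
      (represents_iff H _).2 ⟨w, w', rfl⟩⟩
  exact ⟨_, _, hex.choose.2.2.2, fun rk => by rw [rankOn, dif_pos hex]⟩

theorem IsFiniteApproximationSystem.rankOn_eq [InvariantBasisNumber R]
    (hF : IsFiniteApproximationSystem F) (h : IsSylvester rk) {W W' : Submodule R S}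
    (hW' : W' ∈ F) (H : ∀ i j, ∀ w ∈ W, w * A i j ∈ W')
    [Module.Finite R W] [Module.Free R W] [Module.Finite R W'] [Module.Free R W']
    (hW : W ∈ F) : rankOn F rk W A = linRank rk (rowMap A H) := by
  have hex : ∃ x, IsPresentation F W A x := by
    obtain ⟨W', hW', H⟩ := hF.exists_receiving hW A
    obtain ⟨_, _⟩ := hF.free _ hW'.1
    obtain ⟨l, ⟨w⟩⟩ := exists_finBasis R (Fin n → W)
    obtain ⟨p, ⟨w'⟩⟩ := exists_finBasis R (Fin m → W')
    exact ⟨⟨W', l, p, coordMatrix w w' (rowMap A H)⟩, hW', H,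
      (represents_iff H _).2 ⟨w, w', rfl⟩⟩
  rw [rankOn, dif_pos hex]
  obtain ⟨h1, h2, h3⟩ := hex.choose_spec
  obtain ⟨_, _⟩ := hF.free _ h1.1
  obtain ⟨w, w', h4⟩ := (represents_iff h2 _).1 h3
  rw [← h4, ← h.linRank_eq w w']
  exact linRank_rowMap_congr hF h h1.1 hW' h2 H

theorem IsFiniteApproximationSystem.rankOn_of_represents [InvariantBasisNumber R]
    (hF : IsFiniteApproximationSystem F) (h : IsSylvester rk) {W W' : Submodule R S}
    (hW : W ∈ F) (hW' : W' ∈ F) (H : ∀ i j, ∀ w ∈ W, w * A i j ∈ W') {l p : ℕ}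
    {B : Matrix (Fin l) (Fin p) R} (hB : Represents W W' A B) :
    rankOn F rk W A = rk l p B := by
  obtain ⟨_, _⟩ := hF.free _ hW
  obtain ⟨_, _⟩ := hF.free _ hW'
  obtain ⟨w, w', h4⟩ := (represents_iff H _).1 hB
  rw [hF.rankOn_eq h hW' H hW, ← h4, ← h.linRank_eq w w']

/-- The rank on `W` does not depend on the finite approximation system. -/
theorem IsFiniteApproximationSystem.rankOn_congr [InvariantBasisNumber R]
    (hF : IsFiniteApproximationSystem F) {F' : Set (Submodule R S)}
    (hF' : IsFiniteApproximationSystem F') (hle : F ⊆ F') (h : IsSylvester rk)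
    {W : Submodule R S} (hW : W ∈ F) (A : Matrix (Fin n) (Fin m) S) :
    rankOn F' rk W A = rankOn F rk W A := by
  obtain ⟨W', hW', H⟩ := hF.exists_receiving hW A
  obtain ⟨_, _⟩ := hF.free _ hW
  obtain ⟨_, _⟩ := hF.free _ hW'.1
  rw [hF.rankOn_eq h hW'.1 H hW, hF'.rankOn_eq h (hle hW'.1) H (hle hW)]

/-! ### Monotonicity, submodularity and superadditivity of the rank -/

section Properties

variable [InvariantBasisNumber R] (hF : IsFiniteApproximationSystem F) (h : IsSylvester rk)
include hF h

theorem rankOn_nonneg {W : Submodule R S} (hW : W ∈ F) (A : Matrix (Fin n) (Fin m) S) :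
    0 ≤ rankOn F rk W A := by
  obtain ⟨l, p, B, hB⟩ := hF.exists_rankOn_eq hW A
  rw [hB]
  exact h.nonneg _ _ _

theorem rankOn_le {W : Submodule R S} (hW : W ∈ F) (A : Matrix (Fin n) (Fin m) S) :
    rankOn F rk W A ≤ n * freeDim R W := by
  obtain ⟨W', hW', H⟩ := hF.exists_receiving hW A
  obtain ⟨_, _⟩ := hF.free _ hW
  obtain ⟨_, _⟩ := hF.free _ hW'.1
  rw [hF.rankOn_eq h hW'.1 H hW]
  obtain ⟨b⟩ := exists_basis_freeDim R (Fin n → W)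
  refine (h.linRank_le_card b _).trans ?_
  rw [freeDim_pi]
  push_cast
  exact le_rfl

theorem rankOn_bot (A : Matrix (Fin n) (Fin m) S) : rankOn F rk ⊥ A = 0 := by
  refine le_antisymm ?_ (rankOn_nonneg hF h hF.bot_mem A)
  simpa [freeDim_bot] using rankOn_le hF h hF.bot_mem A

theorem rankOn_mono {V W : Submodule R S} (hV : V ∈ F) (hW : W ∈ F) (hle : V ≤ W)
    (A : Matrix (Fin n) (Fin m) S) : rankOn F rk V A ≤ rankOn F rk W A := by
  obtain ⟨W', hW', H⟩ := hF.exists_receiving hW A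
  obtain ⟨_, _⟩ := hF.free _ hV
  obtain ⟨_, _⟩ := hF.free _ hW
  obtain ⟨_, _⟩ := hF.free _ hW'.1
  rw [hF.rankOn_eq h hW'.1 H hW, hF.rankOn_eq h hW'.1 (fun i j w hw => H i j w (hle hw)) hV]
  exact h.linRank_le_of_comp_eq ((Submodule.inclusion hle).compLeft (Fin n)) LinearMap.id
    (by ext; rfl)

/-- The diagonal map for $X$ and $Y$ is compared with a triangular one whose diagonal blocks belong
to $X+Y$ and $X\cap Y$. A complement of $X\cap Y$ in $Y$ splits each element of $X+Y$ into parts in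
$X$ and $Y$. -/
theorem rankOn_sup_add_inf_le {X Y : Submodule R S} (hX : X ∈ F) (hY : Y ∈ F)
    (A : Matrix (Fin n) (Fin m) S) :
    rankOn F rk (X ⊔ Y) A + rankOn F rk (X ⊓ Y) A ≤ rankOn F rk X A + rankOn F rk Y A := by
  have hXY := hF.sup_mem _ hX _ hY
  have hI := hF.inf_mem _ hX _ hY
  obtain ⟨W', hW', H⟩ := hF.exists_receiving hXY A
  obtain ⟨Y', hY', hd, hsup⟩ := hF.exists_compl _ hY _ hI inf_le_right
  obtain ⟨_, _⟩ := hF.free _ hXY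
  obtain ⟨_, _⟩ := hF.free _ hI
  obtain ⟨_, _⟩ := hF.free _ hX
  obtain ⟨_, _⟩ := hF.free _ hY
  obtain ⟨_, _⟩ := hF.free _ hW'.1
  have hle : Y' ≤ Y := hsup ▸ le_sup_right
  have hd' : Disjoint X Y' := by
    rw [Submodule.disjoint_def] at hd ⊢
    exact fun x hx hx' => hd x ⟨hx, hle hx'⟩ hx'
  have heq : X ⊔ Y = X ⊔ Y' := by
    refine le_antisymm (sup_le le_sup_left ?_) (sup_le_sup_left hle X)
    rw [← hsup]
    exact sup_le (inf_le_left.trans le_sup_left) le_sup_right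
  obtain ⟨p, p', hp, -⟩ := exists_projections hd'
  let sX : (X ⊔ Y : Submodule R S) →ₗ[R] X := p ∘ₗ Submodule.inclusion heq.le
  let sY : (X ⊔ Y : Submodule R S) →ₗ[R] Y :=
    Submodule.inclusion hle ∘ₗ p' ∘ₗ Submodule.inclusion heq.le
  have hs : ∀ z, (sX z : S) + sY z = z := fun z => hp _
  have HX : ∀ i j, ∀ w ∈ X, w * A i j ∈ W' := fun i j w hw => H i j w (Submodule.mem_sup_left hw)
  have HY : ∀ i j, ∀ w ∈ Y, w * A i j ∈ W' := fun i j w hw => H i j w (Submodule.mem_sup_right hw)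
  have HI : ∀ i j, ∀ w ∈ X ⊓ Y, w * A i j ∈ W' := fun i j w hw => HX i j w hw.1
  rw [hF.rankOn_eq h hW'.1 H hXY, hF.rankOn_eq h hW'.1 HI hI, hF.rankOn_eq h hW'.1 HX hX,
    hF.rankOn_eq h hW'.1 HY hY,
    ← h.linRank_prodMap (rowMap A HX) (rowMap A HY)]
  refine (h.le_linRank_triangular (rowMap A H) (rowMap A HX ∘ₗ sX.compLeft (Fin n))
    (rowMap A HI)).trans ?_
  -- The pair $(z,i)$ goes to $(s_Xz+i,\,s_Yz-i)$, then $A$ is applied to each entry, then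
  -- $(a,b)\mapsto(a+b,a)$; the result is $(zA,\,(s_Xz)A+iA)$.
  refine h.linRank_le_of_comp_eq
    (((sX.compLeft (Fin n)).coprod ((Submodule.inclusion inf_le_left).compLeft (Fin n))).prod
      ((sY.compLeft (Fin n)).coprod (-(Submodule.inclusion inf_le_right).compLeft (Fin n))))
    (((LinearMap.id : (Fin m → W') →ₗ[R] _).coprod LinearMap.id).prod (LinearMap.fst R _ _)) ?_
  refine LinearMap.ext fun z => Prod.ext (funext fun j => Subtype.ext ?_)
    (funext fun j => Subtype.ext ?_)
  · simp [← hs, add_mul, Finset.sum_add_distrib]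
    abel
  · simp

theorem rankOn_sup_le {X Y : Submodule R S} (hX : X ∈ F) (hY : Y ∈ F)
    (A : Matrix (Fin n) (Fin m) S) :
    rankOn F rk (X ⊔ Y) A ≤ rankOn F rk X A + rankOn F rk Y A := by
  have h1 := rankOn_sup_add_inf_le hF h hX hY A
  have h2 := rankOn_nonneg hF h (hF.inf_mem _ hX _ hY) A
  linarith

theorem rankOn_lipschitz {V W : Submodule R S} (hV : V ∈ F) (hW : W ∈ F) (hle : V ≤ W)
    (A : Matrix (Fin n) (Fin m) S) :
    rankOn F rk W A ≤ rankOn F rk V A + n * ((freeDim R W : ℝ) - freeDim R V) := by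
  obtain ⟨V', hV', hd, rfl⟩ := hF.exists_compl _ hW _ hV hle
  have h1 := rankOn_sup_le hF h hV hV' A
  have h2 := rankOn_le hF h hV' A
  have h3 := hF.freeDim_sup_of_disjoint hV hV' hd
  rw [h3]
  push_cast
  linarith

theorem rankOn_biSup_le {ι : Type*} (s : Finset ι) (f : ι → Submodule R S) (hf : ∀ i ∈ s, f i ∈ F)
    (A : Matrix (Fin n) (Fin m) S) :
    rankOn F rk (⨆ i ∈ s, f i) A ≤ ∑ i ∈ s, rankOn F rk (f i) A := by
  classical
  induction s using Finset.induction_on with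
  | empty => simp [rankOn_bot hF h]
  | insert a s ha ih =>
    rw [Finset.iSup_insert, Finset.sum_insert ha]
    have h1 : ∀ i ∈ s, f i ∈ F := fun i hi => hf i (Finset.mem_insert_of_mem hi)
    have := rankOn_sup_le hF h (hf a (Finset.mem_insert_self a s)) (hF.biSup_mem s f h1) A
    linarith [ih h1]

/-- The targets are independent, so projecting onto them recovers the diagonal map from the map on
$X+Y$. Disjointness of $X$ and $Y$ is not needed. -/
theorem add_le_rankOn_sup {X Y V W : Submodule R S} (hX : X ∈ F) (hY : Y ∈ F) (hV : V ∈ F)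
    (hW : W ∈ F) (hd : Disjoint V W) (HX : ∀ i j, ∀ w ∈ X, w * A i j ∈ V)
    (HY : ∀ i j, ∀ w ∈ Y, w * A i j ∈ W) :
    rankOn F rk X A + rankOn F rk Y A ≤ rankOn F rk (X ⊔ Y) A := by
  have hXY := hF.sup_mem _ hX _ hY
  have hVW := hF.sup_mem _ hV _ hW
  have H : ∀ i j, ∀ w ∈ X ⊔ Y, w * A i j ∈ V ⊔ W := by
    intro i j w hw
    obtain ⟨x, hx, y, hy, rfl⟩ := Submodule.mem_sup.1 hw
    rw [add_mul]
    exact Submodule.add_mem_sup (HX i j x hx) (HY i j y hy)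
  obtain ⟨_, _⟩ := hF.free _ hX
  obtain ⟨_, _⟩ := hF.free _ hY
  obtain ⟨_, _⟩ := hF.free _ hV
  obtain ⟨_, _⟩ := hF.free _ hW
  obtain ⟨_, _⟩ := hF.free _ hXY
  obtain ⟨_, _⟩ := hF.free _ hVW
  rw [hF.rankOn_eq h hVW H hXY, hF.rankOn_eq h hV HX hX, hF.rankOn_eq h hW HY hY,
    ← h.linRank_prodMap]
  obtain ⟨p, p', -, hp⟩ := exists_projections hd
  refine h.linRank_le_of_comp_eq
    (((Submodule.inclusion le_sup_left).compLeft (Fin n)).coprod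
      ((Submodule.inclusion le_sup_right).compLeft (Fin n)))
    ((p.compLeft (Fin m)).prod (p'.compLeft (Fin m))) ?_
  have key : ∀ (x : Fin n → X) (y : Fin n → Y) (j : Fin m), rowMap A H
      (((Submodule.inclusion le_sup_left).compLeft (Fin n)) x +
        ((Submodule.inclusion le_sup_right).compLeft (Fin n)) y) j =
      ⟨(rowMap A HX x j : S) + rowMap A HY y j,
        Submodule.add_mem_sup (rowMap A HX x j).2 (rowMap A HY y j).2⟩ := by
    intro x y j
    ext
    simp
  refine LinearMap.ext fun z => Prod.ext (funext fun j => ?_) (funext fun j => ?_)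
  · have := (hp (rowMap A HX z.1 j) (rowMap A HY z.2 j)
      (Submodule.add_mem_sup (rowMap A HX z.1 j).2 (rowMap A HY z.2 j).2)).1
    rw [← key] at this
    simpa using this
  · have := (hp (rowMap A HX z.1 j) (rowMap A HY z.2 j)
      (Submodule.add_mem_sup (rowMap A HX z.1 j).2 (rowMap A HY z.2 j).2)).2
    rw [← key] at this
    simpa using this

theorem sum_le_rankOn_biSup {ι : Type*} (s : Finset ι) (X D : ι → Submodule R S)
    (hX : ∀ i ∈ s, X i ∈ F) (hD : ∀ i ∈ s, D i ∈ F) (hd : iSupIndep D)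
    (H : ∀ x ∈ s, ∀ i j, ∀ w ∈ X x, w * A i j ∈ D x) :
    ∑ i ∈ s, rankOn F rk (X i) A ≤ rankOn F rk (⨆ i ∈ s, X i) A := by
  classical
  induction s using Finset.induction_on with
  | empty => simp [rankOn_bot hF h]
  | insert a s ha ih =>
    rw [Finset.iSup_insert, Finset.sum_insert ha]
    have hs : ∀ i ∈ s, i ∈ insert a s := fun i hi => Finset.mem_insert_of_mem hi
    have haa := Finset.mem_insert_self a s
    refine (add_le_add_right (ih (fun i hi => hX i (hs i hi)) (fun i hi => hD i (hs i hi))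
      fun i hi => H i (hs i hi)) _).trans ?_
    refine add_le_rankOn_sup hF h (V := D a) (W := ⨆ i ∈ s, D i) (hX a haa)
      (hF.biSup_mem s X fun i hi => hX i (hs i hi)) (hD a haa)
      (hF.biSup_mem s D fun i hi => hD i (hs i hi)) ?_ (H a haa) ?_
    · refine (hd a).mono_right (iSup₂_le fun i hi => le_iSup₂_of_le i ?_ le_rfl)
      rintro rfl
      exact ha hi
    · intro i j w hw
      have h1 : (⨆ x ∈ s, X x) ≤ (⨆ x ∈ s, D x).comap (rightMul R (A i j)) :=
        iSup₂_le fun x hx w hw =>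
          (le_iSup₂_of_le (f := fun x (_ : x ∈ s) => D x) x hx le_rfl) (H x (hs x hx) i j w hw)
      exact h1 hw

end Properties

theorem exists_basis_pi_leftTranslate {g : S} (hg : g ∈ normalizing R) {W : Submodule R S}
    [Module.Finite R W] [Module.Free R W] (n : ℕ) :
    ∃ (l : ℕ) (b : Module.Basis (Fin l) R (Fin n → W))
      (c : Module.Basis (Fin l) R (Fin n → leftTranslate g W)),
      ∀ i a, (c i a : S) = g * b i a := by
  obtain ⟨d, ⟨b⟩⟩ := exists_finBasis R W
  obtain ⟨c, hc⟩ := exists_basis_leftTranslate hg b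
  let e := Fintype.equivFin (Σ _ : Fin n, Fin d)
  refine ⟨_, (Pi.basis fun _ : Fin n => b).reindex e, (Pi.basis fun _ : Fin n => c).reindex e,
    fun i a => ?_⟩
  simp only [Module.Basis.reindex_apply, Pi.basis_apply]
  obtain ⟨j, k⟩ := e.symm i
  by_cases hj : a = j
  · subst hj
    simp [hc]
  · simp [Pi.single_eq_of_ne hj]

/-- Since $(gw)A=g(wA)$, the matrix on $gW$ in translated bases is obtained by applying $\sigma_g$
to the entries. -/
theorem rankOn_leftTranslate [InvariantBasisNumber R] {U : Submonoid S}
    (hF : IsFiniteApproximationSystem F) (h : rk ∈ invariantRankSpace R U)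
    {g : S} (hg : g ∈ U) (hgN : g ∈ normalizing R) {W : Submodule R S} (hW : W ∈ F)
    (hgF : ∀ V ∈ F, leftTranslate g V ∈ F)
    (A : Matrix (Fin n) (Fin m) S) :
    rankOn F rk (leftTranslate g W) A = rankOn F rk W A := by
  obtain ⟨W', hW', H⟩ := hF.exists_receiving hW A
  obtain ⟨_, _⟩ := hF.free _ hW
  obtain ⟨_, _⟩ := hF.free _ hW'.1
  obtain ⟨l, b, c, hbc⟩ := exists_basis_pi_leftTranslate hgN (W := W) n
  obtain ⟨p, b', c', hbc'⟩ := exists_basis_pi_leftTranslate hgN (W := W') m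
  have H' : ∀ i j, ∀ w ∈ leftTranslate g W, w * A i j ∈ leftTranslate g W' := by
    intro i j w hw
    obtain ⟨v, hv, rfl⟩ := (mem_leftTranslate hgN).1 hw
    exact (mem_leftTranslate hgN).2 ⟨_, H i j v hv, (mul_assoc _ _ _).symm⟩
  have h1 : Represents W W' A (coordMatrix b b' (rowMap A H)) :=
    (represents_iff H _).2 ⟨b, b', rfl⟩
  have h2 : Represents (leftTranslate g W) (leftTranslate g W') A
      ((coordMatrix b b' (rowMap A H)).map (conj hgN)) := by
    refine ⟨c, c', fun i j => ?_⟩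
    have h3 : (rowMap A H (b i) j : S) =
        ((∑ k, coordMatrix b b' (rowMap A H) i k • b' k) j : W') := by
      rw [show ∑ k, coordMatrix b b' (rowMap A H) i k • b' k = rowMap A H (b i) from
        b'.sum_repr _]
    simp only [coe_rowMap, Finset.sum_apply, Pi.smul_apply, AddSubmonoidClass.coe_finsetSum,
      SetLike.val_smul, Subring.smul_def, smul_eq_mul] at h3
    simp only [hbc, hbc', Matrix.map_apply, mul_assoc]
    rw [← Finset.mul_sum, h3, Finset.mul_sum]
    refine Finset.sum_congr rfl fun k _ => ?_
    rw [← mul_assoc, conj_spec hgN, mul_assoc]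
  rw [hF.rankOn_of_represents h.1 hW hW'.1 H h1,
    hF.rankOn_of_represents h.1 (hgF _ hW) (hgF _ hW'.1) H' h2, h.2 g hg hgN]

end RowMap

/-! ### Convexity and compactness -/

section Spaces

theorem isSylvester_iff {R : Type*} [Ring R] (rk : MatrixFunction R) : IsSylvester rk ↔
    (∀ (n m : ℕ) (A : Matrix (Fin n) (Fin m) R), 0 ≤ rk n m A) ∧ (∀ n m : ℕ, rk n m 0 = 0) ∧
    rk 1 1 1 = 1 ∧
    (∀ (n m l : ℕ) (A : Matrix (Fin n) (Fin m) R) (B : Matrix (Fin m) (Fin l) R),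
      rk n l (A * B) ≤ min (rk n m A) (rk m l B)) ∧
    (∀ (n m n' m' : ℕ) (A : Matrix (Fin n) (Fin m) R) (B : Matrix (Fin n') (Fin m') R),
      rk (n + n') (m + m') (blockMatrix A 0 0 B) = rk n m A + rk n' m' B) ∧
    (∀ (n m n' m' : ℕ) (A : Matrix (Fin n) (Fin m) R) (C : Matrix (Fin n) (Fin m') R)
      (B : Matrix (Fin n') (Fin m') R),
      rk n m A + rk n' m' B ≤ rk (n + n') (m + m') (blockMatrix A C 0 B)) :=
  ⟨fun h => ⟨h.1, h.2, h.3, h.4, h.5, h.6⟩, fun ⟨h1, h2, h3, h4, h5, h6⟩ => ⟨h1, h2, h3, h4, h5, h6⟩⟩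

theorem convex_rankSpace (R : Type*) [Ring R] : Convex ℝ (rankSpace R) := by
  intro x hx y hy a b ha hb hab
  constructor
  · intro n m A
    exact add_nonneg (mul_nonneg ha (hx.nonneg _ _ _)) (mul_nonneg hb (hy.nonneg _ _ _))
  · intro n m
    simp [hx.zero, hy.zero]
  · simp [hx.one, hy.one, hab]
  · intro n m l A B
    have h1 := hx.mul_le_left A B
    have h2 := hx.mul_le_right A B
    have h3 := hy.mul_le_left A B
    have h4 := hy.mul_le_right A B
    simp only [Pi.add_apply, Pi.smul_apply, smul_eq_mul]
    exact le_min (by gcongr) (by gcongr)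
  · intro n m n' m' A B
    simp only [Pi.add_apply, Pi.smul_apply, smul_eq_mul, hx.diag, hy.diag]
    ring
  · intro n m n' m' A C B
    have h1 := IsSylvester.upper hx _ _ _ _ A C B
    have h2 := IsSylvester.upper hy _ _ _ _ A C B
    simp only [Pi.add_apply, Pi.smul_apply, smul_eq_mul]
    nlinarith

variable {S : Type*} [Ring S]

theorem convex_invariantRankSpace (R : Subring S) (U : Submonoid S) :
    Convex ℝ (invariantRankSpace R U) := by
  intro x hx y hy a b ha hb hab
  refine ⟨convex_rankSpace R hx.1 hy.1 ha hb hab, fun g hg hgN n m A => ?_⟩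
  simp [hx.2 g hg hgN, hy.2 g hg hgN]

theorem isClosed_rankSpace (R : Type*) [Ring R] : IsClosed (rankSpace R) := by
  have hc : ∀ (n m : ℕ) (A : Matrix (Fin n) (Fin m) R),
      Continuous fun rk : MatrixFunction R => rk n m A := fun n m A => by fun_prop
  simp only [rankSpace, isSylvester_iff, Set.ofPred_and, Set.ofPred_forall]
  refine (isClosed_iInter fun n => isClosed_iInter fun m => isClosed_iInter fun A =>
      isClosed_le continuous_const (hc n m A)).inter <|
    (isClosed_iInter fun n => isClosed_iInter fun m =>
      isClosed_eq (hc n m 0) continuous_const).inter <|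
    (isClosed_eq (hc 1 1 1) continuous_const).inter <|
    (isClosed_iInter fun n => isClosed_iInter fun m => isClosed_iInter fun l =>
      isClosed_iInter fun A => isClosed_iInter fun B =>
        isClosed_le (hc _ _ _) ((hc _ _ _).min (hc _ _ _))).inter <|
    (isClosed_iInter fun n => isClosed_iInter fun m => isClosed_iInter fun n' =>
      isClosed_iInter fun m' => isClosed_iInter fun A => isClosed_iInter fun B =>
        isClosed_eq (hc _ _ _) ((hc _ _ _).add (hc _ _ _))).inter <|
    (isClosed_iInter fun n => isClosed_iInter fun m => isClosed_iInter fun n' =>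
      isClosed_iInter fun m' => isClosed_iInter fun A => isClosed_iInter fun C =>
        isClosed_iInter fun B => isClosed_le ((hc _ _ _).add (hc _ _ _)) (hc _ _ _))

/-- All conditions are closed, and $\mathrm{rk}$ of an $n$-row matrix lies in $[0,n]$, so the set is
closed in a product of intervals. -/
theorem isCompact_invariantRankSpace (R : Subring S) (U : Submonoid S) :
    IsCompact (invariantRankSpace R U) := by
  have hcpt : IsCompact (Set.univ.pi fun n : ℕ => Set.univ.pi fun m : ℕ => Set.univ.pi
      fun _ : Matrix (Fin n) (Fin m) R => Set.Icc (0 : ℝ) n) :=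
    isCompact_univ_pi fun n => isCompact_univ_pi fun m => isCompact_univ_pi fun A => isCompact_Icc
  have hc : ∀ (n m : ℕ) (A : Matrix (Fin n) (Fin m) R),
      Continuous fun rk : MatrixFunction R => rk n m A := fun n m A => by fun_prop
  refine hcpt.of_isClosed_subset ?_ ?_
  · simp only [invariantRankSpace, Set.ofPred_and, Set.ofPred_forall]
    refine (isClosed_rankSpace R).inter ?_
    exact isClosed_iInter fun g => isClosed_iInter fun hg => isClosed_iInter fun hgN =>
      isClosed_iInter fun n => isClosed_iInter fun m => isClosed_iInter fun A =>
        isClosed_eq (hc _ _ _) (hc _ _ _)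
  · intro rk hrk n _ m _ A _
    exact ⟨hrk.1.nonneg _ _ _, hrk.1.le_rows A⟩

end Spaces

/-! ### The extended rank function -/

section Blocks

variable {R : Type*} [Ring R]
variable {M N M' N' : Type*} [AddCommGroup M] [Module R M] [AddCommGroup N] [Module R N]
  [AddCommGroup M'] [Module R M'] [AddCommGroup N'] [Module R N']
variable [Module.Finite R M] [Module.Free R M] [Module.Finite R N] [Module.Free R N]
variable [Module.Finite R M'] [Module.Free R M'] [Module.Finite R N'] [Module.Free R N']
variable {rk : MatrixFunction R}

theorem IsSylvester.linRank_congr (h : IsSylvester rk) {f : M →ₗ[R] N} {f' : M' →ₗ[R] N'}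
    (e : M ≃ₗ[R] M') (e' : N ≃ₗ[R] N') (hf : ∀ x, e' (f x) = f' (e x)) :
    linRank rk f = linRank rk f' := by
  refine le_antisymm (h.linRank_le_of_comp_eq e.toLinearMap e'.symm.toLinearMap ?_)
    (h.linRank_le_of_comp_eq e.symm.toLinearMap e'.toLinearMap ?_)
  · ext x; simp [← hf]
  · ext x; simp [hf]

variable (R M) in
omit [Module.Finite R M] [Module.Free R M] in
/-- Vectors of length `n + n'` as pairs of vectors. -/
def splitEquiv (n n' : ℕ) : (Fin (n + n') → M) ≃ₗ[R] (Fin n → M) × (Fin n' → M) :=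
  (LinearEquiv.funCongrLeft R M finSumFinEquiv).trans
    (LinearEquiv.sumArrowLequivProdArrow (Fin n) (Fin n') R M)

end Blocks

section ExtendedRank

variable {S : Type*} [Ring S] {R : Subring S} {rk : MatrixFunction R} {F : Set (Submodule R S)}

/-! ### The Sylvester axioms for the rank on a fixed member of $F$ -/

section Algebra

variable [InvariantBasisNumber R] (hF : IsFiniteApproximationSystem F) (h : IsSylvester rk)
include hF h

theorem rankOn_zero {W : Submodule R S} (hW : W ∈ F) (n m : ℕ) :
    rankOn F rk W (0 : Matrix (Fin n) (Fin m) S) = 0 := by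
  obtain ⟨W', hW', H⟩ := hF.exists_receiving hW (0 : Matrix (Fin n) (Fin m) S)
  obtain ⟨_, _⟩ := hF.free _ hW
  obtain ⟨_, _⟩ := hF.free _ hW'.1
  rw [hF.rankOn_eq h hW'.1 H hW, ← h.linRank_zero (M := Fin n → W) (N := Fin m → W')]
  congr 1
  ext
  simp

theorem rankOn_one {W : Submodule R S} (hW : W ∈ F) (n : ℕ) :
    rankOn F rk W (1 : Matrix (Fin n) (Fin n) S) = n * freeDim R W := by
  have H : ∀ i j, ∀ w ∈ W, w * (1 : Matrix (Fin n) (Fin n) S) i j ∈ W := by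
    intro i j w hw
    rw [Matrix.one_apply]
    split_ifs <;> simp [hw]
  obtain ⟨_, _⟩ := hF.free _ hW
  have h1 : rowMap 1 H = LinearMap.id := by
    ext x j
    simp [Matrix.one_apply]
  obtain ⟨b⟩ := exists_basis_freeDim R (Fin n → W)
  rw [hF.rankOn_eq h hW H hW, h1, h.linRank_id b, freeDim_pi]
  push_cast
  rfl

theorem rankOn_mul_le {n m l : ℕ} {W W' : Submodule R S} (hW : W ∈ F) (hW' : W' ∈ F)
    (A : Matrix (Fin n) (Fin m) S) (B : Matrix (Fin m) (Fin l) S)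
    (H : ∀ i j, ∀ w ∈ W, w * A i j ∈ W') :
    rankOn F rk W (A * B) ≤ rankOn F rk W A ∧ rankOn F rk W (A * B) ≤ rankOn F rk W' B := by
  obtain ⟨W'', hW'', H'⟩ := hF.exists_receiving hW' B
  have H'' : ∀ i j, ∀ w ∈ W, w * (A * B) i j ∈ W'' := by
    intro i j w hw
    rw [Matrix.mul_apply, Finset.mul_sum]
    refine Submodule.sum_mem _ fun k _ => ?_
    rw [← mul_assoc]
    exact H' k j _ (H i k w hw)
  obtain ⟨_, _⟩ := hF.free _ hW
  obtain ⟨_, _⟩ := hF.free _ hW'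
  obtain ⟨_, _⟩ := hF.free _ hW''.1
  have h1 : rowMap (A * B) H'' = rowMap B H' ∘ₗ rowMap A H := by
    refine LinearMap.ext fun x => funext fun j => Subtype.ext ?_
    simp only [coe_rowMap, LinearMap.comp_apply, Matrix.mul_apply, Finset.mul_sum, Finset.sum_mul,
      mul_assoc]
    exact Finset.sum_comm
  rw [hF.rankOn_eq h hW''.1 H'' hW, hF.rankOn_eq h hW' H hW, hF.rankOn_eq h hW''.1 H' hW', h1]
  exact ⟨h.linRank_comp_le_right _ _, h.linRank_comp_le_left _ _⟩

theorem rankOn_blockMatrix {n m n' m' : ℕ} {W : Submodule R S} (hW : W ∈ F)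
    (A : Matrix (Fin n) (Fin m) S) (C : Matrix (Fin n) (Fin m') S)
    (B : Matrix (Fin n') (Fin m') S) :
    rankOn F rk W (blockMatrix A 0 0 B) = rankOn F rk W A + rankOn F rk W B ∧
    rankOn F rk W A + rankOn F rk W B ≤ rankOn F rk W (blockMatrix A C 0 B) := by
  obtain ⟨WA, hWA, HA⟩ := hF.exists_receiving hW A
  obtain ⟨WB, hWB, HB⟩ := hF.exists_receiving hW B
  obtain ⟨WC, hWC, HC⟩ := hF.exists_receiving hW C
  obtain ⟨W', hW', hle⟩ : ∃ W' ∈ F, WA ⊔ WB ⊔ WC ≤ W' :=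
    ⟨_, hF.sup_mem _ (hF.sup_mem _ hWA.1 _ hWB.1) _ hWC.1, le_rfl⟩
  replace HA : ∀ i j, ∀ w ∈ W, w * A i j ∈ W' := fun i j w hw =>
    hle (Submodule.mem_sup_left (Submodule.mem_sup_left (HA i j w hw)))
  replace HB : ∀ i j, ∀ w ∈ W, w * B i j ∈ W' := fun i j w hw =>
    hle (Submodule.mem_sup_left (Submodule.mem_sup_right (HB i j w hw)))
  replace HC : ∀ i j, ∀ w ∈ W, w * C i j ∈ W' := fun i j w hw =>
    hle (Submodule.mem_sup_right (HC i j w hw))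
  obtain ⟨_, _⟩ := hF.free _ hW
  obtain ⟨_, _⟩ := hF.free _ hW'
  have H : ∀ D : Matrix (Fin n) (Fin m') S, (∀ i j, ∀ w ∈ W, w * D i j ∈ W') →
      ∀ i j, ∀ w ∈ W, w * blockMatrix A D 0 B i j ∈ W' := by
    intro D HD i j w hw
    obtain ⟨i, rfl⟩ := finSumFinEquiv.surjective i
    obtain ⟨j, rfl⟩ := finSumFinEquiv.surjective j
    rcases i with i | i <;> rcases j with j | j
    · simp [blockMatrix, Matrix.reindex_apply, HA i j w hw]
    · simp [blockMatrix, Matrix.reindex_apply, HD i j w hw]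
    · simp [blockMatrix, Matrix.reindex_apply]
    · simp [blockMatrix, Matrix.reindex_apply, HB i j w hw]
  have key : ∀ (D : Matrix (Fin n) (Fin m') S) (HD : ∀ i j, ∀ w ∈ W, w * D i j ∈ W'),
      rankOn F rk W (blockMatrix A D 0 B) = linRank rk
        ((rowMap A HA ∘ₗ LinearMap.fst R (Fin n → W) (Fin n' → W)).prod
          (rowMap D HD ∘ₗ LinearMap.fst R _ _ + rowMap B HB ∘ₗ LinearMap.snd R _ _)) := by
    intro D HD
    rw [hF.rankOn_eq h hW' (H D HD) hW]
    refine h.linRank_congr (splitEquiv R W n n') (splitEquiv R W' m m') fun x => ?_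
    refine Prod.ext (funext fun j => Subtype.ext ?_) (funext fun j => Subtype.ext ?_)
    · simp [splitEquiv, blockMatrix, Matrix.reindex_apply, Fin.sum_univ_add, LinearMap.funLeft]
    · simp [splitEquiv, blockMatrix, Matrix.reindex_apply, Fin.sum_univ_add, LinearMap.funLeft]
  constructor
  · rw [key 0 (by simp), hF.rankOn_eq h hW' HA hW, hF.rankOn_eq h hW' HB hW,
      ← h.linRank_prodMap]
    congr 1
    refine LinearMap.ext fun x => Prod.ext (funext fun j => Subtype.ext ?_)
      (funext fun j => Subtype.ext ?_) <;> simp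
  · rw [key C HC, hF.rankOn_eq h hW' HA hW, hF.rankOn_eq h hW' HB hW]
    exact h.le_linRank_triangular _ _ _

end Algebra

variable {U : Submonoid S} [InvariantBasisNumber R] (hA : IsRightAmenableNormal F U)
include hA

theorem IsRightAmenableNormal.isSubmodularRank_rankOn (h : rk ∈ invariantRankSpace R U) {n m : ℕ}
    (A : Matrix (Fin n) (Fin m) S) :
    IsSubmodularRank (saturation F U) hA.saturatedSubmonoid n
      (fun W => rankOn (saturation F U) rk W A) := by
  have hs := hA.isFiniteApproximationSystem_saturation
  refine ⟨rankOn_bot hs h.1 A, fun V hV W hW hle => rankOn_mono hs h.1 hV hW hle A,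
    fun V hV W hW hle => rankOn_lipschitz hs h.1 hV hW hle A,
    fun V hV W hW => rankOn_sup_add_inf_le hs h.1 hV hW A, fun g hg W hW => ?_⟩
  obtain ⟨c, hc, u, hu, -, hcu⟩ := hA.exists_leftTranslate_eq hg
  have hsU : ∀ u ∈ U, ∀ V ∈ saturation F U, leftTranslate u V ∈ saturation F U := fun u hu V hV =>
    hA.isNormal_saturation.le_mul_mem hs (hA.le_saturatedSubmonoid hu) hV
  -- Invariance of rk is known only for $U$. With $cgW=uW$ for $c,u\in U$, the ranks on $gW$,
  -- $cgW=uW$ and $W$ agree.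
  rw [← rankOn_leftTranslate hs h hc (hA.le_normalizing c hc)
      (hA.isNormal_saturation.le_mul_mem hs hg hW) (hsU c hc), hcu,
    rankOn_leftTranslate hs h hu (hA.le_normalizing u hu) hW (hsU u hu)]

/-- The infimum rule: normalized ranks on sufficiently invariant submodules are close to each
other. -/
theorem IsRightAmenableNormal.exists_limit_rankOn (h : rk ∈ invariantRankSpace R U) {n m : ℕ}
    (A : Matrix (Fin n) (Fin m) S) :
    ∃ l : ℝ, ∀ η : ℝ, 0 < η → ∃ (V : Finset S) (ε : ℝ), 0 < ε ∧ ∀ W ∈ nonzeroPart F,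
      IsInvariant F V ε W → |rankOn F rk W A / freeDim R W - l| ≤ η := by
  obtain ⟨l, hl⟩ := hA.isLeftSaturated_saturation.exists_limit
    hA.isFiniteApproximationSystem_saturation hA.isNormal_saturation n.cast_nonneg
    (hA.isSubmodularRank_rankOn h A)
  refine ⟨l, fun η hη => ?_⟩
  obtain ⟨V, ε, hε, hV⟩ := hl η hη
  refine ⟨V, ε, hε, fun W hW ⟨W', hW', hinv⟩ => ?_⟩
  have := hV W ⟨subset_saturation hW.1, hW.2⟩ ⟨W', subset_saturation hW', hinv⟩
  rwa [hA.toIsFiniteApproximationSystem.rankOn_congr hA.isFiniteApproximationSystem_saturation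
    subset_saturation h.1 hW.1] at this

omit [InvariantBasisNumber R] in
-- Sets of invariant members are nonempty by amenability and directed in $(V,\varepsilon)$, so they
-- generate a proper filter.
theorem IsRightAmenableNormal.exists_isNonprincipal :
    ∃ ω : Ultrafilter (nonzeroPart F), IsNonprincipal F ω := by
  classical
  let f : Filter (nonzeroPart F) := ⨅ p : Finset S × {ε : ℝ // 0 < ε},
    𝓟 {W : nonzeroPart F | IsInvariant F p.1 p.2 W.1}
  have hf : f.NeBot := by
    have : Nonempty (Finset S × {ε : ℝ // 0 < ε}) := ⟨∅, 1, one_pos⟩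
    refine iInf_neBot_of_directed' ?_ ?_
    · rintro ⟨V, ε, hε⟩ ⟨V', ε', hε'⟩
      refine ⟨⟨V ∪ V', min ε ε', lt_min hε hε'⟩, ?_, ?_⟩
      · exact principal_mono.2 fun W hW => hW.mono Finset.subset_union_left (min_le_left _ _)
      · exact principal_mono.2 fun W hW => hW.mono Finset.subset_union_right (min_le_right _ _)
    · rintro ⟨V, ε, hε⟩
      obtain ⟨W, hW, hinv⟩ := hA.exists_invariant V ε hε
      exact principal_neBot_iff.2 ⟨⟨W, hW⟩, hinv⟩
  refine ⟨Ultrafilter.of f, fun V ε hε => Ultrafilter.of_le f ?_⟩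
  exact mem_iInf_of_mem ⟨V, ε, hε⟩ (mem_principal_self _)

variable {ω : Ultrafilter (nonzeroPart F)} (hω : IsNonprincipal F ω)
include hω

/-- The estimate for all invariant $W$ is kept beside the limit: it gives independence of the
ultrafilter and is applied to tiles in the continuity proof. -/
theorem IsRightAmenableNormal.exists_forall_tendsto (h : rk ∈ invariantRankSpace R U) {n m : ℕ}
    (A : Matrix (Fin n) (Fin m) S) :
    Tendsto (normalizedRank F rk A) ω (𝓝 (extendedRank F ω rk n m A)) ∧
    ∀ η : ℝ, 0 < η → ∃ (V : Finset S) (ε : ℝ), 0 < ε ∧ ∀ W ∈ nonzeroPart F,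
      IsInvariant F V ε W → |rankOn F rk W A / freeDim R W - extendedRank F ω rk n m A| ≤ η := by
  obtain ⟨l, hl⟩ := hA.exists_limit_rankOn h A
  have h1 : Tendsto (normalizedRank F rk A) ω (𝓝 l) := by
    rw [Metric.tendsto_nhds]
    intro η hη
    obtain ⟨V, ε, hε, hV⟩ := hl (η / 2) (half_pos hη)
    filter_upwards [hω V ε hε] with W hW
    rw [Real.dist_eq]
    exact (hV W.1 W.2 hW).trans_lt (half_lt_self hη)
  have h2 : extendedRank F ω rk n m A = l := h1.limUnder_eq
  rw [h2]
  exact ⟨h1, hl⟩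

theorem IsRightAmenableNormal.tendsto_normalizedRank (h : rk ∈ invariantRankSpace R U) {n m : ℕ}
    (A : Matrix (Fin n) (Fin m) S) :
    Tendsto (normalizedRank F rk A) ω (𝓝 (extendedRank F ω rk n m A)) :=
  (hA.exists_forall_tendsto hω h A).1

theorem IsRightAmenableNormal.extendedRank_congr {ω' : Ultrafilter (nonzeroPart F)}
    (hω' : IsNonprincipal F ω') (h : rk ∈ invariantRankSpace R U) :
    extendedRank F ω rk = extendedRank F ω' rk := by
  funext n m A
  refine eq_of_forall_dist_le fun η hη => ?_
  obtain ⟨V, ε, hε, hV⟩ := (hA.exists_forall_tendsto hω h A).2 (η / 2) (half_pos hη)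
  have h1 := hA.tendsto_normalizedRank hω' h A
  rw [dist_comm, Real.dist_eq]
  refine le_of_tendsto (h1.sub_const _).abs ?_
  filter_upwards [hω' V ε hε] with W hW
  exact (hV W.1 W.2 hW).trans (half_le_self hη.le)

theorem IsRightAmenableNormal.extendedRank_mem (h : rk ∈ invariantRankSpace R U) :
    extendedRank F ω rk ∈ rankSpace S := by
  have hF := hA.toIsFiniteApproximationSystem
  have ht : ∀ {n m : ℕ} (A : Matrix (Fin n) (Fin m) S), Tendsto (normalizedRank F rk A) ω
    (𝓝 (extendedRank F ω rk n m A)) := fun A => hA.tendsto_normalizedRank hω h A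
  constructor
  · intro n m A
    exact ge_of_tendsto (ht A) (Eventually.of_forall fun W =>
      div_nonneg (rankOn_nonneg hF h.1 W.2.1 A) (Nat.cast_nonneg _))
  · intro n m
    refine tendsto_nhds_unique (ht 0) ?_
    refine tendsto_const_nhds.congr fun W => ?_
    rw [normalizedRank, rankOn_zero hF h.1 W.2.1, zero_div]
  · refine tendsto_nhds_unique (ht 1) ?_
    refine tendsto_const_nhds.congr fun W => ?_
    have := hF.freeDim_pos W.2.1 W.2.2
    rw [normalizedRank, rankOn_one hF h.1 W.2.1]
    field_simp
    simp
  · intro n m l A B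
    refine le_min ?_ ?_
    · refine le_of_tendsto_of_tendsto' (ht _) (ht A) fun W => ?_
      obtain ⟨W', hW', H⟩ := hF.exists_receiving W.2.1 A
      exact div_le_div_of_nonneg_right (rankOn_mul_le hF h.1 W.2.1 hW'.1 A B H).1
        (Nat.cast_nonneg _)
    -- Here $B$ acts on the larger module $W'$. Invariance and the Lipschitz bound let it be
    -- replaced by $W$ at a cost of $\varepsilon$ per dimension; $m+1$ avoids dividing by zero.
    · refine le_of_forall_pos_le_add fun ε hε => ?_
      have hm : (0 : ℝ) < m + 1 := by positivity
      refine le_of_tendsto_of_tendsto (ht _) ((ht B).add_const ε) ?_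
      classical
      filter_upwards [hω (Finset.univ.image fun p : Fin n × Fin m => A p.1 p.2) (ε / (m + 1))
        (by positivity)] with W hW
      obtain ⟨W', hW', hle, hmem, hdim⟩ := hW
      have H : ∀ i j, ∀ w ∈ W.1, w * A i j ∈ W' := fun i j w hw =>
        hmem w hw _ (Finset.mem_image_of_mem (fun p : Fin n × Fin m => A p.1 p.2)
          (Finset.mem_univ (i, j)))
      have h1 := (rankOn_mul_le hF h.1 W.2.1 hW' A B H).2
      have h2 := rankOn_lipschitz hF h.1 W.2.1 hW' hle B
      have h0 : (0 : ℝ) < freeDim R W.1 := by exact_mod_cast hF.freeDim_pos W.2.1 W.2.2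
      have h3 : (m : ℝ) * ((freeDim R W' : ℝ) - freeDim R W.1) ≤ ε * freeDim R W.1 := by
        have h4 : (freeDim R W' : ℝ) - freeDim R W.1 ≤ ε / (m + 1) * freeDim R W.1 := by linarith
        calc (m : ℝ) * ((freeDim R W' : ℝ) - freeDim R W.1)
            ≤ m * (ε / (m + 1) * freeDim R W.1) := by gcongr
          _ = (m / (m + 1)) * (ε * freeDim R W.1) := by ring
          _ ≤ 1 * (ε * freeDim R W.1) := by
            gcongr
            rw [div_le_one hm]
            linarith
          _ = _ := one_mul _
      simp only [normalizedRank]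
      rw [div_add' _ _ _ h0.ne']
      gcongr
      linarith
  · intro n m n' m' A B
    refine tendsto_nhds_unique (ht _) (((ht A).add (ht B)).congr fun W => ?_)
    simp only [normalizedRank]
    rw [(rankOn_blockMatrix hF h.1 W.2.1 A 0 B).1, add_div]
  · intro n m n' m' A C B
    refine le_of_tendsto_of_tendsto' ((ht A).add (ht B)) (ht _) fun W => ?_
    simp only [normalizedRank]
    rw [← add_div]
    exact div_le_div_of_nonneg_right (rankOn_blockMatrix hF h.1 W.2.1 A C B).2 (Nat.cast_nonneg _)

theorem IsRightAmenableNormal.extendedRank_affine {rk₁ rk₂ : MatrixFunction R}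
    (h₁ : rk₁ ∈ invariantRankSpace R U) (h₂ : rk₂ ∈ invariantRankSpace R U) {t : ℝ} (ht : 0 ≤ t)
    (ht' : t ≤ 1) : extendedRank F ω (t • rk₁ + (1 - t) • rk₂) =
      t • extendedRank F ω rk₁ + (1 - t) • extendedRank F ω rk₂ := by
  have h := convex_invariantRankSpace R U h₁ h₂ ht (sub_nonneg.2 ht') (by ring)
  funext n m A
  refine tendsto_nhds_unique (hA.tendsto_normalizedRank hω h A)
    ((((hA.tendsto_normalizedRank hω h₁ A).const_mul t).add
      ((hA.tendsto_normalizedRank hω h₂ A).const_mul (1 - t))).congr fun W => ?_)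
  -- One matrix $B$ serves all rank functions, so the normalized ranks are affine before passing to
  -- the limit.
  obtain ⟨l, p, B, hB⟩ := hA.toIsFiniteApproximationSystem.exists_rankOn_eq W.2.1 A
  simp only [normalizedRank, hB, Pi.add_apply, Pi.smul_apply, smul_eq_mul]
  ring

end ExtendedRank

/-! ### Continuity of the extension -/

section Continuity

universe u

variable {S : Type u} [Ring S] {R : Subring S} {F : Set (Submodule R S)} {U : Submonoid S}

theorem disjoint_biSup_of_iSupIndep {ι : Type*} {f : ι → Submodule R S}
    (hf : iSupIndep f) {s : Finset ι} {a : ι} (ha : a ∉ s) : Disjoint (f a) (⨆ i ∈ s, f i) :=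
  (hf a).mono_right (iSup₂_le fun i hi => le_iSup₂_of_le i (by rintro rfl; exact ha hi) le_rfl)

variable [InvariantBasisNumber R]

theorem IsFiniteApproximationSystem.freeDim_biSup_of_iSupIndep
    (hF : IsFiniteApproximationSystem F) {ι : Type*} {f : ι → Submodule R S} (hf : iSupIndep f)
    (s : Finset ι) (hs : ∀ i ∈ s, f i ∈ F) :
    freeDim R (⨆ i ∈ s, f i : Submodule R S) = ∑ i ∈ s, freeDim R (f i) := by
  classical
  exact hF.freeDim_biSup_eq s f hs fun t a ha _ =>
    disjoint_biSup_of_iSupIndep hf ha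

theorem IsFiniteApproximationSystem.finite_of_iSupIndep
    (hF : IsFiniteApproximationSystem F) {ι : Type*} {f : ι → Submodule R S} (hf : iSupIndep f)
    (hfF : ∀ i, f i ∈ nonzeroPart F) {W : Submodule R S} (hW : W ∈ F) (hle : ∀ i, f i ≤ W) :
    Finite ι := by
  by_contra hinf
  rw [not_finite_iff_infinite] at hinf
  obtain ⟨s, hs⟩ := Infinite.exists_subset_card_eq ι (freeDim R W + 1)
  have h1 := hF.freeDim_biSup_of_iSupIndep hf s fun i _ => (hfF i).1
  have h2 := hF.freeDim_mono (hF.biSup_mem s f fun i _ => (hfF i).1) hW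
    (iSup₂_le fun i _ => hle i)
  have h3 : s.card • 1 ≤ ∑ i ∈ s, freeDim R (f i) :=
    Finset.card_nsmul_le_sum _ _ _ fun i _ => hF.freeDim_pos (hfF i).1 (hfF i).2
  simp only [smul_eq_mul, mul_one] at h3
  omega

theorem IsFiniteApproximationSystem.exists_nonzero_le (hF : IsFiniteApproximationSystem F)
    (M : Submodule R S) (hM : M.FG) : ∃ V ∈ nonzeroPart F, M ≤ V := by
  obtain ⟨V, hV, hle⟩ := hF.exists_le (Submodule.span R {1} ⊔ M)
    ((Submodule.fg_span_singleton 1).sup hM)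
  have : Nontrivial R := nontrivial_of_invariantBasisNumber R
  have : Nontrivial S := Subtype.val_injective.nontrivial (α := R)
  refine ⟨V, ⟨hV, ?_⟩, le_sup_right.trans hle⟩
  rintro rfl
  exact one_ne_zero ((Submodule.mem_bot R).1
    (hle (Submodule.mem_sup_left (Submodule.mem_span_singleton_self (1 : S)))))

omit [InvariantBasisNumber R] in
theorem IsNormal.isInvariant_of_le (hF : IsFiniteApproximationSystem F) (hU : IsNormal F U)
    {V : Submodule R S} (hV : V ∈ F) {v : Finset S} (hv : ∀ x ∈ v, x ∈ V) {δ : ℝ}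
    {W : Submodule R S} (hW : W ∈ F) (h : IsSubmoduleInvariant V δ W) : IsInvariant F v δ W :=
  ⟨_, hF.sup_mem _ hW _ (hU.mul_mem hF hW hV), le_sup_left, fun _ hw x hx =>
    Submodule.mem_sup_right (Submodule.mul_mem_mul hw (hv x hx)), h⟩

/-- An almost invariant submodule `T` contains a large submodule which is carried by `V` into a
given large part `D` of `T`. -/
theorem IsNormal.exists_mul_le_part (hF : IsFiniteApproximationSystem F) (hU : IsNormal F U)
    {V : Submodule R S} {q : ℕ} (b : Module.Basis (Fin q) R V) (hb : ∀ i, (b i : S) ∈ U)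
    {ε : ℝ} {T D : Submodule R S} (hT : T ∈ F) (hD : D ∈ F) (hDT : D ≤ T)
    (hinv : (freeDim R (T ⊔ T * V : Submodule R S) : ℝ) ≤ (1 + ε) * freeDim R T)
    (hdim : (1 - ε) * freeDim R T ≤ freeDim R D) (hV : V ∈ F) :
    ∃ X ∈ F, X ≤ T ∧ (∀ x ∈ X, ∀ a ∈ V, x * a ∈ D) ∧
      (freeDim R T : ℝ) - q * (2 * ε * freeDim R T) ≤ freeDim R X := by
  have hTV := hF.sup_mem _ hT _ (hU.mul_mem hF hT hV)
  obtain ⟨X, hX, hXT, hXf, hXd⟩ := hF.exists_le_forall hT Finset.univ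
    (fun i => rightDiv T (b i : S) D) (fun i _ => hU.rightDiv_mem hF (hb i) hD hT)
    (fun i _ x hx => ((mem_rightDiv (hU.le_normalizing _ (hb i))).1 hx).1)
    -- $D$ and $Tb_i$ both lie in $T+TV$, of dimension at most $(1+\varepsilon)\dim T$, so they meet
    -- in dimension at least $(1-\varepsilon)+1-(1+\varepsilon)=1-2\varepsilon$ times $\dim T$.
    (2 * ε * freeDim R T) (fun i _ => by
      have hm := hU.map_rightMul_mem hF (hb i) hT
      rw [hU.freeDim_rightDiv hF (hb i) hD hT]
      have h1 := hF.freeDim_sup_add_inf hD hm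
      have h2 := hF.freeDim_mono (hF.sup_mem _ hD _ hm) hTV
        (sup_le (hDT.trans le_sup_left) ((map_rightMul_le_mul (b i).2).trans le_sup_right))
      rw [freeDim_map_rightMul hF (hU.le_normalizing _ (hb i)) hT] at h1
      have h1' : (freeDim R (D ⊔ T.map (rightMul R (b i : S)) : Submodule R S) : ℝ) +
        freeDim R (D ⊓ T.map (rightMul R (b i : S)) : Submodule R S) =
          freeDim R D + freeDim R T := by exact_mod_cast h1
      have h2' : (freeDim R (D ⊔ T.map (rightMul R (b i : S)) : Submodule R S) : ℝ) ≤
        freeDim R (T ⊔ T * V : Submodule R S) := by exact_mod_cast h2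
      linarith)
  refine ⟨X, hX, hXT, fun x hx a ha => ?_, by simpa using hXd⟩
  have h1 : a = ∑ i, (b.repr ⟨a, ha⟩ i : S) * (b i : S) := by
    have := congrArg Subtype.val (b.sum_repr ⟨a, ha⟩)
    simp only [AddSubmonoidClass.coe_finsetSum, SetLike.val_smul, Subring.smul_def,
      smul_eq_mul] at this
    exact this.symm
  rw [h1, Finset.mul_sum]
  refine Submodule.sum_mem _ fun i _ => ?_
  rw [← mul_assoc]
  exact ((mem_rightDiv (hU.le_normalizing _ (hb i))).1
    (hXf i (Finset.mem_univ i) (hU.mul_right_mem hX hx _))).2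

/-- The rank on a quasitiled submodule is approximately the sum of the ranks on the tiles. -/
theorem IsQuasitiled.exists_sum_approx (hF : IsFiniteApproximationSystem F) (hU : IsNormal F U)
    {V : Submodule R S} (hV : V ∈ F) {q : ℕ} (b : Module.Basis (Fin q) R V)
    (hb : ∀ i, (b i : S) ∈ U) {ε : ℝ} (hε' : ε < 1) {N : ℕ}
    {T : Fin N → Submodule R S} (hT : ∀ j, T j ∈ nonzeroPart F)
    (hinv : ∀ j, (freeDim R (T j ⊔ T j * V : Submodule R S) : ℝ) ≤ (1 + ε) * freeDim R (T j))
    {W : Submodule R S} (hW : W ∈ nonzeroPart F) (hQ : IsQuasitiled F U ε T W) :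
    ∃ (ι : Type u) (s : Finset ι) (τ : ι → Fin N),
      (1 - ε) * ∑ x ∈ s, (freeDim R (T (τ x)) : ℝ) ≤ freeDim R W ∧
      (1 - ε) * freeDim R W ≤ ∑ x ∈ s, (freeDim R (T (τ x)) : ℝ) ∧
      ∀ rk ∈ invariantRankSpace R U, ∀ (n m : ℕ) (A : Matrix (Fin n) (Fin m) S),
        (∀ i j, A i j ∈ V) →
        rankOn F rk W A ≤ (∑ x ∈ s, rankOn F rk (T (τ x)) A) + n * (ε * freeDim R W) ∧
        (∑ x ∈ s, (rankOn F rk (T (τ x)) A - n * (q * (2 * ε * freeDim R (T (τ x)))))) ≤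
          rankOn F rk W A := by
  obtain ⟨C, D, hC, hDF, hDT, hind, hle, hcov⟩ := hQ
  let f : (Σ j, C j) → Submodule R S := fun x => leftTranslate (x.2 : S) (D x.1 x.2)
  let t : (Σ j, C j) → Submodule R S := fun x => leftTranslate (x.2 : S) (T x.1)
  have hCU : ∀ x : Σ j, C j, (x.2 : S) ∈ U := fun x => (hC x.1 x.2.2).1
  have hCN : ∀ x : Σ j, C j, (x.2 : S) ∈ normalizing R := fun x => hU.le_normalizing _ (hCU x)
  have hDF' : ∀ x : Σ j, C j, D x.1 x.2 ∈ F := fun x => hDF _ _ x.2.2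
  have hfF : ∀ x, f x ∈ F := fun x => hU.le_mul_mem hF (hCU x) (hDF' x)
  have htF : ∀ x, t x ∈ F := fun x => hU.le_mul_mem hF (hCU x) (hT x.1).1
  have hft : ∀ x, f x ≤ t x := fun x => leftTranslate_mono (hDT _ _ x.2.2).1
  have htW : ∀ x, t x ≤ W := fun x => (le_iSup t x).trans hle
  have hfd : ∀ x, freeDim R (f x) = freeDim R (D x.1 x.2) := fun x =>
    freeDim_leftTranslate hF (hCN x) (hDF' x)
  have htd : ∀ x, freeDim R (t x) = freeDim R (T x.1) := fun x =>
    freeDim_leftTranslate hF (hCN x) (hT x.1).1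
  have hf0 : ∀ x, f x ∈ nonzeroPart F := by
    refine fun x => ⟨hfF x, fun h0 => ?_⟩
    have h1 := (hDT _ _ x.2.2).2
    have h2 : (0 : ℝ) < freeDim R (T x.1) := by
      exact_mod_cast hF.freeDim_pos (hT x.1).1 (hT x.1).2
    rw [← hfd, h0, freeDim_bot, Nat.cast_zero] at h1
    nlinarith
  -- The sets of centres are not assumed finite; independent nonzero parts inside $W$ force it, and
  -- $\varepsilon<1$ makes the parts nonzero.
  have hfin : Finite (Σ j, C j) := hF.finite_of_iSupIndep hind hf0 hW.1 fun x =>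
    (hft x).trans (htW x)
  have := Fintype.ofFinite (Σ j, C j)
  have hYeq : (⨆ x, t x) = ⨆ x ∈ (Finset.univ : Finset (Σ j, C j)), t x := by simp
  have hYF : (⨆ x ∈ (Finset.univ : Finset (Σ j, C j)), t x) ∈ F := hF.biSup_mem _ _ fun x _ => htF x
  change (⨆ x, t x) ≤ W at hle
  change (1 - ε) * freeDim R W ≤ freeDim R (⨆ x, t x : Submodule R S) at hcov
  rw [hYeq] at hle hcov
  refine ⟨Σ j, C j, Finset.univ, Sigma.fst, ?_, ?_, fun rk hrk n m A hAV => ⟨?_, ?_⟩⟩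
  · rw [Finset.mul_sum]
    calc ∑ x : Σ j, C j, (1 - ε) * (freeDim R (T x.1) : ℝ)
        ≤ ∑ x : Σ j, C j, (freeDim R (f x) : ℝ) := by
          refine Finset.sum_le_sum fun x _ => ?_
          rw [hfd]
          exact (hDT _ _ x.2.2).2
      _ = (freeDim R (⨆ x ∈ (Finset.univ : Finset (Σ j, C j)), f x : Submodule R S) : ℝ) := by
          rw [hF.freeDim_biSup_of_iSupIndep hind _ fun x _ => hfF x]
          push_cast
          rfl
      _ ≤ freeDim R W := by
          exact_mod_cast hF.freeDim_mono (hF.biSup_mem _ _ fun x _ => hfF x) hW.1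
            (iSup₂_le fun x _ => (hft x).trans (htW x))
  · refine hcov.trans ?_
    simp only [← htd]
    exact_mod_cast hF.freeDim_biSup_le _ _ fun x _ => htF x
  -- Upper bound: the translated tiles span all but $\varepsilon\dim W$ of $W$, and the rank is
  -- subadditive.
  · have h1 := rankOn_lipschitz hF hrk.1 hYF hW.1 hle A
    have h2 := rankOn_biSup_le hF hrk.1 Finset.univ t (fun x _ => htF x) A
    have h3 : ∑ x, rankOn F rk (t x) A = ∑ x : Σ j, C j, rankOn F rk (T x.1) A :=
      Finset.sum_congr rfl fun x _ => rankOn_leftTranslate hF hrk (hCU x) (hCN x) (hT x.1).1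
        (fun Z hZ => hU.le_mul_mem hF (hCU x) hZ) A
    rw [h3] at h2
    have h4 : (n : ℝ) * ((freeDim R W : ℝ) -
        freeDim R (⨆ x ∈ (Finset.univ : Finset (Σ j, C j)), t x : Submodule R S)) ≤
        n * (ε * freeDim R W) := by
      gcongr
      linarith
    linarith
  -- Lower bound: shrink each tile to a submodule that $V$ takes into its part. The translated
  -- images then lie in independent modules, so the ranks add up.
  · have hX := fun x : Σ j, C j => hU.exists_mul_le_part hF b hb (hT x.1).1 (hDF' x)
      (hDT _ _ x.2.2).1 (hinv x.1) (hDT _ _ x.2.2).2 hV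
    choose X hXF hXT hXD hXd using hX
    have hcX : ∀ x, leftTranslate (x.2 : S) (X x) ∈ F := fun x =>
      hU.le_mul_mem hF (hCU x) (hXF x)
    have h1 : ∀ x : Σ j, C j, rankOn F rk (T x.1) A -
        n * (q * (2 * ε * freeDim R (T x.1))) ≤ rankOn F rk (leftTranslate (x.2 : S) (X x)) A := by
      intro x
      rw [rankOn_leftTranslate hF hrk (hCU x) (hCN x) (hXF x)
        (fun Z hZ => hU.le_mul_mem hF (hCU x) hZ)]
      have h2 := rankOn_lipschitz hF hrk.1 (hXF x) (hT x.1).1 (hXT x) A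
      have h3 : (n : ℝ) * ((freeDim R (T x.1) : ℝ) - freeDim R (X x)) ≤
          n * (q * (2 * ε * freeDim R (T x.1))) := by
        gcongr
        linarith [hXd x]
      linarith
    refine (Finset.sum_le_sum fun x _ => h1 x).trans ?_
    refine (sum_le_rankOn_biSup hF hrk.1 Finset.univ _ f (fun x _ => hcX x) (fun x _ => hfF x)
      hind ?_).trans (rankOn_mono hF hrk.1 (hF.biSup_mem _ _ fun x _ => hcX x) hW.1
        (iSup₂_le fun x _ => (leftTranslate_mono (hXT x)).trans (htW x)) A)
    intro x _ i j w hw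
    obtain ⟨y, hy, rfl⟩ := (mem_leftTranslate (hCN x)).1 hw
    exact (mem_leftTranslate (hCN x)).2 ⟨_, hXD x y hy _ (hAV i j), (mul_assoc _ _ _).symm⟩

theorem IsFiniteApproximationSystem.continuous_rankOn (hF : IsFiniteApproximationSystem F)
    {W : Submodule R S} (hW : W ∈ F) {n m : ℕ} (A : Matrix (Fin n) (Fin m) S) :
    Continuous fun rk : MatrixFunction R => rankOn F rk W A := by
  obtain ⟨l, p, B, hB⟩ := hF.exists_rankOn_eq hW A
  simp only [hB]
  fun_prop

theorem abs_sub_le_of_tiling {l l₀ ε η w d a n q φ : ℝ} (hw : 0 < w) (hη : 0 < η)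
    (hε : 0 < ε) (hε' : ε ≤ 1 / 2) (hn : 0 ≤ n) (hq : 0 ≤ q) (hl₀ : 0 ≤ l₀) (hl₀' : l₀ ≤ n)
    (h1 : (1 - ε) * d ≤ w) (h2 : (1 - ε) * w ≤ d) (h3 : φ ≤ a + n * (ε * w))
    (h4 : a - n * (q * (2 * ε * d)) ≤ φ) (h5 : |a - l₀ * d| ≤ 2 * η * d)
    (h6 : |φ / w - l| ≤ η) : |l - l₀| ≤ 5 * η + (4 * q + 4) * n * ε := by
  -- Both bounds use $\varepsilon\le1/2$, through $1/(1-\varepsilon)\le\min(2,\,1+2\varepsilon)$.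
  have hd : d ≤ 2 * w := by nlinarith
  have hd' : d ≤ w + 2 * ε * w := by nlinarith
  have h7 : |φ - l * w| ≤ η * w := by
    have : φ - l * w = (φ / w - l) * w := by field_simp
    rw [this, abs_mul, abs_of_pos hw]
    gcongr
  rw [abs_le] at h5 h7
  have h8 : l₀ * d ≤ l₀ * w + n * (2 * ε * w) := by
    have : l₀ * d ≤ l₀ * (w + 2 * ε * w) := by gcongr
    have : l₀ * (2 * ε * w) ≤ n * (2 * ε * w) := by gcongr
    linarith
  have h9 : l₀ * w - n * (ε * w) ≤ l₀ * d := by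
    have : l₀ * ((1 - ε) * w) ≤ l₀ * d := by gcongr
    have : l₀ * (ε * w) ≤ n * (ε * w) := by gcongr
    linarith
  have h10 : 2 * η * d ≤ 4 * η * w := by nlinarith
  have h11 : n * (q * (2 * ε * d)) ≤ 4 * q * n * ε * w := by
    have : n * (q * (2 * ε * d)) ≤ n * (q * (2 * ε * (2 * w))) := by gcongr
    linarith
  have h12 : 0 ≤ n * (ε * w) := by positivity
  have h13 : 0 ≤ q * n * ε * w := by positivity
  rw [← mul_le_mul_iff_left₀ hw, ← abs_of_pos hw, ← abs_mul, abs_of_pos hw, abs_le]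
  constructor <;> nlinarith [h5.1, h5.2, h7.1, h7.2]

variable (hA : IsRightAmenableNormal F U) {ω : Ultrafilter (nonzeroPart F)}
  (hω : IsNonprincipal F ω)
include hA hω

/-- The order of quantifiers in weak quasitiling is decisive: the tiles depend only on `rk₀`, the
neighbourhood of `rk₀` on the tiles, and $W$ is chosen last, with an invariance that depends on
`rk`. -/
theorem IsRightAmenableNormal.continuousOn_extendedRank (hQ : WeakQuasitiling F U) :
    ContinuousOn (extendedRank F ω) (invariantRankSpace R U) := by
  classical
  have hF := hA.toIsFiniteApproximationSystem
  have hU := hA.toIsNormal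
  rw [continuousOn_pi]
  intro n
  rw [continuousOn_pi]
  intro m
  rw [continuousOn_pi]
  intro A rk₀ hrk₀
  rw [ContinuousWithinAt, Metric.tendsto_nhds]
  intro η hη
  let v₀ : Finset S := Finset.univ.image fun p : Fin n × Fin m => A p.1 p.2
  obtain ⟨V₀, hV₀, hv₀⟩ := hF.exists_nonzero_le (Submodule.span R v₀) ⟨v₀, rfl⟩
  have hAV : ∀ i j, A i j ∈ V₀ := fun i j => hv₀ (Submodule.subset_span
    (Finset.mem_coe.2 (Finset.mem_image_of_mem (fun p : Fin n × Fin m => A p.1 p.2)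
      (Finset.mem_univ (i, j)))))
  obtain ⟨q, b, hb⟩ := hU.exists_basis V₀ hV₀.1
  obtain ⟨v, ε₁, hε₁, hv⟩ := (hA.exists_forall_tendsto hω hrk₀ A).2 (η / 20) (by positivity)
  -- `V` makes the tiles invariant enough for the limit estimate at `rk₀`. The smaller `V₀`, whose
  -- rank `q` enters the bound on `ε`, only has to contain the entries of $A$.
  obtain ⟨V, hV, hvV⟩ := hF.exists_nonzero_le (V₀ ⊔ Submodule.span R v)
    (((Module.Finite.iff_fg).1 (hF.free _ hV₀.1).1).sup ⟨v, rfl⟩)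
  obtain ⟨ε, hε, hε₁', hε₂, hε₃⟩ : ∃ ε : ℝ, 0 < ε ∧ ε ≤ ε₁ ∧ ε ≤ 1 / 2 ∧
      (4 * q + 4) * n * ε ≤ η / 2 := by
    have hpos : (0 : ℝ) < (4 * q + 4) * n + 1 := by positivity
    refine ⟨min ε₁ (min (1 / 2) (η / 2 / ((4 * q + 4) * n + 1))), by positivity, min_le_left _ _,
      (min_le_right _ _).trans (min_le_left _ _), ?_⟩
    calc (4 * q + 4) * n * min ε₁ (min (1 / 2) (η / 2 / ((4 * q + 4) * n + 1)))
        ≤ ((4 * q + 4) * n + 1) * (η / 2 / ((4 * q + 4) * n + 1)) := by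
          gcongr
          · linarith
          · exact (min_le_right _ _).trans (min_le_right _ _)
      _ = η / 2 := by field_simp
  obtain ⟨N, T, hT, htile⟩ := hQ ε hε (hε₂.trans_lt (by norm_num)) V hV
  have hTinv : ∀ j, (freeDim R (T j ⊔ T j * V₀ : Submodule R S) : ℝ) ≤
      (1 + ε) * freeDim R (T j) := by
    intro j
    refine le_trans ?_ (hT j).2
    exact_mod_cast hF.freeDim_mono (hF.sup_mem _ (hT j).1.1 _ (hU.mul_mem hF (hT j).1.1 hV₀.1))
      (hF.sup_mem _ (hT j).1.1 _ (hU.mul_mem hF (hT j).1.1 hV.1))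
      (sup_le_sup_left (mul_submodule_mono_right (le_sup_left.trans hvV)) _)
  have hT₀ : ∀ j, |rankOn F rk₀ (T j) A - extendedRank F ω rk₀ n m A * freeDim R (T j)| ≤
      η / 20 * freeDim R (T j) := by
    intro j
    have hpos : (0 : ℝ) < freeDim R (T j) := by
      exact_mod_cast hF.freeDim_pos (hT j).1.1 (hT j).1.2
    have h1 := hv (T j) (hT j).1 ((hU.isInvariant_of_le hF hV.1 (v := v)
      (fun x hx => hvV (Submodule.mem_sup_right (Submodule.subset_span hx))) (hT j).1.1
      (hT j).2).mono subset_rfl hε₁')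
    have h2 : rankOn F rk₀ (T j) A - extendedRank F ω rk₀ n m A * freeDim R (T j) =
        (rankOn F rk₀ (T j) A / freeDim R (T j) - extendedRank F ω rk₀ n m A) *
          freeDim R (T j) := by field_simp
    rw [h2, abs_mul, abs_of_pos hpos]
    gcongr
  have hnear : ∀ᶠ rk in 𝓝[invariantRankSpace R U] rk₀, ∀ j : Fin N,
      |rankOn F rk (T j) A - rankOn F rk₀ (T j) A| < η / 20 := by
    refine eventually_all.2 fun j => Eventually.filter_mono nhdsWithin_le_nhds ?_
    have := Metric.tendsto_nhds.1 ((hF.continuous_rankOn (hT j).1.1 A).tendsto rk₀) (η / 20)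
      (by positivity)
    simpa only [Real.dist_eq] using this
  filter_upwards [hnear, self_mem_nhdsWithin] with rk hrk hmem
  rw [Real.dist_eq]
  obtain ⟨v', δ, hδ, hv'⟩ := (hA.exists_forall_tendsto hω hmem A).2 (η / 20) (by positivity)
  obtain ⟨V', hV', hvV'⟩ := hF.exists_nonzero_le (Submodule.span R v') ⟨v', rfl⟩
  obtain ⟨W, hW, hWinv, hWQ⟩ := htile δ hδ V' hV'
  obtain ⟨ι, s, τ, h1, h2, h3⟩ := hWQ.exists_sum_approx hF hU hV₀.1 b hb
    (hε₂.trans_lt (by norm_num)) (fun j => (hT j).1) hTinv hW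
  obtain ⟨h3, h4⟩ := h3 rk hmem n m A hAV
  have h6 := hv' W hW (hU.isInvariant_of_le hF hV'.1
    (fun x hx => hvV' (Submodule.subset_span hx)) hW.1 hWinv)
  have hw : (0 : ℝ) < freeDim R W := by exact_mod_cast hF.freeDim_pos hW.1 hW.2
  have hmem₀ := hA.extendedRank_mem hω hrk₀
  have h5 : |∑ x ∈ s, rankOn F rk (T (τ x)) A -
      extendedRank F ω rk₀ n m A * ∑ x ∈ s, (freeDim R (T (τ x)) : ℝ)| ≤
      2 * (η / 20) * ∑ x ∈ s, (freeDim R (T (τ x)) : ℝ) := by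
    rw [Finset.mul_sum, Finset.mul_sum, ← Finset.sum_sub_distrib]
    refine (Finset.abs_sum_le_sum_abs _ _).trans (Finset.sum_le_sum fun x _ => ?_)
    -- The factor 2 in `h5` has two sources: `rk` against `rk₀` on the tile, where $\dim T_j\ge1$
    -- normalizes the error, and the tile against the limit for `rk₀`.
    have h7 : (1 : ℝ) ≤ freeDim R (T (τ x)) := by
      exact_mod_cast hF.freeDim_pos (hT (τ x)).1.1 (hT (τ x)).1.2
    have h8 := hT₀ (τ x)
    have h9 := (hrk (τ x)).le
    have h10 : η / 20 * 1 ≤ η / 20 * freeDim R (T (τ x)) := by gcongr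
    rw [abs_le] at h8 h9 ⊢
    constructor <;> linarith
  rw [Finset.sum_sub_distrib, ← Finset.mul_sum, ← Finset.mul_sum, ← Finset.mul_sum] at h4
  -- With $\eta/20$ in place of $\eta$ the bound is at most $5\eta/20+\eta/2<\eta$.
  have := abs_sub_le_of_tiling hw (by positivity) hε hε₂ n.cast_nonneg q.cast_nonneg
    (hmem₀.nonneg n m A) (IsSylvester.le_rows hmem₀ A) h1 h2 h3 h4 h5 h6
  linarith

end Continuity

end

end SylvesterRank

open SylvesterRank in
theorem theorem1p2 {S : Type*} [Ring S] (R : Subring S) [InvariantBasisNumber R]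
    (F : Set (Submodule R S)) (U : Submonoid S)
    (hS : IsRightAmenableNormal F U) (hQ : WeakQuasitiling F U) :
    -- the domain is a compact convex set, and the target is convex
    (IsCompact (invariantRankSpace R U) ∧ Convex ℝ (invariantRankSpace R U) ∧
      Convex ℝ (rankSpace S)) ∧
    -- `rk_F` is well defined: non-principal ultrafilters exist, the limits along them exist,
    -- and the values of the limits do not depend on the ultrafilter
    ((∃ ω : Ultrafilter (nonzeroPart F), IsNonprincipal F ω) ∧
      (∀ ω : Ultrafilter (nonzeroPart F), IsNonprincipal F ω →
        ∀ rk ∈ invariantRankSpace R U, ∀ (n m : ℕ) (A : Matrix (Fin n) (Fin m) S),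
          Filter.Tendsto (normalizedRank F rk A) ω (nhds (extendedRank F ω rk n m A))) ∧
      (∀ ω ω' : Ultrafilter (nonzeroPart F), IsNonprincipal F ω → IsNonprincipal F ω' →
        Set.EqOn (extendedRank F ω) (extendedRank F ω') (invariantRankSpace R U))) ∧
    -- the map `rk ↦ rk_F` is affine and continuous
    ∀ ω : Ultrafilter (nonzeroPart F), IsNonprincipal F ω →
      Set.MapsTo (extendedRank F ω) (invariantRankSpace R U) (rankSpace S) ∧
      (∀ rk₁ ∈ invariantRankSpace R U, ∀ rk₂ ∈ invariantRankSpace R U,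
        ∀ t : ℝ, 0 ≤ t → t ≤ 1 →
          extendedRank F ω (t • rk₁ + (1 - t) • rk₂) =
            t • extendedRank F ω rk₁ + (1 - t) • extendedRank F ω rk₂) ∧
      ContinuousOn (extendedRank F ω) (invariantRankSpace R U) := by
  refine ⟨⟨isCompact_invariantRankSpace R U, convex_invariantRankSpace R U, convex_rankSpace S⟩,
    ⟨hS.exists_isNonprincipal, fun ω hω rk hrk n m A => hS.tendsto_normalizedRank hω hrk A,
      fun ω ω' hω hω' rk hrk => hS.extendedRank_congr hω hω' hrk⟩,
    fun ω hω => ⟨fun rk hrk => hS.extendedRank_mem hω hrk,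
      fun rk₁ h₁ rk₂ h₂ t ht ht' => hS.extendedRank_affine hω h₁ h₂ ht ht',
      hS.continuousOn_extendedRank hω hQ⟩⟩
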